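/- Consider $N\ge 1$ hard spheres of diameter $\varepsilon>0$ with $\varepsilon^2N=1$ on the torus $\mathbb T^3=[0,2\pi)^3$, with phase space $\mathcal M_N=\{Z_N=(x_i,v_i)_{i\le N}\in(\mathbb T^3\times\mathbb R^3)^N:\ |x_i-x_j|>\varepsilon,\ i\ne j\}$ and with the (almost everywhere defined) flow $\Phi^t_N$ of free motion and elastic binary collisions. Let $W_0^N$ be a probability density on $\mathcal M_N$ that is symmetric in the particles, let $W^N(t)=W_0^N\circ\Phi_N^{-t}$ be the time-evolved density, and let $f^N_{0,j}$ and $f^N_j(t)$, $1\le j\le N$, be the $j$-particle marginals of $W_0^N$ and $W^N(t)$ (for example $f^N_j(t)=\int W^N(t)\,dz_{j+1}\cdots dz_N$). The backward cluster $BC(1)=\{i_1,\dots,i_n\}$ of particle $1$ at time $t$ is obtained by following the trajectory backwards from time $t$ to time $0$: $i_1$ is the first particle colliding with particle $1$; given $i_1,\dots,i_r$, the particle $i_{r+1}$ is the first one outside $\{1,i_1,\dots,i_r\}$ to collide with one of $1,i_1,\dots,i_r$ when going further back in time. Let $\mathbb P^N(|BC(1)|=k)$ be the probability, under the initial density $W_0^N$,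 that $BC(1)$ at time $t$ has cardinality $k$. Let $A,\beta>0$. (1) Let $T>0$ and $t\in[0,T]$. There exist an integer $k_0\ge0$ and a constant $C>0$ such that, for every $N$ and every $W_0^N$ as above whose time-evolved marginals satisfy, for all $j=1,\dots,N$ and all $s\in[0,T]$, $$f^N_j(s)\prod_{i=1}^j e^{\frac\beta2v_i^2}\le A^j\quad\text{almost everywhere},$$ one has, for all integers $k>k_0$, $$\mathbb P^N(|BC(1)|=k)\le C\,t\,e^{-\frac14k^{\frac1{Ct}}}$$ (for $t=0$ the right-hand side is read as $0$). The constants $k_0$ and $C$ may depend on $t,T,A,\beta$, but not on $N$ or $W_0^N$. (2) (Lanford's setting, short times.) There is $T>0$, depending only on $A$ and $\beta$, such that for every $t\in[0,T]$ there exist an integer $k_0\ge0$ and $C>0$ for which the same tail bound at time $t$ holds for all $k>k_0$, all $N$ and all $W_0^N$ as above whose initial marginals satisfy $f^N_{0,j}\prod_{i=1}^j e^{\frac\beta2v_i^2}\le A^j$ almost everywhere for all $j=1,\dots,N$. -/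

import Mathlib

open MeasureTheory Set
open scoped ENNReal

namespace HardSpheres

instance twoPiPos : Fact (0 < 2 * Real.pi) := ⟨Real.two_pi_pos⟩

/-- Velocity space `ℝ³` with its Euclidean norm. -/
abbrev E3 := EuclideanSpace ℝ (Fin 3)

/-- The torus `[0, 2π)³` with Lebesgue measure (total mass `(2π)³`). -/
abbrev T3 := Fin 3 → AddCircle (2 * Real.pi)

/-- One-particle states `(x, v)`. -/
abbrev Particle := T3 × E3

/-- States of `N` particles; particle `1`, the tagged one, has index `0`. -/
abbrev Config (N : ℕ) := Fin N → Particle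

/-- The projection `ℝ³ → 𝕋³`. -/
noncomputable def toTorus (u : E3) : T3 := fun l => ((u l : ℝ) : AddCircle (2 * Real.pi))

/-- The flat (Euclidean) distance on the torus: the norm on `AddCircle (2π)` is the distance
to the nearest multiple of `2π`. -/
noncomputable def torusDist (x y : T3) : ℝ := Real.sqrt (∑ l, ‖x l - y l‖ ^ 2)

/-- The phase space `M_N`: spheres of diameter `ε` that neither overlap nor touch. -/
def phaseSpace (ε : ℝ) (N : ℕ) : Set (Config N) :=
  {Z | ∀ i j, i ≠ j → ε < torusDist (Z i).1 (Z j).1}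

/-- The spheres `i` and `j` touch in the configuration `Z`. -/
def InContact {N : ℕ} (ε : ℝ) (Z : Config N) (i j : Fin N) : Prop :=
  i ≠ j ∧ torusDist (Z i).1 (Z j).1 = ε

/-- The times at which some pair of spheres touches. -/
def collisionTimes {N : ℕ} (ε : ℝ) (ζ : ℝ → Config N) : Set ℝ :=
  {s | ∃ i j, InContact ε (ζ s) i j}

/-- `ζ` is a (two-sided, global in time) hard-sphere trajectory: free flight between collisions,
binary elastic collisions, finitely many of them in bounded time intervals.
At a collision time `ζ` records the outgoing velocities. -/
structure IsTrajectory {N : ℕ} (ε : ℝ) (ζ : ℝ → Config N) : Prop where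
  no_overlap : ∀ s i j, i ≠ j → ε ≤ torusDist (ζ s i).1 (ζ s j).1
  locally_finite : ∀ a b, (collisionTimes ε ζ ∩ Icc a b).Finite
  position : ∀ a b, a ≤ b → Disjoint (collisionTimes ε ζ) (Ioo a b) →
    ∀ i, (ζ b i).1 = (ζ a i).1 + toTorus ((b - a) • (ζ a i).2)
  velocity : ∀ a b, a ≤ b → Disjoint (collisionTimes ε ζ) (Ioc a b) →
    ∀ i, (ζ b i).2 = (ζ a i).2
  binary : ∀ s i j, InContact ε (ζ s) i j → ∀ k l, InContact ε (ζ s) k l →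
    (k = i ∧ l = j) ∨ (k = j ∧ l = i)
  /-- `a` is a time before the collision time `s` with no collision in `(a, s)`, so that
  `(ζ a i).2` is the incoming velocity of `i`; `ω = (x_i - x_j) / ε`. -/
  collision : ∀ a s, a < s → Disjoint (collisionTimes ε ζ) (Ioo a s) →
    ∀ i j, InContact ε (ζ s) i j →
      (∀ ω : E3, ‖ω‖ = 1 → (ζ s i).1 - (ζ s j).1 = toTorus (ε • ω) →
        inner ℝ ω ((ζ a i).2 - (ζ a j).2) < 0 ∧
        (ζ s i).2 = (ζ a i).2 - (inner ℝ ω ((ζ a i).2 - (ζ a j).2)) • ω ∧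
        (ζ s j).2 = (ζ a j).2 + (inner ℝ ω ((ζ a i).2 - (ζ a j).2)) • ω) ∧
      (∀ l, l ≠ i → l ≠ j → (ζ s l).2 = (ζ a l).2)

/-- There is a trajectory that is in the state `Z` at time `0`. -/
def WellPosed {N : ℕ} (ε : ℝ) (Z : Config N) : Prop :=
  ∃ ζ : ℝ → Config N, IsTrajectory ε ζ ∧ ζ 0 = Z

open Classical in
/-- The hard-sphere flow `Φ_N^s`, `s ∈ ℝ`: the state at time `s` of the trajectory starting
from `Z` (which is unique for `Z` in the phase space, and exists for almost all `Z` there). On the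
null set where there is no trajectory the value is immaterial. -/
noncomputable def flow {N : ℕ} (ε : ℝ) (s : ℝ) (Z : Config N) : Config N :=
  if h : WellPosed ε Z then h.choose s else Z

/-- `W₀` is a probability density on the phase space, symmetric in the particles. -/
structure IsSymmetricDensity {N : ℕ} (ε : ℝ) (W₀ : Config N → ℝ≥0∞) : Prop where
  measurable : Measurable W₀
  support : ∀ Z, Z ∉ phaseSpace ε N → W₀ Z = 0
  total : ∫⁻ Z, W₀ Z = 1
  symm : ∀ (σ : Equiv.Perm (Fin N)) (Z : Config N), W₀ (Z ∘ σ) = W₀ Z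

/-- The time-evolved density `W^N(t)`, transported along the flow. -/
noncomputable def evolvedDensity {N : ℕ} (ε : ℝ) (W₀ : Config N → ℝ≥0∞) (t : ℝ) :
    Config N → ℝ≥0∞ :=
  fun Z => W₀ (flow ε (-t) Z)

/-- The `j`-particle marginal `∫ W(z_1, …, z_N) dz_{j+1} ⋯ dz_N` of `W`. -/
noncomputable def marginal {N : ℕ} (W : Config N → ℝ≥0∞) (j : ℕ) (z : Fin j → Particle) :
    ℝ≥0∞ :=
  ∫⁻ w : {i : Fin N // j ≤ (i : ℕ)} → Particle,
    W (fun i => if h : (i : ℕ) < j then z ⟨i, h⟩ else w ⟨i, not_lt.mp h⟩)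

/-- All marginals of `W` satisfy `f_j ∏_{i ≤ j} exp (β v_i² / 2) ≤ A ^ j`. -/
def MarginalBound {N : ℕ} (β A : ℝ) (W : Config N → ℝ≥0∞) : Prop :=
  ∀ j : ℕ, 1 ≤ j → j ≤ N → ∀ᵐ z : Fin j → Particle,
    marginal W j z * ENNReal.ofReal (∏ i, Real.exp (β / 2 * ‖(z i).2‖ ^ 2)) ≤
      ENNReal.ofReal (A ^ j)

/-- The group formed by the particle `p` and those particles `i r` whose joining time `τ r` is
later than `s`, i.e. the particles already collected when one is going back in time to `s`. -/
def collectedAfter {N n : ℕ} (p : Fin N) (i : Fin n → Fin N) (τ : Fin n → ℝ) (s : ℝ) :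
    Set (Fin N) :=
  {a | a = p ∨ ∃ r, s < τ r ∧ i r = a}

/-- Going back from time `t` to time `0` along `ζ`, the ordered set `i_1, …, i_n` is the backward
cluster of `p`: at the times `τ_1 > τ_2 > ⋯ > τ_n` a new particle `i_r` collides with a particle
of the group collected so far, and the group has no other collision with a new particle. -/
structure IsBackwardCluster {N n : ℕ} (ε : ℝ) (ζ : ℝ → Config N) (t : ℝ) (p : Fin N)
    (i : Fin n → Fin N) (τ : Fin n → ℝ) : Prop where
  times_mem : ∀ r, τ r ∈ Icc 0 t
  times_anti : StrictAnti τ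
  new : ∀ r, i r ∉ collectedAfter p i τ (τ r)
  joins : ∀ r, ∃ a ∈ collectedAfter p i τ (τ r), InContact ε (ζ (τ r)) a (i r)
  exhaustive : ∀ s ∈ Icc 0 t, ∀ a ∈ collectedAfter p i τ s, ∀ b ∉ collectedAfter p i τ s,
    InContact ε (ζ s) a b → ∃ r, τ r = s ∧ i r = b

/-- The initial configurations for which, at time `t`, the dynamics being defined, the backward
cluster of particle `1` has cardinality `k`. -/
def clusterCardEvent (ε : ℝ) (N : ℕ) [NeZero N] (t : ℝ) (k : ℕ) : Set (Config N) :=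
  {Z | Z ∈ phaseSpace ε N ∧ WellPosed ε Z ∧
    ∃ (i : Fin k → Fin N) (τ : Fin k → ℝ),
      IsBackwardCluster ε (fun s => flow ε s Z) t 0 i τ}

/-- The probability that `|BC(1)| = k` at time `t`, for the initial density `W₀`. -/
noncomputable def clusterProb {N : ℕ} [NeZero N] (ε : ℝ) (W₀ : Config N → ℝ≥0∞) (t : ℝ)
    (k : ℕ) : ℝ≥0∞ :=
  (volume.withDensity W₀) (clusterCardEvent ε N t k)

end HardSpheres

open MeasureTheory Set
open scoped ENNReal

namespace HardSpheres

/-! ### Geometry and Lebesgue measure of the torus through representatives in `(-π, π]³`. -/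

section Torus

/-! Fix a time `s < t`. Read forwards from `s`, a backward cluster dissolves: the members collected
after `s` evolve by themselves, the one that joined last leaves in its collision with another
member, the remaining ones evolve by themselves, and so on until particle 1 is left at time `t`. A
particle that has left is never needed again, although it may recollide elsewhere. Thus for given
labels the event depends only on the states of those particles at time `s`, and its probability is
controlled by one marginal at time `s`, hence by `A ^ K` times a Gibbs weight.

The Gibbs measure of such states is estimated in discrete time. In a short step a group flies freely
or has one collision; these maps conserve energy, have Jacobian one, and have disjoint images, so
evolution costs nothing (`lintegral_gibbs_stepOp_le`). A departure in a step of length `h` confines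
the departing particle to a thin shell around a partner, which costs `ε² h` times a sum of
velocities. The sum is absorbed by raising the temperature: each of the `K` departures lowers the
inverse temperature by `β / (2K)`, so that it stays above `β / 2`
(`exists_lintegral_gibbs_shedOp_le`). The departures may occur at any of the steps, which yields
binomial coefficients by Pascal's rule, whose factorials cancel the powers of `K`
(`exists_weight_levelOp_iterate_le`, `exists_lintegral_treeCount_le`). The choices of labels, at
most `N ^ (n + j)`, are balanced by `ε² N = 1`. The probability that `j` particles join within the
last `l` slices of length `T` and `n` more in the preceding slice is therefore at most `c A (A C
T)^n (A C l T)^j` (`exists_withDensity_treeEvent_le`).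

This is small if `A C T` is small and `n` dominates `j`. Cut `[0, t]` into `m` slices, with `T = t /
m`, and put `y = k ^ (1/m)`. A cluster of size `k` must in some slice pass from at most `y ^ l` to
at least `y ^ (l+1)` joined particles (`exists_slice`), so `y j ≤ n + j`. The small factor to the
power `n` then beats the other one and leaves `exp (-y/4)` times a summable weight
(`pow_mul_pow_le_exp`). The a priori bound enters only at the starting times of the slices. For
short `t` one slice suffices, and only the initial bound is needed.

Discrete and continuous time are linked by `TrajOn.eventually_chain`: along a given trajectory every
fine mesh has at most one collision time per step. Fatou's lemma then transfers estimates for fixed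
step length to the flow, and determinism of the steps in both directions gives uniqueness of
trajectories and measurability of the flow. Existence of the flow almost everywhere is not needed,
since the cluster event contains well-posed states only. -/

lemma toTorus_add (u w : E3) : toTorus (u + w) = toTorus u + toTorus w := by
  funext l; simp [toTorus]

lemma toTorus_neg (u : E3) : toTorus (-u) = -toTorus u := by
  funext l; simp [toTorus]

lemma toTorus_sub (u w : E3) : toTorus (u - w) = toTorus u - toTorus w := by
  funext l; simp [toTorus]

@[simp] lemma toTorus_zero : toTorus 0 = 0 := by
  funext l; simp [toTorus]

@[fun_prop] lemma continuous_toTorus : Continuous toTorus := by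
  unfold toTorus
  refine continuous_pi fun l => (AddCircle.continuous_mk' _).comp ?_
  fun_prop

@[fun_prop] lemma measurable_toTorus : Measurable toTorus := continuous_toTorus.measurable

/-- The representative in `(-π, π]³` of a point of the torus. -/
noncomputable def lift (x : T3) : E3 :=
  WithLp.toLp 2 fun l => (AddCircle.equivIoc (2 * Real.pi) (-Real.pi) (x l) : ℝ)

lemma lift_apply (x : T3) (l : Fin 3) :
    lift x l = (AddCircle.equivIoc (2 * Real.pi) (-Real.pi) (x l) : ℝ) := rfl

@[simp] lemma toTorus_lift (x : T3) : toTorus (lift x) = x := by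
  funext l
  simp only [toTorus, lift_apply]
  exact AddCircle.coe_equivIoc

lemma lift_mem (x : T3) (l : Fin 3) : lift x l ∈ Ioc (-Real.pi) Real.pi := by
  have := (AddCircle.equivIoc (2 * Real.pi) (-Real.pi) (x l)).2
  rw [lift_apply]
  refine ⟨this.1, this.2.trans_eq ?_⟩
  ring

/-- The representative is coordinatewise the closest one to the origin, so that contact on the torus
becomes a statement about a Euclidean norm. -/
lemma torusDist_eq (x y : T3) : torusDist x y = ‖lift (x - y)‖ := by
  rw [torusDist, EuclideanSpace.norm_eq]
  congr 1
  refine Finset.sum_congr rfl fun l _ => ?_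
  congr 1
  have h1 : ((lift (x - y) l : ℝ) : AddCircle (2 * Real.pi)) = x l - y l :=
    congrFun (toTorus_lift (x - y)) l
  rw [← h1, (AddCircle.norm_coe_eq_abs_iff _ Real.two_pi_pos.ne').2, Real.norm_eq_abs]
  have := lift_mem (x - y) l
  rw [abs_of_pos Real.two_pi_pos, abs_le]
  constructor <;> linarith [this.1, this.2]

lemma lift_toTorus {u : E3} (hu : ‖u‖ < Real.pi) : lift (toTorus u) = u := by
  ext l
  rw [lift_apply]
  refine AddCircle.equivIoc_coe_of_mem ?_
  have : ‖u l‖ ≤ ‖u‖ := PiLp.norm_apply_le u l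
  rw [Real.norm_eq_abs] at this
  have := abs_lt.1 (this.trans_lt hu)
  constructor <;> linarith [this.1, this.2]

lemma torusDist_comm (x y : T3) : torusDist x y = torusDist y x := by
  unfold torusDist
  congr 1
  refine Finset.sum_congr rfl fun l _ => ?_
  rw [norm_sub_rev]

lemma torusDist_of_sub_eq {x y : T3} {u : E3} (h : x - y = toTorus u) (hu : ‖u‖ < Real.pi) :
    torusDist x y = ‖u‖ := by
  rw [torusDist_eq, h, lift_toTorus hu]

lemma exists_dir_of_torusDist_eq {x y : T3} {ε : ℝ} (hε : 0 < ε) (h : torusDist x y = ε) :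
    ∃ ω : E3, ‖ω‖ = 1 ∧ x - y = toTorus (ε • ω) := by
  rw [torusDist_eq] at h
  refine ⟨ε⁻¹ • lift (x - y), ?_, ?_⟩
  · rw [norm_smul, h, norm_inv, Real.norm_of_nonneg hε.le, inv_mul_cancel₀ hε.ne']
  · rw [smul_smul, mul_inv_cancel₀ hε.ne', one_smul, toTorus_lift]

@[fun_prop] lemma measurable_lift : Measurable lift := by
  unfold lift
  refine (PiLp.continuous_toLp 2 _).measurable.comp ?_
  refine measurable_pi_lambda _ fun l => ?_
  exact measurable_subtype_coe.comp
    ((AddCircle.measurableEquivIoc (2 * Real.pi) (-Real.pi)).measurable.comp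
      (measurable_pi_apply l))

/-- The fundamental domain `(-π, π]³` of the torus. -/
def fundBox : Set E3 := {y | ∀ l, y l ∈ Ioc (-Real.pi) Real.pi}

lemma measurePreserving_toTorus :
    MeasurePreserving toTorus (volume.restrict fundBox) volume := by
  have h1 : MeasurePreserving (fun (y : Fin 3 → ℝ) (l : Fin 3) => ((y l : ℝ) : AddCircle
    (2 * Real.pi)))
      (Measure.pi fun _ => volume.restrict (Ioc (-Real.pi) Real.pi)) volume := by
    refine measurePreserving_pi _ _ fun l => ?_
    have := AddCircle.measurePreserving_mk (2 * Real.pi) (-Real.pi)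
    rwa [show -Real.pi + 2 * Real.pi = Real.pi by ring] at this
  have h2 := (PiLp.volume_preserving_ofLp (Fin 3)).restrict_preimage
    (s := Set.pi univ fun _ => Ioc (-Real.pi) Real.pi)
    (MeasurableSet.univ_pi fun _ => measurableSet_Ioc)
  rw [volume_pi, Measure.restrict_pi_pi] at h2
  have h3 : WithLp.ofLp ⁻¹' (Set.pi univ fun _ => Ioc (-Real.pi) Real.pi) = fundBox := by
    ext y; simp [fundBox]
  rw [h3] at h2
  exact h1.comp h2

lemma mem_fundBox_of_norm_lt {u : E3} (hu : ‖u‖ < Real.pi) : u ∈ fundBox := by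
  intro l
  have : ‖u l‖ ≤ ‖u‖ := PiLp.norm_apply_le u l
  rw [Real.norm_eq_abs] at this
  have := abs_lt.1 (this.trans_lt hu)
  constructor <;> linarith [this.1, this.2]

lemma measurableSet_fundBox : MeasurableSet fundBox := by
  have : fundBox = ⋂ l, (fun y : E3 => y l) ⁻¹' Ioc (-Real.pi) Real.pi := by
    ext y; simp [fundBox]
  rw [this]
  refine MeasurableSet.iInter fun l => measurableSet_Ioc.preimage ?_
  fun_prop


instance : BorelSpace Particle := Prod.borelSpace
instance : StandardBorelSpace Particle := StandardBorelSpace.prod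
instance {N : ℕ} : BorelSpace (Config N) := Pi.borelSpace
instance {N : ℕ} : StandardBorelSpace (Config N) := StandardBorelSpace.pi_countable

instance : (volume : Measure T3).IsAddLeftInvariant :=
  inferInstanceAs (Measure.pi fun _ => (volume : Measure (AddCircle
    (2 * Real.pi)))).IsAddLeftInvariant
instance : (volume : Measure Particle).IsAddLeftInvariant :=
  Measure.prod.instIsAddLeftInvariant
end Torus

/-! ### Elastic scattering of the relative state in `ℝ³`. -/

section Scattering

open scoped RealInnerProductSpace

/-- The discriminant of the equation `‖y - s v‖ = ε` for `s`. -/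
noncomputable def disc (ε : ℝ) (p : E3 × E3) : ℝ :=
  ⟪p.1, p.2⟫ ^ 2 - ‖p.2‖ ^ 2 * (‖p.1‖ ^ 2 - ε ^ 2)

/-- The time elapsed since the relative position entered the ball of radius `ε`, if one has arrived
at the relative state `p` by free flight. -/
noncomputable def scatTime (ε : ℝ) (p : E3 × E3) : ℝ :=
  (⟪p.1, p.2⟫ + √(disc ε p)) / ‖p.2‖ ^ 2

/-- The unit vector at which the relative position entered the ball. -/
noncomputable def scatDir (ε : ℝ) (p : E3 × E3) : E3 := ε⁻¹ • (p.1 - scatTime ε p • p.2)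

/-- The component of the relative velocity along the direction of contact. -/
noncomputable def scatSpeed (ε : ℝ) (p : E3 × E3) : ℝ := ⟪scatDir ε p, p.2⟫

/-- The difference of position and velocity, of one of the two particles, between free flight and
collision. -/
noncomputable def scatKick (ε : ℝ) (p : E3 × E3) : E3 × E3 :=
  ((scatTime ε p * scatSpeed ε p) • scatDir ε p, scatSpeed ε p • scatDir ε p)

/-- The relative state produced by an elastic collision, from the one produced by free flight. -/
noncomputable def scat (ε : ℝ) (p : E3 × E3) : E3 × E3 := p - (2 : ℝ) • scatKick ε p

variable {ε : ℝ} {p : E3 × E3}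

lemma snd_ne_zero_of_disc_pos (h : 0 < disc ε p) : p.2 ≠ 0 := by
  intro h0
  simp [disc, h0] at h

/-- The larger root of the quadratic is the entry into the ball, as it lies farther in the past than
the exit; this fixes the negative sign. -/
lemma scatSpeed_eq (hε : 0 < ε) (h : 0 < disc ε p) : scatSpeed ε p = -√(disc ε p) / ε := by
  have hv : ‖p.2‖ ≠ 0 := norm_ne_zero_iff.2 (snd_ne_zero_of_disc_pos h)
  rw [scatSpeed, scatDir, real_inner_smul_left, inner_sub_left, real_inner_smul_left,
    real_inner_self_eq_norm_sq, scatTime]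
  field_simp
  ring

lemma scatSpeed_neg (hε : 0 < ε) (h : 0 < disc ε p) : scatSpeed ε p < 0 := by
  rw [scatSpeed_eq hε h, neg_div]
  exact neg_neg_of_pos (div_pos (Real.sqrt_pos.2 h) hε)

lemma norm_scatDir (hε : 0 < ε) (h : 0 < disc ε p) : ‖scatDir ε p‖ = 1 := by
  have hv : ‖p.2‖ ≠ 0 := norm_ne_zero_iff.2 (snd_ne_zero_of_disc_pos h)
  have h1 : scatTime ε p * ‖p.2‖ ^ 2 - ⟪p.1, p.2⟫ = √(disc ε p) := by
    rw [scatTime]; field_simp; ring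
  have h2 : √(disc ε p) ^ 2 = disc ε p := Real.sq_sqrt h.le
  have h3 : ‖p.1 - scatTime ε p • p.2‖ ^ 2 = ε ^ 2 := by
    rw [norm_sub_sq_real, real_inner_smul_right, norm_smul, mul_pow, Real.norm_eq_abs, sq_abs]
    rw [← h1, disc] at h2
    have : ‖p.2‖ ^ 2 * (‖p.1‖ ^ 2 - 2 * (scatTime ε p * ⟪p.1, p.2⟫) + scatTime ε p ^ 2 * ‖p.2‖ ^ 2
      - ε ^ 2) = 0 := by linear_combination h2
    rcases mul_eq_zero.1 this with h4 | h4
    · exact absurd h4 (pow_ne_zero 2 hv)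
    · linarith
  have h4 : ‖p.1 - scatTime ε p • p.2‖ = ε := by
    rwa [sq_eq_sq₀ (norm_nonneg _) hε.le] at h3
  rw [scatDir, norm_smul, h4, norm_inv, Real.norm_of_nonneg hε.le, inv_mul_cancel₀ hε.ne']

lemma fst_eq_scat (hε : 0 < ε) : p.1 = ε • scatDir ε p + scatTime ε p • p.2 := by
  rw [scatDir, smul_smul, mul_inv_cancel₀ hε.ne', one_smul, sub_add_cancel]

/-- For a state built from a contact direction, an incoming velocity and an elapsed time, the
discriminant is the square of `-ε ⟪ω, v⟫`. Positivity of that number selects the right root, so the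
data are recovered. -/
lemma scat_unique (hε : 0 < ε) {ω v : E3} {s : ℝ} (hω : ‖ω‖ = 1) (hc : ⟪ω, v⟫ < 0) :
    0 < disc ε (ε • ω + s • v, v) ∧ scatTime ε (ε • ω + s • v, v) = s ∧
      scatDir ε (ε • ω + s • v, v) = ω := by
  have hv : ‖v‖ ≠ 0 := by
    intro h
    rw [norm_eq_zero.1 h, inner_zero_right] at hc
    exact lt_irrefl _ hc
  have h1 : ⟪ε • ω + s • v, v⟫ = ε * ⟪ω, v⟫ + s * ‖v‖ ^ 2 := by
    rw [inner_add_left, real_inner_smul_left, real_inner_smul_left, real_inner_self_eq_norm_sq]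
  have h2 : ‖ε • ω + s • v‖ ^ 2 = ε ^ 2 + 2 * (ε * s * ⟪ω, v⟫) + s ^ 2 * ‖v‖ ^ 2 := by
    rw [norm_add_sq_real, norm_smul, norm_smul, mul_pow, mul_pow, hω, Real.norm_eq_abs, sq_abs,
      Real.norm_eq_abs, sq_abs, real_inner_smul_left, real_inner_smul_right]
    ring
  have h3 : disc ε (ε • ω + s • v, v) = (-(ε * ⟪ω, v⟫)) ^ 2 := by
    rw [disc, h1, h2]; ring
  have hpos : 0 < -(ε * ⟪ω, v⟫) := by nlinarith
  have h4 : scatTime ε (ε • ω + s • v, v) = s := by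
    rw [scatTime, h3, Real.sqrt_sq hpos.le, h1]
    field_simp
    ring
  refine ⟨by rw [h3]; positivity, h4, ?_⟩
  rw [scatDir, h4]
  simp only [add_sub_cancel_right, smul_smul]
  rw [inv_mul_cancel₀ hε.ne', one_smul]

lemma scat_snd : (scat ε p).2 = p.2 - (2 * scatSpeed ε p) • scatDir ε p := by
  simp [scat, scatKick, smul_smul]

lemma scat_fst (hε : 0 < ε) :
    (scat ε p).1 = ε • scatDir ε p + scatTime ε p • (scat ε p).2 := by
  rw [scat_snd]
  conv_lhs => rw [scat]
  simp only [scatKick, Prod.fst_sub, Prod.smul_fst]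
  nth_rw 1 [fst_eq_scat (p := p) hε]
  module

lemma inner_scatDir_scat_snd (hε : 0 < ε) (h : 0 < disc ε p) :
    ⟪scatDir ε p, (scat ε p).2⟫ = -scatSpeed ε p := by
  rw [scat_snd, inner_sub_right, real_inner_smul_right, real_inner_self_eq_norm_sq,
    norm_scatDir hε h]
  change scatSpeed ε p - _ = _
  ring

lemma norm_scat_snd (hε : 0 < ε) (h : 0 < disc ε p) : ‖(scat ε p).2‖ = ‖p.2‖ := by
  have : ‖(scat ε p).2‖ ^ 2 = ‖p.2‖ ^ 2 := by
    rw [scat_snd, norm_sub_sq_real, norm_smul, real_inner_smul_right, norm_scatDir hε h,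
      real_inner_comm, Real.norm_eq_abs, mul_one, sq_abs]
    change _ - 2 * (2 * scatSpeed ε p * scatSpeed ε p) + _ = _
    ring
  rwa [sq_eq_sq₀ (norm_nonneg _) (norm_nonneg _)] at this

/-- Reversal of the velocity. -/
def rev (p : E3 × E3) : E3 × E3 := (p.1, -p.2)

/-- Time reversal: with the velocity reversed the outgoing state is an incoming one at the same
point of contact, seen before the contact instead of after it. Hence the elapsed time changes sign.
-/
lemma disc_rev_scat (hε : 0 < ε) (h : 0 < disc ε p) :
    0 < disc ε (rev (scat ε p)) ∧ scatTime ε (rev (scat ε p)) = -scatTime ε p ∧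
      scatDir ε (rev (scat ε p)) = scatDir ε p := by
  have h1 := scat_unique (ε := ε) hε (ω := scatDir ε p) (v := -(scat ε p).2) (s := -scatTime ε p)
    (norm_scatDir hε h) (by
      rw [inner_neg_right, inner_scatDir_scat_snd hε h, neg_neg]; exact scatSpeed_neg hε h)
  have h2 : rev (scat ε p) =
      (ε • scatDir ε p + -scatTime ε p • -(scat ε p).2, -(scat ε p).2) := by
    rw [rev, neg_smul_neg, ← scat_fst hε]
  rwa [h2]

/-- Reversibility of collisions; it is the source of injectivity in `scat_injOn`. -/
lemma scat_rev_scat (hε : 0 < ε) (h : 0 < disc ε p) : scat ε (rev (scat ε p)) = rev p := by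
  obtain ⟨h1, h2, h3⟩ := disc_rev_scat hε h
  have h5 : scatSpeed ε (rev (scat ε p)) = scatSpeed ε p := by
    rw [scatSpeed, h3, rev]
    simp only
    rw [inner_neg_right, inner_scatDir_scat_snd hε h, neg_neg]
  have h4 : (scat ε (rev (scat ε p))).2 = -p.2 := by
    rw [scat_snd, h3, h5, rev]
    simp only
    rw [scat_snd]
    module
  ext1
  · rw [scat_fst hε, h4, h2, h3, neg_smul_neg, rev]
    exact (fst_eq_scat hε).symm
  · rw [h4, rev]

lemma scat_injOn (hε : 0 < ε) : InjOn (scat ε) {p | 0 < disc ε p} := by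
  intro p hp q hq hpq
  have h1 := scat_rev_scat hε hp
  rw [hpq, scat_rev_scat hε hq] at h1
  simpa [rev, Prod.ext_iff, eq_comm] using h1

end Scattering

/-! ### Scattering preserves Lebesgue measure. -/

section ScatteringMeasure

open scoped RealInnerProductSpace

/-- The linear shear `(q, p) ↦ (q + s p, p)`. -/
noncomputable def freeShear (s : ℝ) : (E3 × E3) ≃ₗ[ℝ] (E3 × E3) where
  toFun x := (x.1 + s • x.2, x.2)
  invFun x := (x.1 - s • x.2, x.2)
  map_add' x y := by ext1 <;> simp; module
  map_smul' c x := by ext1 <;> simp; module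
  left_inv x := by simp
  right_inv x := by simp

/-- Conjugation with the dilation of the second factor by 2 turns the shear `S` into `S ∘ S`, so
`det S = (det S)²`, and `det S ≠ 0` because `S` has an inverse. -/
lemma det_lowerShear (N : E3 →ₗ[ℝ] E3) :
    LinearMap.det (LinearMap.prod (LinearMap.fst ℝ E3 E3)
      (LinearMap.snd ℝ E3 E3 + N ∘ₗ LinearMap.fst ℝ E3 E3)) = 1 := by
  set S := LinearMap.prod (LinearMap.fst ℝ E3 E3)
      (LinearMap.snd ℝ E3 E3 + N ∘ₗ LinearMap.fst ℝ E3 E3) with hS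
  let e : (E3 × E3) ≃ₗ[ℝ] (E3 × E3) :=
    LinearEquiv.prodCongr (LinearEquiv.refl ℝ E3) (LinearEquiv.smulOfNeZero ℝ E3 2 two_ne_zero)
  have h1 : (e : (E3 × E3) →ₗ[ℝ] (E3 × E3)) ∘ₗ S ∘ₗ (e.symm : (E3 × E3) →ₗ[ℝ] (E3 × E3))
      = S ∘ₗ S := by
    refine LinearMap.ext fun x => ?_
    obtain ⟨y, rfl⟩ := e.surjective x
    simp only [LinearMap.comp_apply, LinearEquiv.coe_coe, LinearEquiv.symm_apply_apply]
    ext1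
    · simp [hS, e]
    · simp [hS, e, smul_add]
      module
  have h2 := LinearMap.det_conj S e
  have hinv : S ∘ₗ LinearMap.prod (LinearMap.fst ℝ E3 E3)
      (LinearMap.snd ℝ E3 E3 - N ∘ₗ LinearMap.fst ℝ E3 E3) = LinearMap.id := by
    refine LinearMap.ext fun x => ?_
    ext1 <;> simp [hS]
  have h3 : LinearMap.det S ≠ 0 := by
    intro h0
    have := congrArg LinearMap.det hinv
    rw [LinearMap.det_comp, h0, zero_mul, LinearMap.det_id] at this
    exact zero_ne_one this
  rw [h1, LinearMap.det_comp] at h2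
  exact mul_left_cancel₀ h3 (by rw [h2, mul_one])

/-- Up to a shear the map is `R` on both factors, and `(det R)² = det (R ∘ R) = 1`. -/
lemma det_reflection_shear (R : E3 →ₗ[ℝ] E3) (hR : R ∘ₗ R = LinearMap.id) (M : E3 →ₗ[ℝ] E3) :
    LinearMap.det (LinearMap.prod (R ∘ₗ LinearMap.fst ℝ E3 E3)
      (R ∘ₗ LinearMap.snd ℝ E3 E3 + M ∘ₗ LinearMap.fst ℝ E3 E3)) = 1 := by
  have h : LinearMap.prod (R ∘ₗ LinearMap.fst ℝ E3 E3)
      (R ∘ₗ LinearMap.snd ℝ E3 E3 + M ∘ₗ LinearMap.fst ℝ E3 E3) =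
      LinearMap.prodMap R R ∘ₗ LinearMap.prod (LinearMap.fst ℝ E3 E3)
      (LinearMap.snd ℝ E3 E3 + (R ∘ₗ M) ∘ₗ LinearMap.fst ℝ E3 E3) := by
    refine LinearMap.ext fun x => ?_
    have : R (R (M x.1)) = M x.1 := LinearMap.congr_fun hR _
    ext1 <;> simp [this]
  rw [h, LinearMap.det_comp, det_lowerShear, LinearMap.det_prodMap, mul_one, ← LinearMap.det_comp,
    hR, LinearMap.det_id]

variable {ε : ℝ}

lemma continuous_disc : Continuous (disc ε) := by
  unfold disc; fun_prop

lemma isOpen_disc_pos : IsOpen {p : E3 × E3 | 0 < disc ε p} :=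
  isOpen_lt continuous_const continuous_disc

lemma differentiableAt_scatTime {p : E3 × E3} (h : 0 < disc ε p) :
    DifferentiableAt ℝ (scatTime ε) p := by
  have hv := snd_ne_zero_of_disc_pos h
  have hd : DifferentiableAt ℝ (disc ε) p := by
    unfold disc
    have h1 : DifferentiableAt ℝ (fun p : E3 × E3 => ‖p.2‖ ^ 2) p :=
      (differentiableAt_snd).norm_sq ℝ
    have h2 : DifferentiableAt ℝ (fun p : E3 × E3 => ‖p.1‖ ^ 2) p :=
      (differentiableAt_fst).norm_sq ℝ
    have h3 : DifferentiableAt ℝ (fun p : E3 × E3 => ⟪p.1, p.2⟫) p :=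
      differentiableAt_fst.inner ℝ differentiableAt_snd
    fun_prop
  unfold scatTime
  have h1 : DifferentiableAt ℝ (fun p : E3 × E3 => ‖p.2‖ ^ 2) p :=
    (differentiableAt_snd).norm_sq ℝ
  have h3 : DifferentiableAt ℝ (fun p : E3 × E3 => ⟪p.1, p.2⟫) p :=
    differentiableAt_fst.inner ℝ differentiableAt_snd
  have h4 : DifferentiableAt ℝ (fun p : E3 × E3 => ⟪p.1, p.2⟫ + √(disc ε p)) p :=
    h3.add (hd.sqrt h.ne')
  have h5 : ‖p.2‖ ^ 2 ≠ 0 := pow_ne_zero 2 (norm_ne_zero_iff.2 hv)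
  simp only [div_eq_mul_inv]
  exact h4.mul (h1.inv h5)

/-- Flown back to the moment of contact, a perturbation acts as follows: its position part is
reflected, its velocity part is reflected and gets a correction that depends on the position part
alone. So the derivative is conjugate, by the free flight of duration `s`, to a block triangular map
with the reflection twice on the diagonal. -/
lemma exists_hasFDerivAt_scat (hε : 0 < ε) {p : E3 × E3} (h : 0 < disc ε p) :
    ∃ D : (E3 × E3) →L[ℝ] (E3 × E3), HasFDerivAt (scat ε) D p ∧ D.det = 1 := by
  set s := scatTime ε p with hs
  set ω := scatDir ε p with hω
  set c := scatSpeed ε p with hc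
  have hω1 : ‖ω‖ = 1 := norm_scatDir hε h
  have hc0 : c < 0 := scatSpeed_neg hε h
  obtain ⟨s', hs'⟩ := differentiableAt_scatTime h
  have hid1 : HasFDerivAt (fun p : E3 × E3 => p.1) (ContinuousLinearMap.fst ℝ E3 E3) p :=
    hasFDerivAt_fst
  have hid2 : HasFDerivAt (fun p : E3 × E3 => p.2) (ContinuousLinearMap.snd ℝ E3 E3) p :=
    hasFDerivAt_snd
  obtain ⟨ω', hω'⟩ : ∃ ω', HasFDerivAt (scatDir ε) ω' p :=
    ⟨_, (hid1.sub (hs'.smul hid2)).const_smul ε⁻¹⟩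
  have hω'eq : ∀ x, ε • ω' x = x.1 - s • x.2 - s' x • p.2 := by
    intro x
    have := hω'.unique ((hid1.sub (hs'.smul hid2)).const_smul ε⁻¹)
    rw [this]
    simp only [smul_apply, smul_smul, mul_inv_cancel₀ hε.ne', one_smul]
    simp [hs]
    module
  -- The contact direction stays on the unit sphere, so its derivative is orthogonal to it. This
  -- determines the derivative `s'` of the collision time.
  have horth : ∀ x, ⟪ω, ω' x⟫ = 0 := by
    intro x
    have h1 : HasFDerivAt (fun q => ⟪scatDir ε q, scatDir ε q⟫) _ p := hω'.inner ℝ hω'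
    have h2 : (fun q => ⟪scatDir ε q, scatDir ε q⟫) =ᶠ[nhds p] fun _ => (1 : ℝ) := by
      filter_upwards [isOpen_disc_pos.mem_nhds h] with q hq
      rw [real_inner_self_eq_norm_sq, norm_scatDir hε hq, one_pow]
    have h3 := (h1.congr_of_eventuallyEq h2.symm).unique (hasFDerivAt_const (1 : ℝ) p)
    have h4 := congrArg (fun L => L x) h3
    simp only [ContinuousLinearMap.comp_apply, zero_apply,
      ContinuousLinearMap.prod_apply, fderivInnerCLM_apply] at h4
    rw [real_inner_comm] at h4
    have h5 : ⟪ω, ω' x⟫ + ⟪ω, ω' x⟫ = 0 := by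
      rw [← hω] at h4
      linarith [real_inner_comm ω (ω' x)]
    linarith
  have hs'eq : ∀ x, s' x * c = ⟪ω, x.1 - s • x.2⟫ := by
    intro x
    have h1 := horth x
    have h2 : ⟪ω, ε • ω' x⟫ = 0 := by rw [real_inner_smul_right, h1, mul_zero]
    rw [hω'eq, inner_sub_right, real_inner_smul_right] at h2
    change _ - s' x * c = 0 at h2
    linarith
  let R : E3 →ₗ[ℝ] E3 := LinearMap.id - (2 : ℝ) • (innerₛₗ ℝ ω).smulRight ω
  have hRapp : ∀ x, R x = x - (2 * ⟪ω, x⟫) • ω := by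
    intro x; simp [R, smul_smul]
  have hR : R ∘ₗ R = LinearMap.id := by
    refine LinearMap.ext fun x => ?_
    simp only [LinearMap.comp_apply, hRapp, LinearMap.id_apply, inner_sub_right,
      real_inner_smul_right, real_inner_self_eq_norm_sq, hω1]
    module
  let η : E3 →ₗ[ℝ] E3 := ε⁻¹ • (LinearMap.id - (c⁻¹ • innerₛₗ ℝ ω).smulRight p.2)
  have hη : ∀ x, η x = ε⁻¹ • (x - (⟪ω, x⟫ / c) • p.2) := by
    intro x; simp [η, div_eq_inv_mul]
  -- The contact direction responds only to the displacement `x.1 - s • x.2` at the moment of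
  -- contact, which is what makes the conjugated derivative triangular.
  have hω'η : ∀ x, ω' x = η (x.1 - s • x.2) := by
    intro x
    have h1 := hω'eq x
    have h2 : s' x = ⟪ω, x.1 - s • x.2⟫ / c := by
      rw [← hs'eq, mul_div_cancel_right₀ _ hc0.ne]
    rw [hη, ← h2, ← h1, smul_smul, inv_mul_cancel₀ hε.ne', one_smul]
  let M : E3 →ₗ[ℝ] E3 := -(2 : ℝ) • ((innerₛₗ ℝ p.2 ∘ₗ η).smulRight ω + c • η)
  have hM : ∀ x, M x = -(2 : ℝ) • (⟪p.2, η x⟫ • ω + c • η x) := by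
    intro x; simp [M]
  let B := LinearMap.prod (R ∘ₗ LinearMap.fst ℝ E3 E3)
      (R ∘ₗ LinearMap.snd ℝ E3 E3 + M ∘ₗ LinearMap.fst ℝ E3 E3)
  have hspeed : HasFDerivAt (scatSpeed ε) _ p := hω'.inner ℝ hid2
  have hD : HasFDerivAt (scat ε) _ p :=
    (hasFDerivAt_id p).sub ((((hs'.mul hspeed).smul hω').prodMk (hspeed.smul hω')).const_smul
      (2 : ℝ))
  refine ⟨_, hD, ?_⟩
  have hap : ∀ y, freeShear s y = (y.1 + s • y.2, y.2) := fun _ => rfl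
  have hsym : ∀ x, (freeShear s).symm x = (x.1 - s • x.2, x.2) := fun _ => rfl
  have hB : ∀ y, B y = (R y.1, R y.2 + M y.1) := fun _ => rfl
  rw [ContinuousLinearMap.det, ← det_reflection_shear R hR M, ← LinearMap.det_conj B (freeShear s)]
  congr 1
  refine LinearMap.ext fun x => ?_
  rw [LinearMap.comp_apply, LinearMap.comp_apply, LinearEquiv.coe_coe, LinearEquiv.coe_coe, hsym,
    hB, hap]
  simp only [hRapp, hM, ← hω'η, ← hs'eq]
  simp only [ContinuousLinearMap.coe_coe, sub_apply, smul_apply,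
    ContinuousLinearMap.prod_apply, add_apply, ContinuousLinearMap.smulRight_apply,
    ContinuousLinearMap.comp_apply, fderivInnerCLM_apply, ContinuousLinearMap.coe_id', id_eq,
    ContinuousLinearMap.coe_snd', ← hs, ← hω, ← hc, smul_eq_mul, Pi.mul_apply]
  rw [real_inner_comm (ω' x) p.2]
  ext1
  · simp only [Prod.fst_sub, Prod.smul_fst]
    module
  · simp only [Prod.snd_sub, Prod.smul_snd]
    module

@[fun_prop] lemma measurable_disc : Measurable (disc ε) := continuous_disc.measurable

@[fun_prop] lemma measurable_scatTime : Measurable (scatTime ε) := by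
  unfold scatTime; fun_prop

@[fun_prop] lemma measurable_scatDir : Measurable (scatDir ε) := by
  unfold scatDir; fun_prop

@[fun_prop] lemma measurable_scatSpeed : Measurable (scatSpeed ε) := by
  unfold scatSpeed; fun_prop

instance : (volume : Measure (E3 × E3)).IsAddHaarMeasure :=
  inferInstanceAs ((volume : Measure E3).prod (volume : Measure E3)).IsAddHaarMeasure

lemma setLIntegral_scat (hε : 0 < ε) {U : Set (E3 × E3)} (hU : MeasurableSet U)
    (hUd : U ⊆ {p | 0 < disc ε p}) (φ : E3 × E3 → ℝ≥0∞) :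
    ∫⁻ p in U, φ (scat ε p) = ∫⁻ p in scat ε '' U, φ p := by
  choose! D hD using fun p (hp : p ∈ U) => exists_hasFDerivAt_scat hε (hUd hp)
  rw [lintegral_image_eq_lintegral_abs_det_fderiv_mul volume hU
    (fun x hx => (hD x hx).1.hasFDerivWithinAt) ((scat_injOn hε).mono hUd) φ]
  refine setLIntegral_congr_fun hU fun x hx => ?_
  simp [(hD x hx).2]

end ScatteringMeasure

/-! ### Collisions of two particles on the torus: measure, injectivity, energy. -/

section PairCollision

open scoped RealInnerProductSpace

variable {ε : ℝ}

lemma lift_toTorus_of_mem {u : E3} (hu : u ∈ fundBox) : lift (toTorus u) = u := by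
  ext l
  rw [lift_apply]
  refine AddCircle.equivIoc_coe_of_mem ⟨(hu l).1, (hu l).2.trans_eq ?_⟩
  ring

lemma lintegral_particle {f : Particle → ℝ≥0∞} (hf : Measurable f) :
    ∫⁻ z, f z = ∫⁻ p in fundBox ×ˢ univ, f (toTorus p.1, p.2) := by
  have h := measurePreserving_toTorus.prod (MeasurePreserving.id (volume : Measure E3))
  rw [← Measure.restrict_univ (μ := (volume : Measure E3)), Measure.prod_restrict,
    Measure.restrict_univ] at h
  exact (h.lintegral_comp hf).symm

/-- The relative state of two particles, with the position lifted to `(-π, π]³`. -/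
noncomputable def relState (z : Particle) : E3 × E3 := (lift z.1, z.2)

@[fun_prop] lemma measurable_relState : Measurable relState := by
  unfold relState; fun_prop

lemma relState_injective : Function.Injective relState := by
  intro z w h
  have h1 : lift z.1 = lift w.1 := (Prod.ext_iff.1 h).1
  have h2 : z.2 = w.2 := (Prod.ext_iff.1 h).2
  ext1
  · rw [← toTorus_lift z.1, h1, toTorus_lift]
  · exact h2

/-- The change that a collision causes to the state reached by free flight. -/
noncomputable def kick (ε : ℝ) (z : Particle) : Particle :=
  (toTorus (scatKick ε (relState z)).1, (scatKick ε (relState z)).2)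

@[fun_prop] lemma measurable_kick : Measurable (kick ε) := by
  unfold kick; fun_prop

/-- Relative states that free flight reaches by entering the ball of radius `ε` at most the time
`h` ago. -/
def collDom (ε h : ℝ) : Set Particle :=
  {z | 0 < disc ε (relState z) ∧ scatTime ε (relState z) ∈ Ico 0 h ∧ h * ‖z.2‖ ≤ ε / 4}

lemma measurableSet_collDom {h : ℝ} : MeasurableSet (collDom ε h) := by
  have h1 : MeasurableSet {z : Particle | 0 < disc ε (relState z)} :=
    measurableSet_lt measurable_const (by fun_prop)
  have h2 : MeasurableSet {z : Particle | scatTime ε (relState z) ∈ Ico 0 h} :=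
    measurableSet_Ico.preimage (by fun_prop)
  have h3 : MeasurableSet {z : Particle | h * ‖z.2‖ ≤ ε / 4} :=
    measurableSet_le (by fun_prop) measurable_const
  exact h1.inter (h2.inter h3)

lemma toTorus_scat (z : Particle) :
    (toTorus (scat ε (relState z)).1, (scat ε (relState z)).2) = z - kick ε z - kick ε z := by
  rw [scat, two_smul]
  ext1
  · simp only [Prod.fst_sub, Prod.fst_add, toTorus_sub, toTorus_add, kick, relState, toTorus_lift]
    abel
  · simp only [Prod.snd_sub, Prod.snd_add, kick, relState]
    abel

/-- Since the contact, the relative position has moved by at most `h ‖v‖ ≤ ε / 4`. For `ε ≤ 1` it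
therefore remains inside the fundamental box, where lifting to `ℝ³` loses nothing. -/
lemma norm_scat_fst_le (hε : 0 < ε) {h : ℝ} {p : E3 × E3} (hd : 0 < disc ε p)
    (hs : scatTime ε p ∈ Ico 0 h) (hv : h * ‖p.2‖ ≤ ε / 4) : ‖(scat ε p).1‖ ≤ 5 / 4 * ε := by
  rw [scat_fst hε]
  refine (norm_add_le _ _).trans ?_
  rw [norm_smul, norm_smul, norm_scatDir hε hd, norm_scat_snd hε hd, Real.norm_of_nonneg hε.le,
    Real.norm_of_nonneg hs.1]
  have := mul_le_mul_of_nonneg_right hs.2.le (norm_nonneg p.2)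
  linarith

lemma lt_pi_of_le (hε1 : ε ≤ 1) {x : ℝ} (hx : x ≤ 5 / 4 * ε) : x < Real.pi := by
  linarith [Real.pi_gt_three]

lemma relState_scat (hε : 0 < ε) (hε1 : ε ≤ 1) {h : ℝ} {z : Particle} (hz : z ∈ collDom ε h) :
    relState (z - kick ε z - kick ε z) = scat ε (relState z) := by
  rw [← toTorus_scat, relState]
  simp only
  rw [lift_toTorus (lt_pi_of_le hε1 (norm_scat_fst_le hε hz.1 hz.2.1 hz.2.2))]

lemma injOn_relative_collision (hε : 0 < ε) (hε1 : ε ≤ 1) {h : ℝ} :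
    InjOn (fun z => z - kick ε z - kick ε z) (collDom ε h) := by
  intro z hz w hw hzw
  have h1 := congrArg relState hzw
  simp only at h1
  rw [relState_scat hε hε1 hz, relState_scat hε hε1 hw] at h1
  exact relState_injective (scat_injOn hε hz.1 hw.1 h1)

/-- After lifting to the fundamental box this is the change of variables by `scat` with Jacobian
one; the image stays inside the box. An inequality suffices, so the image need not be identified. -/
lemma lintegral_relative_collision_le (hε : 0 < ε) (hε1 : ε ≤ 1) {h : ℝ} {φ : Particle → ℝ≥0∞}
    (hφ : Measurable φ) :
    ∫⁻ z, (collDom ε h).indicator (fun z => φ (z - kick ε z - kick ε z)) z ≤ ∫⁻ z, φ z := by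
  have hm : Measurable fun z => φ (z - kick ε z - kick ε z) := by fun_prop
  rw [lintegral_particle (hm.indicator measurableSet_collDom), lintegral_particle hφ]
  set U : Set (E3 × E3) := {p | p.1 ∈ fundBox ∧ 0 < disc ε p ∧ scatTime ε p ∈ Ico 0 h ∧
    h * ‖p.2‖ ≤ ε / 4} with hUdef
  have hU : MeasurableSet U := by
    have h0 : MeasurableSet {p : E3 × E3 | p.1 ∈ fundBox} :=
      measurableSet_fundBox.preimage measurable_fst
    have h1 : MeasurableSet {z : E3 × E3 | 0 < disc ε z} :=
      measurableSet_lt measurable_const (by fun_prop)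
    have h2 : MeasurableSet {z : E3 × E3 | scatTime ε z ∈ Ico 0 h} :=
      measurableSet_Ico.preimage (by fun_prop)
    have h3 : MeasurableSet {z : E3 × E3 | h * ‖z.2‖ ≤ ε / 4} :=
      measurableSet_le (by fun_prop) measurable_const
    exact h0.inter (h1.inter (h2.inter h3))
  have hbox : MeasurableSet (fundBox ×ˢ (univ : Set E3)) := measurableSet_fundBox.prod .univ
  calc ∫⁻ p in fundBox ×ˢ univ,
        (collDom ε h).indicator (fun z => φ (z - kick ε z - kick ε z)) (toTorus p.1, p.2)
      = ∫⁻ p in fundBox ×ˢ univ,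
        U.indicator (fun p => φ (toTorus (scat ε p).1, (scat ε p).2)) p := by
        refine setLIntegral_congr_fun hbox fun p hp => ?_
        have hrel : relState (toTorus p.1, p.2) = p := by
          rw [relState]; simp only; rw [lift_toTorus_of_mem hp.1]
        by_cases hpU : p ∈ U
        · rw [indicator_of_mem hpU, indicator_of_mem, ← toTorus_scat, hrel]
          rw [collDom, mem_ofPred_eq, hrel]
          exact hpU.2
        · rw [indicator_of_notMem hpU, indicator_of_notMem]
          rw [collDom, mem_ofPred_eq, hrel]
          exact fun hh => hpU ⟨hp.1, hh⟩
    _ ≤ ∫⁻ p, U.indicator (fun p => φ (toTorus (scat ε p).1, (scat ε p).2)) p :=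
        setLIntegral_le_lintegral _ _
    _ = ∫⁻ p in U, φ (toTorus (scat ε p).1, (scat ε p).2) := lintegral_indicator hU _
    _ = ∫⁻ p in scat ε '' U, φ (toTorus p.1, p.2) :=
        setLIntegral_scat hε hU (fun p hp => hp.2.1) fun p => φ (toTorus p.1, p.2)
    _ ≤ ∫⁻ p in fundBox ×ˢ univ, φ (toTorus p.1, p.2) := by
        refine lintegral_mono_set ?_
        rintro _ ⟨p, hp, rfl⟩
        exact ⟨mem_fundBox_of_norm_lt
          (lt_pi_of_le hε1 (norm_scat_fst_le hε hp.2.1 hp.2.2.1 hp.2.2.2)), mem_univ _⟩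

/-- In the variables `z - w` and `w`, a collision is the scattering of the first variable together
with a translation of the second one by an amount that depends on the first only. Translation
invariance and the relative estimate give the claim. -/
lemma lintegral_two_particles_le (hε : 0 < ε) (hε1 : ε ≤ 1) {h : ℝ}
    {g : Particle → Particle → ℝ≥0∞} (hg : Measurable (Function.uncurry g)) :
    ∫⁻ z, ∫⁻ w, (collDom ε h).indicator
      (fun _ => g (z - kick ε (z - w)) (w + kick ε (z - w))) (z - w) ≤ ∫⁻ z, ∫⁻ w, g z w := by
  have hg2 : ∀ {a b : Particle × Particle → Particle}, Measurable a → Measurable b →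
      Measurable fun p => g (a p) (b p) := fun ha hb => hg.comp (ha.prodMk hb)
  set F : Particle → Particle → ℝ≥0∞ := fun z w => (collDom ε h).indicator
      (fun _ => g (z - kick ε (z - w)) (w + kick ε (z - w))) (z - w) with hF
  have hFm : Measurable (Function.uncurry F) := by
    have : Function.uncurry F = ({p : Particle × Particle | p.1 - p.2 ∈ collDom ε h}).indicator
        fun p => g (p.1 - kick ε (p.1 - p.2)) (p.2 + kick ε (p.1 - p.2)) := by
      funext p; simp [Function.uncurry, hF, indicator]
    rw [this]
    exact (hg2 (by fun_prop) (by fun_prop)).indicator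
      (measurableSet_collDom.preimage (by fun_prop))
  have hΓm : Measurable fun z => ∫⁻ w, g (z + w) w :=
    Measurable.lintegral_prod_right' (f := fun p : Particle × Particle => g (p.1 + p.2) p.2)
      (hg2 (by fun_prop) (by fun_prop))
  calc ∫⁻ z, ∫⁻ w, F z w = ∫⁻ w, ∫⁻ z, F z w := lintegral_lintegral_swap hFm.aemeasurable
    _ = ∫⁻ w, ∫⁻ z, F (z + w) w := by
        refine lintegral_congr fun w => (lintegral_add_right_eq_self _ w).symm
    _ = ∫⁻ z, ∫⁻ w, F (z + w) w := by
        refine lintegral_lintegral_swap ?_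
        exact (hFm.comp (f := fun p : Particle × Particle => (p.2 + p.1, p.1))
          (by fun_prop)).aemeasurable
    _ = ∫⁻ z, (collDom ε h).indicator
          (fun z => (fun z => ∫⁻ w, g (z + w) w) (z - kick ε z - kick ε z)) z := by
        refine lintegral_congr fun z => ?_
        by_cases hz : z ∈ collDom ε h
        -- For fixed relative state `z` the kick is a fixed vector, and translating `w` by it
        -- removes it from the second argument.
        · simp only [hF, add_sub_cancel_right, indicator_of_mem hz]
          refine Eq.trans (lintegral_congr fun w => ?_) (lintegral_add_right_eq_self
            (fun w => g (z - kick ε z - kick ε z + w) w) (kick ε z))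
          congr 1
          abel_nf
        · simp [hF, indicator_of_notMem hz]
    _ ≤ ∫⁻ z, ∫⁻ w, g (z + w) w := lintegral_relative_collision_le hε hε1 hΓm
    _ = ∫⁻ w, ∫⁻ z, g (z + w) w := by
        refine lintegral_lintegral_swap ?_
        exact (hg2 (a := fun p : Particle × Particle => p.1 + p.2) (by fun_prop)
          measurable_snd).aemeasurable
    _ = ∫⁻ w, ∫⁻ z, g z w := by
        refine lintegral_congr fun w => lintegral_add_right_eq_self (fun z => g z w) w
    _ = ∫⁻ z, ∫⁻ w, g z w := (lintegral_lintegral_swap hg.aemeasurable).symm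

variable {N : ℕ}

/-- The elastic collision of `i` and `j`, applied to the state reached by free flight. -/
noncomputable def collide (ε : ℝ) (i j : Fin N) (Z : Config N) : Config N :=
  Function.update (Function.update Z i (Z i - kick ε (Z i - Z j))) j (Z j + kick ε (Z i - Z j))

lemma collide_left {i j : Fin N} (hij : i ≠ j) (Z : Config N) :
    collide ε i j Z i = Z i - kick ε (Z i - Z j) := by
  simp [collide, Function.update_of_ne hij]

lemma collide_right {i j : Fin N} (Z : Config N) :
    collide ε i j Z j = Z j + kick ε (Z i - Z j) := by
  simp [collide]

lemma collide_of_ne {i j k : Fin N} (hi : k ≠ i) (hj : k ≠ j) (Z : Config N) :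
    collide ε i j Z k = Z k := by
  simp [collide, Function.update_of_ne hi, Function.update_of_ne hj]

@[fun_prop] lemma measurable_collide {i j : Fin N} : Measurable (collide ε i j) := by
  refine measurable_pi_lambda _ fun k => ?_
  by_cases hj : k = j
  · subst hj
    simp only [collide_right]
    fun_prop
  · by_cases hi : k = i
    · subst hi
      simp only [collide_left hj]
      fun_prop
    · simp only [collide_of_ne hi hj]
      fun_prop

/-- Only two coordinates change, so it suffices to compare the partial integrals over these two with
the others frozen. -/
lemma lintegral_collide_le (hε : 0 < ε) (hε1 : ε ≤ 1) {h : ℝ} {i j : Fin N} (hij : i ≠ j)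
    {φ : Config N → ℝ≥0∞} (hφ : Measurable φ) :
    ∫⁻ Z, {Z : Config N | Z i - Z j ∈ collDom ε h}.indicator (fun Z => φ (collide ε i j Z)) Z ≤
      ∫⁻ Z, φ Z := by
  have hS : MeasurableSet {Z : Config N | Z i - Z j ∈ collDom ε h} :=
    measurableSet_collDom.preimage (by fun_prop)
  have hm : Measurable ({Z : Config N | Z i - Z j ∈ collDom ε h}.indicator
    (fun Z => φ (collide ε i j Z))) := (by fun_prop : Measurable _).indicator hS
  refine lintegral_le_of_lmarginal_le (μ := fun _ : Fin N => (volume : Measure Particle)) {i, j}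
    hm hφ fun x => ?_
  have hnot : i ∉ ({j} : Finset (Fin N)) := by simpa using hij
  rw [lmarginal_insert _ hm hnot, lmarginal_insert _ hφ hnot]
  simp only [lmarginal_singleton]
  refine le_trans (le_of_eq ?_) (lintegral_two_particles_le hε hε1 (h := h)
    (g := fun z w => φ (Function.update (Function.update x i z) j w)) ?_)
  · refine lintegral_congr fun z => lintegral_congr fun w => ?_
    have h1 : Function.update (Function.update x i z) j w i = z := by
      rw [Function.update_of_ne hij, Function.update_self]
    have h2 : Function.update (Function.update x i z) j w j = w := Function.update_self ..
    by_cases hzw : z - w ∈ collDom ε h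
    · rw [indicator_of_mem hzw, indicator_of_mem (by rwa [mem_ofPred_eq, h1, h2])]
      congr 1
      rw [collide, h1, h2, Function.update_comm hij, Function.update_idem,
        Function.update_comm hij.symm,
        Function.update_idem]
    · rw [indicator_of_notMem hzw, indicator_of_notMem (by rwa [mem_ofPred_eq, h1, h2])]
  · refine hφ.comp ?_
    refine measurable_pi_lambda _ fun k => ?_
    by_cases hj : k = j
    · subst hj
      simpa [Function.uncurry] using measurable_snd
    · by_cases hi : k = i
      · subst hi
        simpa [Function.uncurry, Function.update_of_ne hj] using measurable_fst
      · simp [Function.update_of_ne hj, Function.update_of_ne hi]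

lemma injOn_collide (hε : 0 < ε) (hε1 : ε ≤ 1) {h : ℝ} {i j : Fin N} (hij : i ≠ j) :
    InjOn (collide ε i j) {Z : Config N | Z i - Z j ∈ collDom ε h} := by
  intro Z hZ W hW hZW
  have hi := congrFun hZW i
  have hj := congrFun hZW j
  rw [collide_left hij, collide_left hij] at hi
  rw [collide_right, collide_right] at hj
  have hrel : Z i - Z j = W i - W j := by
    refine injOn_relative_collision hε hε1 hZ hW ?_
    calc Z i - Z j - kick ε (Z i - Z j) - kick ε (Z i - Z j)
        = (Z i - kick ε (Z i - Z j)) - (Z j + kick ε (Z i - Z j)) := by abel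
      _ = (W i - kick ε (W i - W j)) - (W j + kick ε (W i - W j)) := by rw [hi, hj]
      _ = _ := by abel_nf
  rw [hrel] at hi hj
  funext k
  by_cases hki : k = i
  · subst hki; exact sub_left_injective hi
  · by_cases hkj : k = j
    · subst hkj; exact add_left_injective _ hj
    · have := congrFun hZW k
      rwa [collide_of_ne hki hkj, collide_of_ne hki hkj] at this

/-- The kinetic energy. -/
noncomputable def energy (Z : Config N) : ℝ := ∑ k, ‖(Z k).2‖ ^ 2 / 2

@[fun_prop] lemma measurable_energy : Measurable (energy (N := N)) := by
  unfold energy; fun_prop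

lemma energy_nonneg (Z : Config N) : 0 ≤ energy Z :=
  Finset.sum_nonneg fun _ _ => by positivity

/-- The transferred velocity `w` is the projection of `v_i - v_j` onto the contact direction, so
`⟪w, v_i - v_j⟫ = ‖w‖²`, and the quadratic terms cancel the cross terms. -/
lemma energy_collide (hε : 0 < ε) {i j : Fin N} (hij : i ≠ j) {Z : Config N}
    (hd : 0 < disc ε (relState (Z i - Z j))) : energy (collide ε i j Z) = energy Z := by
  set p := relState (Z i - Z j) with hp
  have hw : (kick ε (Z i - Z j)).2 = scatSpeed ε p • scatDir ε p := rfl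
  have h1 : ⟪scatSpeed ε p • scatDir ε p, (Z i).2 - (Z j).2⟫ = scatSpeed ε p ^ 2 := by
    rw [real_inner_smul_left]
    change _ * scatSpeed ε p = _
    ring
  have h2 : ‖scatSpeed ε p • scatDir ε p‖ ^ 2 = scatSpeed ε p ^ 2 := by
    rw [norm_smul, norm_scatDir hε hd, mul_one, Real.norm_eq_abs, sq_abs]
  have hsplit : ∀ f : Fin N → ℝ, ∑ k, f k = f i + (f j + ∑ k ∈ (Finset.univ.erase i).erase j,
    f k) := by
    intro f
    rw [← Finset.add_sum_erase _ _ (Finset.mem_univ i),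
      ← Finset.add_sum_erase (Finset.univ.erase i) _ (Finset.mem_erase.2 ⟨hij.symm,
        Finset.mem_univ j⟩)]
  unfold energy
  rw [hsplit, hsplit (fun k => ‖(Z k).2‖ ^ 2 / 2), collide_left hij, collide_right]
  have h3 : ∑ k ∈ (Finset.univ.erase i).erase j, ‖(collide ε i j Z k).2‖ ^ 2 / 2 =
      ∑ k ∈ (Finset.univ.erase i).erase j, ‖(Z k).2‖ ^ 2 / 2 := by
    refine Finset.sum_congr rfl fun k hk => ?_
    rw [Finset.mem_erase, Finset.mem_erase] at hk
    rw [collide_of_ne hk.2.1 hk.1]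
  rw [h3, Prod.snd_sub, Prod.snd_add, hw, norm_sub_sq_real, norm_add_sq_real, h2]
  rw [inner_sub_right] at h1
  rw [real_inner_comm (scatSpeed ε p • scatDir ε p) (Z i).2,
    real_inner_comm (scatSpeed ε p • scatDir ε p) (Z j).2]
  linarith

end PairCollision

/-! ### One time step with at most one collision: determinism and measure. -/

section OneStep

variable {ε : ℝ} {N : ℕ}

/-- On a compact interval a strict inequality for a continuous function has a uniform gap `1 / (m +
1)`, and with a gap it may be tested at a countable dense set of times. -/
lemma measurableSet_forall_lt {α : Type*} [MeasurableSpace α] {d : ℝ → α → ℝ}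
    (hd : ∀ x, Continuous fun s => d s x) (hm : ∀ s, Measurable (d s)) (c h : ℝ) :
    MeasurableSet {x | ∀ s ∈ Ioc 0 h, c < d s x} := by
  have key : ∀ a b : ℝ, a ≤ b → MeasurableSet {x | ∀ s ∈ Icc a b, c < d s x} := by
    intro a b hab
    have heq : {x | ∀ s ∈ Icc a b, c < d s x} =
        ⋃ m : ℕ, ⋂ q : ℚ, {x | c + 1 / (m + 1) ≤ d (projIcc a b hab q) x} := by
      ext x
      simp only [mem_ofPred_eq, mem_iUnion, mem_iInter]
      constructor
      · intro hx
        obtain ⟨s, hs, hmin⟩ := isCompact_Icc.exists_isMinOn (nonempty_Icc.2 hab)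
          (hd x).continuousOn
        obtain ⟨m, hm⟩ := exists_nat_one_div_lt (sub_pos.2 (hx s hs))
        refine ⟨m, fun q => ?_⟩
        have := hmin (projIcc a b hab q).2
        simp only [mem_ofPred_eq] at this
        linarith
      · rintro ⟨m, hx⟩ s hs
        have hcl : IsClosed {q : ℝ | c + 1 / (m + 1) ≤ d (projIcc a b hab q) x} :=
          isClosed_le continuous_const
            ((hd x).comp (continuous_subtype_val.comp continuous_projIcc))
        have h1 : {q : ℝ | c + 1 / (m + 1) ≤ d (projIcc a b hab q) x} = univ := by
          -- Rationals projected into the interval serve as test times; closedness extends the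
          -- inequality with gap to all times.
          rw [← hcl.closure_eq]
          exact (Rat.denseRange_cast (𝕜 := ℝ)).mono (by rintro _ ⟨q, rfl⟩; exact hx q) |>.closure_eq
        have h2 : s ∈ {q : ℝ | c + 1 / (m + 1) ≤ d (projIcc a b hab q) x} := h1 ▸ mem_univ s
        simp only [mem_ofPred_eq, projIcc_of_mem hab hs] at h2
        have : (0 : ℝ) < 1 / (m + 1) := by positivity
        linarith
    rw [heq]
    exact .iUnion fun m => .iInter fun q => measurableSet_le measurable_const (hm _)
  -- The half-open interval is exhausted by compact intervals that avoid the time `0`, at which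
  -- contact is allowed.
  have heq : {x | ∀ s ∈ Ioc 0 h, c < d s x} =
      ⋂ n : ℕ, {x | 0 < h → ∀ s ∈ Icc (h / (n + 1)) h, c < d s x} := by
    ext x
    simp only [mem_ofPred_eq, mem_iInter]
    constructor
    · intro hx n hh s hs
      exact hx s ⟨lt_of_lt_of_le (by positivity) hs.1, hs.2⟩
    · intro hx s hs
      have hh := hs.1.trans_le hs.2
      obtain ⟨n, hn⟩ := exists_nat_one_div_lt (div_pos hs.1 hh)
      refine hx n hh s ⟨?_, hs.2⟩
      rw [lt_div_iff₀ hh] at hn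
      rw [div_eq_mul_one_div, mul_comm]
      exact hn.le
  rw [heq]
  refine .iInter fun n => ?_
  by_cases hh : 0 < h
  · simp only [hh, true_imp_iff]
    exact key _ _ (div_le_self hh.le (by linarith [n.cast_nonneg (α := ℝ)]))
  · simp [hh]

/-- Free flight. -/
noncomputable def freeFlow (s : ℝ) (Z : Config N) : Config N :=
  fun k => ((Z k).1 + toTorus (s • (Z k).2), (Z k).2)

lemma freeFlow_fst (s : ℝ) (Z : Config N) (k : Fin N) :
    (freeFlow s Z k).1 = (Z k).1 + toTorus (s • (Z k).2) := rfl

@[simp] lemma freeFlow_snd (s : ℝ) (Z : Config N) (k : Fin N) : (freeFlow s Z k).2 = (Z k).2 := rfl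

lemma freeFlow_freeFlow (s r : ℝ) (Z : Config N) :
    freeFlow s (freeFlow r Z) = freeFlow (s + r) Z := by
  funext k
  ext1
  · simp only [freeFlow, add_smul, toTorus_add]; abel
  · rfl

@[simp] lemma freeFlow_zero (Z : Config N) : freeFlow 0 Z = Z := by
  funext k; ext1 <;> simp [freeFlow]

@[simp] lemma energy_freeFlow (s : ℝ) (Z : Config N) : energy (freeFlow s Z) = energy Z := rfl

@[fun_prop] lemma measurable_freeFlow (s : ℝ) : Measurable (freeFlow (N := N) s) := by
  unfold freeFlow; fun_prop

lemma freeFlow_injective (s : ℝ) : Function.Injective (freeFlow (N := N) s) := by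
  intro Z W h
  have := congrArg (freeFlow (-s)) h
  simpa [freeFlow_freeFlow] using this

lemma measurePreserving_freeFlow (s : ℝ) :
    MeasurePreserving (freeFlow (N := N) s) volume volume := by
  have h1 : MeasurePreserving (fun p : E3 × T3 => (p.1, p.2 + toTorus (s • p.1)))
      ((volume : Measure E3).prod (volume : Measure T3))
      ((volume : Measure E3).prod (volume : Measure T3)) := by
    refine MeasurePreserving.skew_product (g := fun v x => x + toTorus (s • v))
      (MeasurePreserving.id _) ?_ ?_
    · simp only [Function.uncurry_def]; fun_prop
    · exact Filter.Eventually.of_forall fun v => (measurePreserving_add_right volume _).map_eq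
  have h2 : MeasurePreserving (fun z : Particle => ((z.1 + toTorus (s • z.2), z.2) : Particle))
      volume volume :=
    (Measure.measurePreserving_swap.comp h1).comp Measure.measurePreserving_swap
  exact volume_preserving_pi fun _ : Fin N => h2

/-- The velocities are so small that no particle moves farther than `ε / 8` in the time `h`. -/
def slow (ε h : ℝ) : Set (Config N) := {Z | ∀ k, h * ‖(Z k).2‖ ≤ ε / 8}

lemma measurableSet_slow {h : ℝ} : MeasurableSet (slow (N := N) ε h) := by
  simp only [slow, ofPred_forall]
  exact .iInter fun k => measurableSet_le (by fun_prop) measurable_const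

/-- The velocity transferred from `i` to `j` in the collision that precedes the state reached from
`Z` in the time `h`. -/
noncomputable def transfer (ε h : ℝ) (i j : Fin N) (Z : Config N) : E3 :=
  (kick ε (freeFlow h Z i - freeFlow h Z j)).2

/-- The time of the collision of `i` and `j`. -/
noncomputable def collTime (ε h : ℝ) (i j : Fin N) (Z : Config N) : ℝ :=
  h - scatTime ε (relState (freeFlow h Z i - freeFlow h Z j))

/-- The positions in the motion with a change of velocity `w` from `i` to `j` at the time `σ`. -/
noncomputable def brokenPos (Z : Config N) (i j : Fin N) (σ : ℝ) (w : E3) (s : ℝ)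
    (k : Fin N) : T3 :=
  (Z k).1 + toTorus (s • (Z k).2) +
    if k = i then -toTorus (max (s - σ) 0 • w) else if k = j then toTorus (max (s - σ) 0 • w) else 0

lemma brokenPos_of_le {Z : Config N} {i j : Fin N} {σ s : ℝ} {w : E3} (h : s ≤ σ) (k : Fin N) :
    brokenPos Z i j σ w s k = (freeFlow s Z k).1 := by
  simp [brokenPos, freeFlow, max_eq_right (sub_nonpos.2 h)]

lemma continuous_brokenPos (Z : Config N) (i j : Fin N) (σ : ℝ) (w : E3) (k : Fin N) :
    Continuous fun s => brokenPos Z i j σ w s k := by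
  unfold brokenPos
  split_ifs <;> fun_prop

/-- The kick in position is the elapsed time since contact times the kick in velocity. Hence free
flight backwards from the collided state retraces the broken path as far as the contact. -/
lemma collide_freeFlow_fst {h : ℝ} {i j : Fin N} (hij : i ≠ j) {Z : Config N}
    (h0 : 0 ≤ scatTime ε (relState (freeFlow h Z i - freeFlow h Z j))) {s : ℝ}
    (hs : s ≤ scatTime ε (relState (freeFlow h Z i - freeFlow h Z j))) (k : Fin N) :
    (freeFlow (-s) (collide ε i j (freeFlow h Z)) k).1 =
      brokenPos Z i j (collTime ε h i j Z) (transfer ε h i j Z) (h - s) k := by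
  set z := freeFlow h Z i - freeFlow h Z j with hz
  have hmax : max (h - s - collTime ε h i j Z) 0 = scatTime ε (relState z) - s := by
    rw [collTime, ← hz, max_eq_left (by linarith)]; ring
  have hk1 : (kick ε z).1 = toTorus (scatTime ε (relState z) • transfer ε h i j Z) := by
    rw [transfer, ← hz]; simp [kick, scatKick, smul_smul]
  have hk2 : (kick ε z).2 = transfer ε h i j Z := rfl
  rw [brokenPos, hmax, freeFlow_fst]
  by_cases hki : k = i
  · subst hki
    rw [collide_left hij, if_pos rfl, ← hz, Prod.fst_sub, Prod.snd_sub, hk1, hk2, freeFlow_fst,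
      freeFlow_snd]
    simp only [sub_smul, smul_sub, toTorus_sub, neg_smul, toTorus_neg]
    abel
  · by_cases hkj : k = j
    · subst hkj
      rw [collide_right, if_neg hki, if_pos rfl, ← hz, Prod.fst_add, Prod.snd_add, hk1, hk2,
        freeFlow_fst, freeFlow_snd]
      simp only [sub_smul, smul_add, toTorus_sub, neg_smul, toTorus_neg, toTorus_add]
      abel
    · rw [collide_of_ne hki hkj, if_neg hki, if_neg hkj, freeFlow_fst, freeFlow_snd]
      simp only [sub_smul, toTorus_sub, neg_smul, toTorus_neg]
      abel

/-- Free flight in the time interval `(0, h]` leads to no contact. -/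
def Free (ε h : ℝ) : Set (Config N) :=
  {Z | Z ∈ slow ε h ∧ ∀ k l, k ≠ l → ∀ s ∈ Ioc 0 h,
    ε < torusDist (freeFlow s Z k).1 (freeFlow s Z l).1}

/-- The spheres `i` and `j` collide in the time interval `(0, h]`, and there is no other contact. -/
def Coll (ε h : ℝ) (i j : Fin N) : Set (Config N) :=
  {Z | Z ∈ slow ε h ∧ freeFlow h Z i - freeFlow h Z j ∈ collDom ε h ∧
    ∀ k l, k ≠ l → ¬((k = i ∧ l = j) ∨ (k = j ∧ l = i)) → ∀ s ∈ Ioc 0 h,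
    ε < torusDist (brokenPos Z i j (collTime ε h i j Z) (transfer ε h i j Z) s k)
      (brokenPos Z i j (collTime ε h i j Z) (transfer ε h i j Z) s l)}

lemma measurable_torusDist {α : Type*} [MeasurableSpace α] {f g : α → T3} (hf : Measurable f)
    (hg : Measurable g) : Measurable fun a => torusDist (f a) (g a) := by
  simp only [torusDist_eq]
  exact (measurable_lift.comp (hf.sub hg)).norm

lemma continuous_torusDist_comp {α : Type*} [TopologicalSpace α] {f g : α → T3}
    (hf : Continuous f) (hg : Continuous g) : Continuous fun a => torusDist (f a) (g a) := by
  have hl : ∀ l, Continuous fun a => f a l - g a l := fun l =>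
    ((continuous_apply l).comp hf).sub ((continuous_apply l).comp hg)
  unfold torusDist
  exact (continuous_finsetSum _ fun l _ => (hl l).norm.pow 2).sqrt

lemma continuous_freeFlow_fst (Z : Config N) (k : Fin N) :
    Continuous fun s => (freeFlow s Z k).1 := by
  unfold freeFlow; fun_prop

lemma measurableSet_Free {h : ℝ} : MeasurableSet (Free (N := N) ε h) := by
  have heq : Free (N := N) ε h = slow ε h ∩ ⋂ k, ⋂ l, ⋂ (_ : k ≠ l), {Z | ∀ s ∈ Ioc 0 h,
      ε < torusDist (freeFlow s Z k).1 (freeFlow s Z l).1} := by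
    ext Z; simp only [Free, mem_inter_iff, mem_iInter, mem_ofPred_eq]
  rw [heq]
  refine measurableSet_slow.inter (.iInter fun k => .iInter fun l => .iInter fun _ => ?_)
  refine measurableSet_forall_lt (d := fun s (Z : Config N) =>
    torusDist (freeFlow s Z k).1 (freeFlow s Z l).1) ?_ ?_ ε h
  · intro Z
    exact continuous_torusDist_comp (continuous_freeFlow_fst Z k) (continuous_freeFlow_fst Z l)
  · intro s
    exact measurable_torusDist (f := fun Z : Config N => (freeFlow s Z k).1)
      (g := fun Z : Config N => (freeFlow s Z l).1) (by fun_prop) (by fun_prop)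

lemma measurableSet_Coll {h : ℝ} {i j : Fin N} : MeasurableSet (Coll ε h i j) := by
  have heq : Coll ε h i j = slow ε h ∩ ({Z | freeFlow h Z i - freeFlow h Z j ∈ collDom ε h} ∩
      ⋂ k, ⋂ l, ⋂ (_ : k ≠ l), ⋂ (_ : ¬((k = i ∧ l = j) ∨ (k = j ∧ l = i))), {Z | ∀ s ∈ Ioc 0 h,
        ε < torusDist (brokenPos Z i j (collTime ε h i j Z) (transfer ε h i j Z) s k)
          (brokenPos Z i j (collTime ε h i j Z) (transfer ε h i j Z) s l)}) := by
    ext Z; simp only [Coll, mem_inter_iff, mem_iInter, mem_ofPred_eq]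
  rw [heq]
  refine measurableSet_slow.inter ((measurableSet_collDom.preimage (by fun_prop)).inter
    (.iInter fun k => .iInter fun l => .iInter fun _ => .iInter fun _ => ?_))
  have hm : ∀ s k, Measurable fun Z : Config N =>
      brokenPos Z i j (collTime ε h i j Z) (transfer ε h i j Z) s k := by
    intro s k
    unfold brokenPos transfer collTime
    split_ifs <;> fun_prop
  refine measurableSet_forall_lt (d := fun s (Z : Config N) =>
    torusDist (brokenPos Z i j (collTime ε h i j Z) (transfer ε h i j Z) s k)
      (brokenPos Z i j (collTime ε h i j Z) (transfer ε h i j Z) s l)) ?_ ?_ ε h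
  · intro Z
    exact continuous_torusDist_comp (continuous_brokenPos ..) (continuous_brokenPos ..)
  · intro s
    exact measurable_torusDist (f := fun Z : Config N =>
        brokenPos Z i j (collTime ε h i j Z) (transfer ε h i j Z) s k)
      (g := fun Z : Config N => brokenPos Z i j (collTime ε h i j Z) (transfer ε h i j Z) s l)
      (hm s k) (hm s l)

/-- Ordered pairs of particles. -/
abbrev Pair (N : ℕ) := {p : Fin N × Fin N // p.1 < p.2}

/-- The states from which a time step proceeds by free flight (`none`), or with one collision. -/
def branchDom (ε h : ℝ) : Option (Pair N) → Set (Config N)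
  | none => Free ε h
  | some p => Coll ε h p.1.1 p.1.2

/-- The state after a time step, by free flight or with one collision. -/
noncomputable def branchMap (ε h : ℝ) : Option (Pair N) → Config N → Config N
  | none => freeFlow h
  | some p => fun Z => collide ε p.1.1 p.1.2 (freeFlow h Z)

lemma measurableSet_branchDom {h : ℝ} (q : Option (Pair N)) : MeasurableSet (branchDom ε h q) := by
  cases q
  · exact measurableSet_Free
  · exact measurableSet_Coll

@[fun_prop] lemma measurable_branchMap {h : ℝ} (q : Option (Pair N)) :
    Measurable (branchMap ε h q) := by
  cases q <;> simp only [branchMap] <;> fun_prop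

lemma energy_branchMap (hε : 0 < ε) {h : ℝ} {q : Option (Pair N)} {Z : Config N}
    (hZ : Z ∈ branchDom ε h q) : energy (branchMap ε h q Z) = energy Z := by
  cases q with
  | none => rfl
  | some p => exact energy_collide hε p.2.ne hZ.2.1.1

lemma injOn_branchMap (hε : 0 < ε) (hε1 : ε ≤ 1) {h : ℝ} (q : Option (Pair N)) :
    InjOn (branchMap ε h q) (branchDom ε h q) := by
  cases q with
  | none => exact (freeFlow_injective h).injOn
  | some p =>
    intro Z hZ W hW hZW
    exact freeFlow_injective h (injOn_collide hε hε1 p.2.ne hZ.2.1 hW.2.1 hZW)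

lemma lintegral_Coll_le (hε : 0 < ε) (hε1 : ε ≤ 1) {h : ℝ} {i j : Fin N} (hij : i ≠ j)
    {φ : Config N → ℝ≥0∞} (hφ : Measurable φ) :
    ∫⁻ Z, (Coll ε h i j).indicator (fun Z => φ (collide ε i j (freeFlow h Z))) Z ≤ ∫⁻ Z, φ Z := by
  have hS : MeasurableSet {Z : Config N | Z i - Z j ∈ collDom ε h} :=
    measurableSet_collDom.preimage (by fun_prop)
  have hm : Measurable ({Z : Config N | Z i - Z j ∈ collDom ε h}.indicator
    (fun Z => φ (collide ε i j Z))) := (by fun_prop : Measurable _).indicator hS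
  refine le_trans ?_ (lintegral_collide_le hε hε1 hij hφ (h := h))
  rw [← (measurePreserving_freeFlow h).lintegral_comp hm]
  refine lintegral_mono fun Z => ?_
  by_cases hZ : Z ∈ Coll ε h i j
  · have h2 : freeFlow h Z ∈ {Z : Config N | Z i - Z j ∈ collDom ε h} := hZ.2.1
    rw [indicator_of_mem hZ, indicator_of_mem h2]
  · rw [indicator_of_notMem hZ]
    exact zero_le

lemma lintegral_branch_le (hε : 0 < ε) (hε1 : ε ≤ 1) {h : ℝ} (q : Option (Pair N))
    {φ : Config N → ℝ≥0∞} (hφ : Measurable φ) :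
    ∫⁻ Z, (branchDom ε h q).indicator (fun Z => φ (branchMap ε h q Z)) Z ≤ ∫⁻ Z, φ Z := by
  cases q with
  | none =>
    refine le_trans ?_ ((measurePreserving_freeFlow h).lintegral_comp hφ).le
    exact lintegral_mono fun Z => indicator_le_self _ _ _
  | some p => exact lintegral_Coll_le hε hε1 p.2.ne hφ

/-- Two families of times of first contact exclude each other. -/
lemma pair_eq_of_first_contact {D : ℝ → Fin N → Fin N → ℝ} {P : ℝ → Prop} {s r : ℝ}
    {p q : Pair N} (hPs : P s) (hPr : P r) (hs : D s p.1.1 p.1.2 = ε) (hr : D r q.1.1 q.1.2 = ε)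
    (hs' : ∀ u ≤ s, P u → ∀ k l, k ≠ l → ¬((k = p.1.1 ∧ l = p.1.2) ∨ (k = p.1.2 ∧ l = p.1.1)) →
      ε < D u k l)
    (hr' : ∀ u ≤ r, P u → ∀ k l, k ≠ l → ¬((k = q.1.1 ∧ l = q.1.2) ∨ (k = q.1.2 ∧ l = q.1.1)) →
      ε < D u k l) : p = q := by
  by_contra hne
  have hpq : ¬((q.1.1 = p.1.1 ∧ q.1.2 = p.1.2) ∨ (q.1.1 = p.1.2 ∧ q.1.2 = p.1.1)) := by
    rintro (⟨h1, h2⟩ | ⟨h1, h2⟩)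
    · exact hne (Subtype.ext (Prod.ext h1.symm h2.symm))
    · have := p.2; have := q.2; rw [h1, h2] at this; exact absurd this (not_lt.2 p.2.le)
  have hqp : ¬((p.1.1 = q.1.1 ∧ p.1.2 = q.1.2) ∨ (p.1.1 = q.1.2 ∧ p.1.2 = q.1.1)) := by
    rintro (⟨h1, h2⟩ | ⟨h1, h2⟩)
    · exact hpq (Or.inl ⟨h1.symm, h2.symm⟩)
    · exact hpq (Or.inr ⟨h2.symm, h1.symm⟩)
  rcases le_total s r with h | h
  · exact absurd hs (hr' s h hPs _ _ p.2.ne hqp).ne'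
  · exact absurd hr (hs' r h hPr _ _ q.2.ne hpq).ne'

lemma freeFlow_sub {h s : ℝ} (Z : Config N) (k l : Fin N) :
    (freeFlow (h - s) Z k).1 - (freeFlow (h - s) Z l).1 =
      toTorus (lift (freeFlow h Z k - freeFlow h Z l).1 -
        s • (freeFlow h Z k - freeFlow h Z l).2) := by
  rw [toTorus_sub, toTorus_lift]
  simp only [freeFlow, Prod.fst_sub, Prod.snd_sub, sub_smul, smul_sub, toTorus_sub]
  abel

lemma torusDist_collTime (hε : 0 < ε) (hε1 : ε ≤ 1) {h : ℝ} {i j : Fin N} {Z : Config N}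
    (hZ : freeFlow h Z i - freeFlow h Z j ∈ collDom ε h) :
    (freeFlow (collTime ε h i j Z) Z i).1 - (freeFlow (collTime ε h i j Z) Z j).1 =
      toTorus (ε • scatDir ε (relState (freeFlow h Z i - freeFlow h Z j))) ∧
    torusDist (freeFlow (collTime ε h i j Z) Z i).1 (freeFlow (collTime ε h i j Z) Z j).1 = ε := by
  set p := relState (freeFlow h Z i - freeFlow h Z j) with hp
  have h1 : (freeFlow (collTime ε h i j Z) Z i).1 - (freeFlow (collTime ε h i j Z) Z j).1 =
      toTorus (ε • scatDir ε p) := by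
    rw [collTime, freeFlow_sub, ← hp]
    congr 1
    change p.1 - _ • p.2 = _
    rw [sub_eq_iff_eq_add]
    exact fst_eq_scat hε
  refine ⟨h1, ?_⟩
  have h2 : ‖ε • scatDir ε p‖ = ε := by
    rw [norm_smul, norm_scatDir hε hZ.1, mul_one, Real.norm_of_nonneg hε.le]
  rw [torusDist_of_sub_eq h1 (by rw [h2]; linarith [Real.pi_gt_three]), h2]

lemma collTime_mem {h : ℝ} {i j : Fin N} {Z : Config N}
    (hZ : freeFlow h Z i - freeFlow h Z j ∈ collDom ε h) : collTime ε h i j Z ∈ Ioc 0 h := by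
  have := hZ.2.1
  rw [collTime]
  constructor <;> linarith [this.1, this.2]

/-- Determinism forwards. Each branch follows free flight until its collision, so the earlier of two
collisions would be a forbidden contact for the other branch. -/
lemma branchDom_unique (hε : 0 < ε) (hε1 : ε ≤ 1) {h : ℝ} {q r : Option (Pair N)} {Z : Config N}
    (hq : Z ∈ branchDom ε h q) (hr : Z ∈ branchDom ε h r) : q = r := by
  have key : ∀ p : Pair N, Z ∈ Coll ε h p.1.1 p.1.2 → Z ∉ Free ε h := by
    intro p hp hf
    exact absurd (torusDist_collTime hε hε1 hp.2.1).2
      (hf.2 _ _ p.2.ne _ (collTime_mem hp.2.1)).ne'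
  match q, r, hq, hr with
  | none, none, _, _ => rfl
  | none, some p, hq, hr => exact absurd hq (key p hr)
  | some p, none, hq, hr => exact absurd hr (key p hq)
  | some p, some q, hq, hr =>
    have hfree : ∀ p : Pair N, Z ∈ Coll ε h p.1.1 p.1.2 → ∀ u ≤ collTime ε h p.1.1 p.1.2 Z, 0 < u →
        ∀ k l, k ≠ l → ¬((k = p.1.1 ∧ l = p.1.2) ∨ (k = p.1.2 ∧ l = p.1.1)) →
        ε < torusDist (freeFlow u Z k).1 (freeFlow u Z l).1 := by
      intro p hp u hu h0 k l hkl hne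
      have := hp.2.2 k l hkl hne u ⟨h0, hu.trans (collTime_mem hp.2.1).2⟩
      rwa [brokenPos_of_le hu, brokenPos_of_le hu] at this
    rw [pair_eq_of_first_contact (D := fun u k l => torusDist (freeFlow u Z k).1 (freeFlow u Z l).1)
      (P := fun u => 0 < u) (collTime_mem hq.2.1).1 (collTime_mem hr.2.1).1
      (torusDist_collTime hε hε1 hq.2.1).2 (torusDist_collTime hε hε1 hr.2.1).2
      (hfree p hq) (hfree q hr)]

/-- Determinism backwards: free flight back from the final state shows the last contact first, and
the same comparison of first contacts applies in reversed time. Disjointness of the images of the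
branches follows. -/
lemma branchMap_unique (hε : 0 < ε) (hε1 : ε ≤ 1) {h : ℝ} {q r : Option (Pair N)} {Z W : Config N}
    (hq : Z ∈ branchDom ε h q) (hr : W ∈ branchDom ε h r)
    (hZW : branchMap ε h q Z = branchMap ε h r W) : q = r := by
  have hcoll : ∀ (p : Pair N) (Z : Config N), Z ∈ Coll ε h p.1.1 p.1.2 →
      ∃ s, (0 ≤ s ∧ s < h) ∧ torusDist (freeFlow (-s) (branchMap ε h (some p) Z) p.1.1).1
          (freeFlow (-s) (branchMap ε h (some p) Z) p.1.2).1 = ε ∧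
        ∀ u ≤ s, (0 ≤ u ∧ u < h) → ∀ k l, k ≠ l →
          ¬((k = p.1.1 ∧ l = p.1.2) ∨ (k = p.1.2 ∧ l = p.1.1)) →
          ε < torusDist (freeFlow (-u) (branchMap ε h (some p) Z) k).1
            (freeFlow (-u) (branchMap ε h (some p) Z) l).1 := by
    intro p Z hp
    refine ⟨scatTime ε (relState (freeFlow h Z p.1.1 - freeFlow h Z p.1.2)), hp.2.1.2.1, ?_, ?_⟩
    · rw [branchMap, collide_freeFlow_fst p.2.ne hp.2.1.2.1.1 le_rfl,
        collide_freeFlow_fst p.2.ne hp.2.1.2.1.1 le_rfl, brokenPos_of_le (by rw [collTime]),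
        brokenPos_of_le (by rw [collTime])]
      exact (torusDist_collTime hε hε1 hp.2.1).2
    · intro u hu hu0 k l hkl hne
      rw [branchMap, collide_freeFlow_fst p.2.ne hp.2.1.2.1.1 hu,
        collide_freeFlow_fst p.2.ne hp.2.1.2.1.1 hu]
      exact hp.2.2 k l hkl hne _ ⟨by linarith [hu0.2], by linarith [hu0.1]⟩
  have key : ∀ (p : Pair N) (Z W : Config N), Z ∈ Coll ε h p.1.1 p.1.2 → W ∈ Free ε h →
      branchMap ε h (some p) Z ≠ freeFlow h W := by
    intro p Z W hp hf heq
    obtain ⟨s, hs, hs1, -⟩ := hcoll p Z hp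
    rw [heq, freeFlow_freeFlow] at hs1
    exact absurd hs1 (hf.2 _ _ p.2.ne _ ⟨by linarith, by linarith⟩).ne'
  match q, r, hq, hr, hZW with
  | none, none, _, _, _ => rfl
  | none, some p, hq, hr, hZW => exact absurd hZW.symm (key p W Z hr hq)
  | some p, none, hq, hr, hZW => exact absurd hZW (key p Z W hq hr)
  | some p, some q, hq, hr, hZW =>
    obtain ⟨s, hs, hs1, hs2⟩ := hcoll p Z hq
    obtain ⟨r, hr, hr1, hr2⟩ := hcoll q W hr
    rw [← hZW] at hr1 hr2
    rw [pair_eq_of_first_contact (D := fun u k l =>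
      torusDist (freeFlow (-u) (branchMap ε h (some p) Z) k).1
        (freeFlow (-u) (branchMap ε h (some p) Z) l).1)
      (P := fun u => 0 ≤ u ∧ u < h) hs hr hs1 hr1 hs2 hr2]

/-- The value of `φ` after one time step, and `0` if that is not defined. -/
noncomputable def stepOp (ε h : ℝ) (φ : Config N → ℝ≥0∞) (Z : Config N) : ℝ≥0∞ :=
  ∑ q : Option (Pair N), (branchDom ε h q).indicator (fun Z => φ (branchMap ε h q Z)) Z

@[fun_prop] lemma measurable_stepOp {h : ℝ} {φ : Config N → ℝ≥0∞} (hφ : Measurable φ) :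
    Measurable (stepOp ε h φ) := by
  unfold stepOp
  exact Finset.measurable_sum _ fun q _ => (hφ.comp (measurable_branchMap q)).indicator
    (measurableSet_branchDom q)

/-- No single branch increases integrals, and the images of distinct branches are disjoint, so the
sum over all branches costs no factor. -/
lemma lintegral_stepOp_le (hε : 0 < ε) (hε1 : ε ≤ 1) {h : ℝ} {φ : Config N → ℝ≥0∞}
    (hφ : Measurable φ) : ∫⁻ Z, stepOp ε h φ Z ≤ ∫⁻ Z, φ Z := by
  set Q : Option (Pair N) → Set (Config N) := fun q => branchMap ε h q '' branchDom ε h q with hQ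
  have hQm : ∀ q, MeasurableSet (Q q) :=
    fun q => (measurableSet_branchDom q).image_of_measurable_injOn
    (measurable_branchMap q) (injOn_branchMap hε hε1 q)
  have hm : ∀ q, Measurable ((branchDom ε h q).indicator fun Z => φ (branchMap ε h q Z)) :=
    fun q => (hφ.comp (measurable_branchMap q)).indicator (measurableSet_branchDom q)
  unfold stepOp
  rw [lintegral_finsetSum _ fun q _ => hm q]
  calc ∑ q, ∫⁻ Z, (branchDom ε h q).indicator (fun Z => φ (branchMap ε h q Z)) Z
      ≤ ∑ q, ∫⁻ Z, (Q q).indicator φ Z := by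
        refine Finset.sum_le_sum fun q _ => ?_
        refine le_trans (lintegral_mono fun Z => ?_)
          (lintegral_branch_le hε hε1 q (hφ.indicator (hQm q)) (h := h))
        by_cases hZ : Z ∈ branchDom ε h q
        · rw [indicator_of_mem hZ, indicator_of_mem hZ, indicator_of_mem (mem_image_of_mem _ hZ)]
        · rw [indicator_of_notMem hZ]
          exact zero_le
    _ = ∫⁻ Z, ∑ q, (Q q).indicator φ Z :=
        (lintegral_finsetSum _ fun q _ => hφ.indicator (hQm q)).symm
    _ ≤ ∫⁻ Z, φ Z := by
        refine lintegral_mono fun Z => ?_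
        by_cases hZ : ∃ q, Z ∈ Q q
        · obtain ⟨q, hq⟩ := hZ
          rw [Finset.sum_eq_single_of_mem q (Finset.mem_univ q)]
          · exact indicator_le_self _ _ _
          · intro r _ hrq
            refine indicator_of_notMem (fun hr => hrq ?_) _
            obtain ⟨W, hW, hWZ⟩ := hq
            obtain ⟨V, hV, hVZ⟩ := hr
            exact branchMap_unique hε hε1 hV hW (hVZ.trans hWZ.symm)
        · push Not at hZ
          rw [Finset.sum_eq_zero fun q _ => indicator_of_notMem (hZ q) _]
          exact zero_le

end OneStep

/-! ### The cost of a departure: a thin shell and a rise of temperature. -/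

section Shedding

open scoped RealInnerProductSpace

variable {ε : ℝ} {N : ℕ}

/-- The Gibbs weight with inverse temperature `b`. -/
noncomputable def gibbs (b : ℝ) (Z : Config N) : ℝ≥0∞ := ENNReal.ofReal (Real.exp (-b * energy Z))

@[fun_prop] lemma measurable_gibbs (b : ℝ) : Measurable (gibbs (N := N) b) := by
  unfold gibbs; fun_prop

/-- Energy is conserved by every branch, so the Gibbs weight may be moved inside the step. -/
lemma lintegral_gibbs_stepOp_le (hε : 0 < ε) (hε1 : ε ≤ 1) {h b : ℝ} {φ : Config N → ℝ≥0∞}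
    (hφ : Measurable φ) : ∫⁻ Z, gibbs b Z * stepOp ε h φ Z ≤ ∫⁻ Z, gibbs b Z * φ Z := by
  refine le_trans (le_of_eq ?_) (lintegral_stepOp_le hε hε1 (h := h) ((measurable_gibbs b).mul hφ))
  refine lintegral_congr fun Z => ?_
  rw [stepOp, stepOp, Finset.mul_sum]
  refine Finset.sum_congr rfl fun q _ => ?_
  by_cases hZ : Z ∈ branchDom ε h q
  · rw [indicator_of_mem hZ, indicator_of_mem hZ]
    simp only [gibbs, energy_branchMap hε hZ]
  · rw [indicator_of_notMem hZ, indicator_of_notMem hZ, mul_zero]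

/-- The configuration without its last particle. -/
def dropLast {m : ℕ} (Z : Config (m + 1)) : Config m := fun i => Z i.castSucc

@[fun_prop] lemma measurable_dropLast {m : ℕ} : Measurable (dropLast (m := m)) :=
  measurable_pi_lambda _ fun _ => measurable_pi_apply _

/-- The sum over `a` of the value of `φ` after one time step in which `a` and the last particle
collide and the last particle is then removed. -/
noncomputable def shedOp {m : ℕ} (ε h : ℝ) (φ : Config m → ℝ≥0∞) (Z : Config (m + 1)) : ℝ≥0∞ :=
  ∑ a : Fin m, (Coll ε h a.castSucc (Fin.last m)).indicator
    (fun Z => φ (dropLast (collide ε a.castSucc (Fin.last m) (freeFlow h Z)))) Z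

@[fun_prop] lemma measurable_shedOp {m : ℕ} {h : ℝ} {φ : Config m → ℝ≥0∞} (hφ : Measurable φ) :
    Measurable (shedOp ε h φ) := by
  unfold shedOp
  exact Finset.measurable_sum _ fun a _ => (by fun_prop : Measurable _).indicator measurableSet_Coll

/-- Pairs of particles that can have collided at most the time `h` ago. -/
def shell (ε h : ℝ) (z w : Particle) : Prop :=
  (ε ≤ torusDist z.1 w.1 ∧ torusDist z.1 w.1 ≤ ε + h * ‖z.2 - w.2‖) ∧ h * ‖z.2 - w.2‖ ≤ ε / 4

/-- The outgoing velocity points away along the contact direction, so the component of the relative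
position in that direction is at least `ε`; the time since contact is less than `h`. -/
lemma shell_collide (hε : 0 < ε) (hε1 : ε ≤ 1) {h : ℝ} {i j : Fin N} (hij : i ≠ j) {Z : Config N}
    (hZ : Z i - Z j ∈ collDom ε h) : shell ε h (collide ε i j Z i) (collide ε i j Z j) := by
  have hsub : collide ε i j Z i - collide ε i j Z j =
      Z i - Z j - kick ε (Z i - Z j) - kick ε (Z i - Z j) := by
    rw [collide_left hij, collide_right]; abel
  set p := relState (Z i - Z j) with hp
  have hrel : relState (collide ε i j Z i - collide ε i j Z j) = scat ε p := by
    rw [hsub]; exact relState_scat hε hε1 hZ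
  have hd : torusDist (collide ε i j Z i).1 (collide ε i j Z j).1 = ‖(scat ε p).1‖ := by
    rw [torusDist_eq, ← hrel]; rfl
  have hv : (collide ε i j Z i).2 - (collide ε i j Z j).2 = (scat ε p).2 := by
    rw [← hrel]; rfl
  have hvn : h * ‖(scat ε p).2‖ ≤ ε / 4 := by
    rw [norm_scat_snd hε hZ.1]; exact hZ.2.2
  have hω := norm_scatDir hε hZ.1
  rw [shell, hd, hv]
  refine ⟨⟨?_, ?_⟩, hvn⟩
  · have h1 : ⟪scatDir ε p, (scat ε p).1⟫ ≤ ‖(scat ε p).1‖ := by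
      simpa [hω, hp] using real_inner_le_norm (scatDir ε p) (scat ε p).1
    refine le_trans ?_ h1
    rw [scat_fst hε, inner_add_right, real_inner_smul_right, real_inner_smul_right,
      real_inner_self_eq_norm_sq, hω, inner_scatDir_scat_snd hε hZ.1]
    have := mul_nonneg hZ.2.1.1 (neg_nonneg.2 (scatSpeed_neg hε hZ.1).le)
    linarith
  · rw [scat_fst hε]
    refine (norm_add_le _ _).trans ?_
    rw [norm_smul, norm_smul, hω, Real.norm_of_nonneg hε.le, Real.norm_of_nonneg hZ.2.1.1, mul_one]
    exact add_le_add_right (mul_le_mul_of_nonneg_right hZ.2.1.2.le (norm_nonneg _)) _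

/-- The factor 4 bounds the volume difference of the balls: `(ε + r)³ - ε³ = 3ε²r + 3εr² + r³`, and
`r ≤ ε / 4`. -/
lemma volume_shell_le (hε : 0 < ε) {r : ℝ} (hr0 : 0 ≤ r) (hr : r ≤ ε / 4) (y : T3) :
    volume {x : T3 | ε ≤ torusDist y x ∧ torusDist y x ≤ ε + r} ≤
      ENNReal.ofReal (4 * ε ^ 2 * r) * volume (Metric.ball (0 : E3) 1) := by
  have hS1 : MeasurableSet {u : E3 | ε ≤ ‖u‖} := measurableSet_le measurable_const (by fun_prop)
  have hS2 : MeasurableSet {u : E3 | ‖u‖ ≤ ε + r} := measurableSet_le (by fun_prop) measurable_const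
  have hS : MeasurableSet {u : E3 | ε ≤ ‖u‖ ∧ ‖u‖ ≤ ε + r} := hS1.inter hS2
  have hS' : MeasurableSet {x : T3 | ε ≤ ‖lift x‖ ∧ ‖lift x‖ ≤ ε + r} :=
    hS.preimage measurable_lift
  have h1 : volume {x : T3 | ε ≤ torusDist y x ∧ torusDist y x ≤ ε + r} =
      volume {x : T3 | ε ≤ ‖lift x‖ ∧ ‖lift x‖ ≤ ε + r} := by
    rw [← (measurePreserving_sub_right volume y).measure_preimage hS'.nullMeasurableSet]
    congr 1
    ext x
    simp only [mem_ofPred_eq, mem_preimage, torusDist_comm y, torusDist_eq]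
  have h2 : volume {x : T3 | ε ≤ ‖lift x‖ ∧ ‖lift x‖ ≤ ε + r} ≤
      volume (Metric.closedBall (0 : E3) (ε + r) \ Metric.ball 0 ε) := by
    rw [← measurePreserving_toTorus.measure_preimage hS'.nullMeasurableSet,
      Measure.restrict_apply (hS'.preimage measurable_toTorus)]
    refine measure_mono ?_
    rintro u ⟨hu, hbox⟩
    simp only [mem_preimage, mem_ofPred_eq, lift_toTorus_of_mem hbox] at hu
    simpa [and_comm] using hu
  rw [h1]
  refine h2.trans ?_
  rw [measure_sdiff ((Metric.ball_subset_closedBall).trans (Metric.closedBall_subset_closedBall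
    (by linarith))) measurableSet_ball.nullMeasurableSet measure_ball_lt_top.ne,
    Measure.addHaar_closedBall _ _ (by linarith), Measure.addHaar_ball _ _ hε.le,
    ← ENNReal.sub_mul (by intro _ _; exact measure_ball_lt_top.ne),
    ← ENNReal.ofReal_sub _ (by positivity)]
  refine mul_le_mul_left (ENNReal.ofReal_le_ofReal ?_) _
  rw [finrank_euclideanSpace_fin]
  have : 0 ≤ ε * r * (ε / 4 - r) := by
    have := sub_nonneg.2 hr
    positivity
  have : 0 ≤ r ^ 2 * (ε / 4 - r) := by
    have := sub_nonneg.2 hr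
    positivity
  nlinarith [mul_pos hε hε, mul_nonneg (mul_pos hε hε).le hr0]

lemma lintegral_config_succ {m : ℕ} {f : Config (m + 1) → ℝ≥0∞} (hf : Measurable f) :
    ∫⁻ Z, f Z = ∫⁻ W : Config m, ∫⁻ z : Particle,
      f (Fin.snoc (α := fun _ => Particle) W z) := by
  have e := volume_preserving_piFinSuccAbove (fun _ : Fin (m + 1) => Particle) (Fin.last m)
  rw [← (e.symm).lintegral_comp hf]
  refine (lintegral_prod_symm _ ?_).trans ?_
  · exact (hf.comp (MeasurableEquiv.measurable _)).aemeasurable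
  · refine lintegral_congr fun W => lintegral_congr fun z => ?_
    congr 1
    exact Fin.insertNth_last' z W

lemma energy_snoc {m : ℕ} (W : Config m) (z : Particle) :
    energy (Fin.snoc (α := fun _ => Particle) W z) = energy W + ‖z.2‖ ^ 2 / 2 := by
  simp [energy, Fin.sum_univ_castSucc]

lemma dropLast_snoc {m : ℕ} (W : Config m) (z : Particle) :
    dropLast (Fin.snoc (α := fun _ => Particle) W z) = W := by
  funext i; simp [dropLast]

lemma integrable_exp_neg_mul_sq {b : ℝ} (hb : 0 < b) :
    Integrable fun v : E3 => Real.exp (-b * ‖v‖ ^ 2) := by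
  have := (GaussianFourier.integrable_cexp_neg_mul_sq_norm_add (V := E3) (b := b)
    (by simpa) 0 0).norm
  refine this.congr (Filter.Eventually.of_forall fun v => ?_)
  simp only [inner_zero_left, Complex.ofReal_zero, mul_zero, add_zero, Complex.norm_exp]
  congr 1
  rw [← Complex.ofReal_pow, ← Complex.ofReal_neg, ← Complex.ofReal_mul, Complex.ofReal_re]

/-- A single constant serves all inverse temperatures above `γ`, as is needed when the temperature
varies during the shedding. -/
lemma exists_gauss_moment {γ : ℝ} (hγ : 0 < γ) :
    ∃ g : ℝ, 0 < g ∧ ∀ b, γ ≤ b →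
      ∫⁻ v : E3, ENNReal.ofReal (Real.exp (-b * (‖v‖ ^ 2 / 2)) * (1 + ‖v‖)) ≤ ENNReal.ofReal g := by
  obtain ⟨c, hc⟩ : ∃ c : ℝ, ∀ x : ℝ, 0 ≤ x →
      Real.exp (-γ * (x ^ 2 / 2)) * (1 + x) ≤ c * Real.exp (-(γ / 4) * x ^ 2) := by
    refine ⟨1 + (1 + 4 / γ), fun x hx => ?_⟩
    have h1 : x ≤ (1 + 4 / γ) * Real.exp (γ / 4 * x ^ 2) := by
      have h2 := Real.add_one_le_exp (γ / 4 * x ^ 2)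
      have h3 : (1 + 4 / γ) * (γ / 4 * x ^ 2 + 1) ≤ (1 + 4 / γ) * Real.exp (γ / 4 * x ^ 2) := by
        gcongr
      refine le_trans ?_ h3
      have : (1 + 4 / γ) * (γ / 4 * x ^ 2 + 1) = x ^ 2 + 1 + (γ / 4 * x ^ 2 + 4 / γ) := by
        field_simp; ring
      rw [this]
      have : 0 ≤ γ / 4 * x ^ 2 + 4 / γ := by positivity
      nlinarith [sq_nonneg (x - 1)]
    have h4 : Real.exp (-γ * (x ^ 2 / 2)) =
      Real.exp (-(γ / 4) * x ^ 2) * Real.exp (-(γ / 4 * x ^ 2)) := by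
      rw [← Real.exp_add]; congr 1; ring
    have h5 : Real.exp (-(γ / 4 * x ^ 2)) * Real.exp (γ / 4 * x ^ 2) = 1 := by
      rw [← Real.exp_add, neg_add_cancel, Real.exp_zero]
    have h6 : Real.exp (-(γ / 4 * x ^ 2)) ≤ 1 := Real.exp_le_one_iff.2 (by
      have : 0 ≤ γ / 4 * x ^ 2 := by positivity
      linarith)
    rw [h4, mul_assoc, mul_comm (1 + (1 + 4 / γ))]
    refine mul_le_mul_of_nonneg_left ?_ (Real.exp_pos _).le
    have h7 := mul_le_mul_of_nonneg_left h1 (Real.exp_pos (-(γ / 4 * x ^ 2))).le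
    have h8 : Real.exp (-(γ / 4 * x ^ 2)) * ((1 + 4 / γ) * Real.exp (γ / 4 * x ^ 2)) =
      1 + 4 / γ := by
      linear_combination (1 + 4 / γ) * h5
    linarith
  have hint := (integrable_exp_neg_mul_sq (b := γ / 4) (by positivity)).const_mul c
  have hfin : ∫⁻ v : E3, ENNReal.ofReal (c * Real.exp (-(γ / 4) * ‖v‖ ^ 2)) < ⊤ := by
    refine lt_of_le_of_lt (lintegral_mono fun v => ?_) hint.2
    rw [← ofReal_norm]
    exact ENNReal.ofReal_le_ofReal (Real.le_norm_self _)
  refine ⟨(∫⁻ v : E3, ENNReal.ofReal (c * Real.exp (-(γ / 4) * ‖v‖ ^ 2))).toReal + 1, by positivity,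
    fun b hb => ?_⟩
  refine le_trans (lintegral_mono fun v => ?_) (le_trans (ENNReal.ofReal_toReal hfin.ne).ge
    (ENNReal.ofReal_le_ofReal (le_add_of_nonneg_right zero_le_one)))
  refine ENNReal.ofReal_le_ofReal (le_trans ?_ (hc ‖v‖ (norm_nonneg v)))
  gcongr

lemma measurableSet_shell {h : ℝ} {α : Type*} [MeasurableSpace α] {f g : α → Particle}
    (hf : Measurable f) (hg : Measurable g) : MeasurableSet {a | shell ε h (f a) (g a)} := by
  have h1 : Measurable fun a => torusDist (f a).1 (g a).1 :=
    measurable_torusDist (measurable_fst.comp hf) (measurable_fst.comp hg)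
  have h2 : Measurable fun a => h * ‖(f a).2 - (g a).2‖ := by fun_prop
  exact ((measurableSet_le measurable_const h1).inter (measurableSet_le h1 (by fun_prop))).inter
    (measurableSet_le h2 measurable_const)

/-- For a fixed velocity `v` the position lies in a shell of thickness `h ‖w - v‖`. The bound `‖w -
v‖ ≤ (1 + ‖w‖)(1 + ‖v‖)` separates the velocities and leaves a Gaussian moment. -/
lemma lintegral_shell_le (hε : 0 < ε) {h b g : ℝ} (hh : 0 ≤ h)
    (hgb : ∫⁻ v : E3, ENNReal.ofReal (Real.exp (-b * (‖v‖ ^ 2 / 2)) * (1 + ‖v‖)) ≤ ENNReal.ofReal g)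
    (w : Particle) :
    ∫⁻ z : Particle, ENNReal.ofReal (Real.exp (-b * (‖z.2‖ ^ 2 / 2))) *
        {z | shell ε h w z}.indicator 1 z ≤
      ENNReal.ofReal (4 * ε ^ 2 * h * g * (1 + ‖w.2‖)) * volume (Metric.ball (0 : E3) 1) := by
  have hm1 : MeasurableSet {z | shell ε h w z} := measurableSet_shell measurable_const measurable_id
  have hm : Measurable fun z : Particle => ENNReal.ofReal (Real.exp (-b * (‖z.2‖ ^ 2 / 2))) *
        {z | shell ε h w z}.indicator 1 z :=
    (by fun_prop : Measurable fun z : Particle =>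
      ENNReal.ofReal (Real.exp (-b * (‖z.2‖ ^ 2 / 2)))).mul (measurable_one.indicator hm1)
  calc ∫⁻ z : Particle, ENNReal.ofReal (Real.exp (-b * (‖z.2‖ ^ 2 / 2))) *
        {z | shell ε h w z}.indicator 1 z
      = ∫⁻ v : E3, ∫⁻ x : T3, ENNReal.ofReal (Real.exp (-b * (‖v‖ ^ 2 / 2))) *
        {z | shell ε h w z}.indicator 1 (x, v) := lintegral_prod_symm _ hm.aemeasurable
    _ ≤ ∫⁻ v : E3, ENNReal.ofReal (4 * ε ^ 2 * h * (1 + ‖w.2‖)) *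
          volume (Metric.ball (0 : E3) 1) *
          ENNReal.ofReal (Real.exp (-b * (‖v‖ ^ 2 / 2)) * (1 + ‖v‖)) := by
        refine lintegral_mono fun v => ?_
        have hmx : MeasurableSet {x : T3 | shell ε h w (x, v)} :=
          measurableSet_shell measurable_const (measurable_id.prodMk measurable_const)
        have hind : ∀ x : T3, {z | shell ε h w z}.indicator (1 : Particle → ℝ≥0∞) (x, v) =
            {x : T3 | shell ε h w (x, v)}.indicator 1 x := fun x => by simp [indicator]
        simp only [hind]
        rw [lintegral_const_mul _ (measurable_one.indicator hmx), lintegral_indicator_one hmx]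
        have hmain : volume {x : T3 | shell ε h w (x, v)} ≤
            ENNReal.ofReal (4 * ε ^ 2 * h * (1 + ‖w.2‖) * (1 + ‖v‖)) *
              volume (Metric.ball (0 : E3) 1) := by
          by_cases hr : h * ‖w.2 - v‖ ≤ ε / 4
          · refine (measure_mono fun x hx => hx.1).trans
              ((volume_shell_le hε (by positivity) hr w.1).trans ?_)
            gcongr ENNReal.ofReal ?_ * _
            have h1 : ‖w.2 - v‖ ≤ (1 + ‖w.2‖) * (1 + ‖v‖) := by
              refine (norm_sub_le _ _).trans ?_
              nlinarith [norm_nonneg w.2, norm_nonneg v,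
                mul_nonneg (norm_nonneg w.2) (norm_nonneg v)]
            calc 4 * ε ^ 2 * (h * ‖w.2 - v‖) ≤ 4 * ε ^ 2 * (h * ((1 + ‖w.2‖) * (1 + ‖v‖))) :=
                   by gcongr
              _ = _ := by ring
          · have : {x : T3 | shell ε h w (x, v)} = ∅ := by
              ext x; simp only [mem_ofPred_eq, mem_empty_iff_false, iff_false]
              exact fun hx => hr hx.2
            rw [this, measure_empty]
            exact zero_le
        calc ENNReal.ofReal (Real.exp (-b * (‖v‖ ^ 2 / 2))) * volume {x : T3 | shell ε h w (x, v)}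
            ≤ ENNReal.ofReal (Real.exp (-b * (‖v‖ ^ 2 / 2))) *
              (ENNReal.ofReal (4 * ε ^ 2 * h * (1 + ‖w.2‖) * (1 + ‖v‖)) *
              volume (Metric.ball (0 : E3) 1)) := by gcongr
          _ = _ := by
            rw [ENNReal.ofReal_mul (p := 4 * ε ^ 2 * h * (1 + ‖w.2‖)) (by positivity),
              ENNReal.ofReal_mul (Real.exp_pos _).le]
            ring
    _ ≤ ENNReal.ofReal (4 * ε ^ 2 * h * (1 + ‖w.2‖)) * volume (Metric.ball (0 : E3) 1) *
          ENNReal.ofReal g := by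
        rw [lintegral_const_mul _ (by fun_prop)]
        gcongr
    _ = _ := by
        rw [mul_right_comm, ← ENNReal.ofReal_mul (by positivity)]
        congr 2
        ring

/-- Shedding a particle costs a factor proportional to the length of the time step, and some
temperature. -/
lemma exists_lintegral_gibbs_shedOp_le {β : ℝ} (hβ : 0 < β) :
    ∃ C : ℝ, 0 < C ∧ ∀ {ε h b : ℝ} {m K : ℕ} {φ : Config m → ℝ≥0∞}, 0 < ε → ε ≤ 1 → 0 ≤ h →
      m ≤ K → 0 < K → β / 2 ≤ b → Measurable φ →
      ∫⁻ Z, gibbs b Z * shedOp ε h φ Z ≤ ENNReal.ofReal (C * K * ε ^ 2 * h) *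
        ∫⁻ W, gibbs (b - β / (2 * K)) W * φ W := by
  obtain ⟨g, hg, hgb⟩ := exists_gauss_moment (half_pos hβ)
  set κ := (volume (Metric.ball (0 : E3) 1)).toReal with hκ
  have hκ' : volume (Metric.ball (0 : E3) 1) = ENNReal.ofReal κ :=
    (ENNReal.ofReal_toReal measure_ball_lt_top.ne).symm
  -- `κ` is the volume of the unit ball, the geometric factor of the shells.
  have hκ0 : 0 < κ := ENNReal.toReal_pos (Metric.measure_ball_pos _ _ one_pos).ne'
    measure_ball_lt_top.ne
  refine ⟨4 * g * κ * (2 + 2 / β), by positivity, ?_⟩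
  intro ε h b m K φ hε hε1 hh hmK hK hb hφ
  have hinit : ∀ a : Fin m, Measurable fun Y : Config (m + 1) => gibbs b Y *
      ({Y : Config (m + 1) | shell ε h (Y a.castSucc) (Y (Fin.last m))}.indicator 1 Y *
        φ (dropLast Y)) := by
    intro a
    refine (measurable_gibbs b).mul ((measurable_one.indicator ?_).mul (by fun_prop))
    exact measurableSet_shell (measurable_pi_apply _) (measurable_pi_apply _)
  have hKpos : (0 : ℝ) < K := Nat.cast_pos.2 hK
  calc ∫⁻ Z, gibbs b Z * shedOp ε h φ Z
      = ∑ a : Fin m, ∫⁻ Z, gibbs b Z * (Coll ε h a.castSucc (Fin.last m)).indicator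
          (fun Z => φ (dropLast (collide ε a.castSucc (Fin.last m) (freeFlow h Z)))) Z := by
        simp only [shedOp, Finset.mul_sum]
        rw [lintegral_finsetSum]
        intro a _
        exact (measurable_gibbs b).mul ((by fun_prop : Measurable _).indicator measurableSet_Coll)
    _ ≤ ∑ a : Fin m, ∫⁻ Y : Config (m + 1), gibbs b Y *
          ({Y : Config (m + 1) | shell ε h (Y a.castSucc) (Y (Fin.last m))}.indicator 1 Y *
            φ (dropLast Y)) := by
        refine Finset.sum_le_sum fun a _ => ?_
        have hne : a.castSucc ≠ Fin.last m := (Fin.castSucc_lt_last a).ne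
        -- In the variables after the collision the departing particle lies in the shell around its
        -- partner. The passage to these variables costs nothing, and the departing particle can
        -- then be integrated out.
        refine le_trans (lintegral_mono fun Z => ?_)
          (lintegral_Coll_le hε hε1 hne (hinit a) (h := h))
        by_cases hZ : Z ∈ Coll ε h a.castSucc (Fin.last m)
        · rw [indicator_of_mem hZ, indicator_of_mem hZ, indicator_of_mem, Pi.one_apply, one_mul,
            gibbs,
            gibbs, energy_collide hε hne hZ.2.1.1, energy_freeFlow]
          exact shell_collide hε hε1 hne hZ.2.1
        · rw [indicator_of_notMem hZ, mul_zero]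
          exact zero_le
    _ = ∑ a : Fin m, ∫⁻ W : Config m, gibbs b W * φ W * ∫⁻ z : Particle,
          ENNReal.ofReal (Real.exp (-b * (‖z.2‖ ^ 2 / 2))) *
            {z | shell ε h (W a) z}.indicator 1 z := by
        refine Finset.sum_congr rfl fun a _ => ?_
        rw [lintegral_config_succ (hinit a)]
        refine lintegral_congr fun W => ?_
        rw [← lintegral_const_mul]
        · refine lintegral_congr fun z => ?_
          rw [dropLast_snoc, gibbs, energy_snoc, mul_add, Real.exp_add,
            ENNReal.ofReal_mul (Real.exp_pos _).le, gibbs]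
          have : {Y : Config (m + 1) | shell ε h (Y a.castSucc) (Y (Fin.last m))}.indicator
              (1 : Config (m + 1) → ℝ≥0∞) (Fin.snoc (α := fun _ => Particle) W z) =
              {z | shell ε h (W a) z}.indicator 1 z := by
            have e1 : Fin.snoc (α := fun _ => Particle) W z a.castSucc = W a := Fin.snoc_castSucc ..
            have e2 : Fin.snoc (α := fun _ => Particle) W z (Fin.last m) = z := Fin.snoc_last ..
            by_cases hz : shell ε h (W a) z
            · have hY : Fin.snoc (α := fun _ => Particle) W z ∈
                  {Y : Config (m + 1) | shell ε h (Y a.castSucc) (Y (Fin.last m))} := by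
                change shell ε h (Fin.snoc (α := fun _ => Particle) W z a.castSucc)
                  (Fin.snoc (α := fun _ => Particle) W z (Fin.last m))
                rwa [e1, e2]
              rw [indicator_of_mem hY, indicator_of_mem (s := {z | shell ε h (W a) z}) hz]
              rfl
            · have hY : Fin.snoc (α := fun _ => Particle) W z ∉
                  {Y : Config (m + 1) | shell ε h (Y a.castSucc) (Y (Fin.last m))} := by
                change ¬ shell ε h (Fin.snoc (α := fun _ => Particle) W z a.castSucc)
                  (Fin.snoc (α := fun _ => Particle) W z (Fin.last m))
                rwa [e1, e2]
              rw [indicator_of_notMem hY, indicator_of_notMem (s := {z | shell ε h (W a) z}) hz]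
          rw [this]
          ring
        · exact (by fun_prop : Measurable fun z : Particle =>
            ENNReal.ofReal (Real.exp (-b * (‖z.2‖ ^ 2 / 2)))).mul (measurable_one.indicator
              (measurableSet_shell measurable_const measurable_id))
    _ ≤ ∑ a : Fin m, ∫⁻ W : Config m, gibbs b W * φ W *
          ENNReal.ofReal (4 * ε ^ 2 * h * g * (1 + ‖(W a).2‖) * κ) := by
        refine Finset.sum_le_sum fun a _ => lintegral_mono fun W => ?_
        refine mul_le_mul_right ?_ _
        refine (lintegral_shell_le hε hh (hgb b hb) (W a)).trans_eq ?_
        rw [hκ', ENNReal.ofReal_mul (p := 4 * ε ^ 2 * h * g * (1 + ‖(W a).2‖)) (by positivity)]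
    _ = ∫⁻ W : Config m, gibbs b W * φ W *
          ENNReal.ofReal (∑ a : Fin m, 4 * ε ^ 2 * h * g * (1 + ‖(W a).2‖) * κ) := by
        rw [← lintegral_finsetSum]
        · refine lintegral_congr fun W => ?_
          rw [ENNReal.ofReal_sum_of_nonneg fun a _ => by positivity, Finset.mul_sum]
        · intro a _
          exact ((measurable_gibbs b).mul hφ).mul (by fun_prop)
    _ ≤ ∫⁻ W : Config m, ENNReal.ofReal (4 * g * κ * (2 + 2 / β) * K * ε ^ 2 * h) *
          (gibbs (b - β / (2 * K)) W * φ W) := by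
        refine lintegral_mono fun W => ?_
        have hE := energy_nonneg W
        -- `x ≤ 1 + x² / 2` trades speeds for kinetic energy.
        have hsum : ∑ a : Fin m, (1 + ‖(W a).2‖) ≤ 2 * K + energy W := by
          have h1 : ∀ a : Fin m, 1 + ‖(W a).2‖ ≤ 2 + ‖(W a).2‖ ^ 2 / 2 := fun a => by
            nlinarith [sq_nonneg (‖(W a).2‖ - 1)]
          refine (Finset.sum_le_sum fun a _ => h1 a).trans ?_
          rw [Finset.sum_add_distrib]
          have : (m : ℝ) ≤ K := Nat.cast_le.2 hmK
          simp only [Finset.sum_const, Finset.card_univ, Fintype.card_fin, nsmul_eq_mul]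
          rw [energy]
          linarith
        -- A factor linear in the energy is paid by the fraction `β / (2K)` of the inverse
        -- temperature. The price is a factor of order `K`, which later meets a factorial.
        have hexp : 2 * K + energy W ≤ (2 + 2 / β) * K * Real.exp (β / (2 * K) * energy W) := by
          have h1 := Real.add_one_le_exp (β / (2 * K) * energy W)
          have h2 : (2 + 2 / β) * K * (β / (2 * K) * energy W + 1) ≤
            (2 + 2 / β) * K * Real.exp (β / (2 * K) * energy W) := by gcongr
          refine le_trans ?_ h2
          have : (2 + 2 / β) * K * (β / (2 * K) * energy W + 1) =
              2 * K + energy W + (β * energy W + 2 / β * K) := by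
            field_simp; ring
          rw [this]
          have : 0 ≤ β * energy W + 2 / β * K := by positivity
          linarith
        have hS : ∑ a : Fin m, 4 * ε ^ 2 * h * g * (1 + ‖(W a).2‖) * κ ≤
            4 * g * κ * (2 + 2 / β) * K * ε ^ 2 * h * Real.exp (β / (2 * K) * energy W) := by
          calc ∑ a : Fin m, 4 * ε ^ 2 * h * g * (1 + ‖(W a).2‖) * κ
              = 4 * ε ^ 2 * h * g * κ * ∑ a : Fin m, (1 + ‖(W a).2‖) := by
                rw [Finset.mul_sum]; exact Finset.sum_congr rfl fun a _ => by ring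
            _ ≤ 4 * ε ^ 2 * h * g * κ * ((2 + 2 / β) * K * Real.exp (β / (2 * K) * energy W)) := by
                gcongr; exact hsum.trans hexp
            _ = _ := by ring
        have hgib : gibbs (b - β / (2 * K)) W =
            gibbs b W * ENNReal.ofReal (Real.exp (β / (2 * K) * energy W)) := by
          rw [gibbs, gibbs, ← ENNReal.ofReal_mul (Real.exp_pos _).le, ← Real.exp_add]
          congr 2; ring
        calc gibbs b W * φ W * ENNReal.ofReal (∑ a : Fin m, 4 * ε ^ 2 * h * g * (1 + ‖(W a).2‖) * κ)
            ≤ gibbs b W * φ W * ENNReal.ofReal (4 * g * κ * (2 + 2 / β) * K * ε ^ 2 * h *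
              Real.exp (β / (2 * K) * energy W)) := by gcongr
          _ = _ := by
            rw [ENNReal.ofReal_mul (by positivity), hgib]
            ring
    _ = _ := by rw [lintegral_const_mul _ (by fun_prop)]

end Shedding

/-! ### Counting the ways in which a group dissolves. -/

section Levels

variable {ε : ℝ}

/-- One time step backwards from a family of observables of groups: a group of `m + 1` particles
evolves by itself, or it loses its last particle in a collision. -/
noncomputable def levelOp (ε h : ℝ) (Φ : ∀ m, Config m → ℝ≥0∞) : ∀ m, Config m → ℝ≥0∞
  | 0 => stepOp ε h (Φ 0)
  | m + 1 => fun Z => stepOp ε h (Φ (m + 1)) Z + shedOp ε h (Φ m) Z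

lemma measurable_levelOp {h : ℝ} {Φ : ∀ m, Config m → ℝ≥0∞} (hΦ : ∀ m, Measurable (Φ m)) (m : ℕ) :
    Measurable (levelOp ε h Φ m) := by
  cases m with
  | zero => exact measurable_stepOp (hΦ 0)
  | succ m => exact (measurable_stepOp (hΦ (m + 1))).add (measurable_shedOp (hΦ m))

lemma measurable_levelOp_iterate {h : ℝ} {Φ : ∀ m, Config m → ℝ≥0∞} (hΦ : ∀ m, Measurable (Φ m))
    (M m : ℕ) : Measurable ((levelOp ε h)^[M] Φ m) := by
  induction M generalizing m with
  | zero => exact hΦ m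
  | succ M ih => rw [Function.iterate_succ_apply']; exact measurable_levelOp ih m

/-- The value at level `m` uses the levels `m` and `m - 1` only, so an observable that vanishes
below `m₀` continues to do so. -/
lemma levelOp_iterate_eq_zero {h : ℝ} {Φ : ∀ m, Config m → ℝ≥0∞} {m₀ : ℕ}
    (hΦ : ∀ m < m₀, Φ m = 0) (M : ℕ) : ∀ m < m₀, (levelOp ε h)^[M] Φ m = 0 := by
  induction M with
  | zero => exact hΦ
  | succ M ih =>
    intro m hm
    rw [Function.iterate_succ_apply']
    have hstep : ∀ m < m₀, stepOp ε h ((levelOp ε h)^[M] Φ m) = 0 := by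
      intro m hm
      funext Z
      simp [stepOp, ih m hm, indicator]
    cases m with
    | zero => exact hstep 0 hm
    | succ m =>
      funext Z
      simp [levelOp, hstep _ hm, shedOp, ih m (by omega), indicator]

/-- The integral of an observable of groups of `m` particles against a Gibbs weight that gets
hotter when `m` gets smaller. -/
noncomputable def weight (β : ℝ) (K : ℕ) (Φ : ∀ m, Config m → ℝ≥0∞) (m : ℕ) : ℝ≥0∞ :=
  ∫⁻ Z, gibbs (β / 2 + β * m / (2 * K)) Z * Φ m Z

/-- The inverse temperatures of neighbouring levels differ by exactly `β / (2K)`, the amount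
consumed by one departure. -/
lemma exists_weight_levelOp_le {β : ℝ} (hβ : 0 < β) :
    ∃ C : ℝ, 0 < C ∧ ∀ {ε h : ℝ} {K : ℕ} {Φ : ∀ m, Config m → ℝ≥0∞}, 0 < ε → ε ≤ 1 → 0 ≤ h →
      (∀ m, Measurable (Φ m)) → ∀ m, m < K →
      weight β K (levelOp ε h Φ) (m + 1) ≤ weight β K Φ (m + 1) +
        ENNReal.ofReal (C * K * ε ^ 2 * h) * weight β K Φ m := by
  obtain ⟨C, hC, H⟩ := exists_lintegral_gibbs_shedOp_le hβ
  refine ⟨C, hC, fun {ε h K Φ} hε hε1 hh hΦ m hm => ?_⟩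
  have hK : (0 : ℝ) < K := Nat.cast_pos.2 (by omega)
  simp only [weight, levelOp, mul_add]
  rw [lintegral_add_left (by have := hΦ (m + 1); fun_prop)]
  refine add_le_add (lintegral_gibbs_stepOp_le hε hε1 (hΦ _)) ?_
  refine (H hε hε1 hh hm.le (by omega) ?_ (hΦ m)).trans_eq ?_
  · have : (0 : ℝ) ≤ β * ↑(m + 1) / (2 * K) := by positivity
    linarith
  · congr 3
    funext Z
    congr 2
    push_cast
    field_simp
    ring

/-- Each of the `M` steps either keeps the level or sheds one particle, and the recursion for the
weights is Pascal's rule with a factor `C K ε² h` per departure. -/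
lemma exists_weight_levelOp_iterate_le {β : ℝ} (hβ : 0 < β) :
    ∃ C : ℝ, 0 < C ∧ ∀ {ε h : ℝ} {K m₀ : ℕ} {Φ : ∀ m, Config m → ℝ≥0∞}, 0 < ε → ε ≤ 1 → 0 ≤ h →
      (∀ m, Measurable (Φ m)) → (∀ m < m₀, Φ m = 0) → (∀ m > m₀, Φ m = 0) → 0 < m₀ →
      ∀ M n, m₀ + n ≤ K → weight β K ((levelOp ε h)^[M] Φ) (m₀ + n) ≤
        ENNReal.ofReal (M.choose n * (C * K * ε ^ 2 * h) ^ n) * weight β K Φ m₀ := by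
  obtain ⟨C, hC, H⟩ := exists_weight_levelOp_le hβ
  refine ⟨C, hC, fun {ε h K m₀ Φ} hε hε1 hh hΦ hlow hhigh hm₀ M => ?_⟩
  have hzero : ∀ {Ψ : ∀ m, Config m → ℝ≥0∞} {m : ℕ}, Ψ m = 0 → weight β K Ψ m = 0 := by
    intro Ψ m h0
    simp [weight, h0]
  have hq : 0 ≤ C * K * ε ^ 2 * h := by positivity
  induction M with
  | zero =>
    intro n hn
    cases n with
    | zero => simp
    | succ n => simp [hzero (hhigh (m₀ + (n + 1)) (by omega))]
  | succ M ih =>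
    intro n hn
    have hm := measurable_levelOp_iterate (ε := ε) (h := h) hΦ M
    rw [Function.iterate_succ_apply']
    cases n with
    | zero =>
      obtain ⟨m, rfl⟩ : ∃ m, m₀ = m + 1 := ⟨m₀ - 1, by omega⟩
      refine (H hε hε1 hh hm m (by omega)).trans ?_
      rw [hzero (levelOp_iterate_eq_zero hlow M m (by omega)), mul_zero, add_zero]
      simpa using ih 0 (by omega)
    | succ n =>
      refine (H hε hε1 hh hm (m₀ + n) (by omega)).trans ?_
      have h1 := ih (n + 1) hn
      have h2 := ih n (by omega)
      rw [Nat.choose_succ_succ, Nat.cast_add, add_mul, ENNReal.ofReal_add (by positivity)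
        (by positivity), add_mul, add_comm]
      refine add_le_add ?_ h1
      calc ENNReal.ofReal (C * K * ε ^ 2 * h) * weight β K ((levelOp ε h)^[M] Φ) (m₀ + n)
          ≤ ENNReal.ofReal (C * K * ε ^ 2 * h) * (ENNReal.ofReal
            (M.choose n * (C * K * ε ^ 2 * h) ^ n) * weight β K Φ m₀) := by gcongr
        _ = _ := by
          rw [← mul_assoc, ← ENNReal.ofReal_mul hq]
          congr 2
          ring

/-- The observable `1` of groups that consist of one particle. -/
noncomputable def oneParticle : ∀ m, Config m → ℝ≥0∞ := fun m _ => if m = 1 then 1 else 0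

/-- The observables that count the ways in which a group is reduced to `m₀` particles within `M₁`
time steps, and then to one particle within `M₂` time steps. -/
noncomputable def treeCount (ε h : ℝ) (m₀ M₁ M₂ : ℕ) : ∀ m, Config m → ℝ≥0∞ :=
  (levelOp ε h)^[M₁] fun m Z => if m = m₀ then (levelOp ε h)^[M₂] oneParticle m Z else 0

lemma measurable_midLevel {h : ℝ} (m₀ M₂ : ℕ) (m : ℕ) : Measurable fun Z : Config m =>
    if m = m₀ then (levelOp ε h)^[M₂] oneParticle m Z else 0 := by
  split_ifs
  · refine measurable_levelOp_iterate (fun m => ?_) M₂ m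
    exact measurable_const
  · exact measurable_const

lemma measurable_treeCount {h : ℝ} (m₀ M₁ M₂ m : ℕ) : Measurable (treeCount ε h m₀ M₁ M₂ m) :=
  measurable_levelOp_iterate (measurable_midLevel m₀ M₂) M₁ m

lemma exists_lintegral_gibbs_one_le {β : ℝ} (hβ : 0 < β) :
    ∃ c : ℝ, 0 < c ∧ ∀ b, β / 2 ≤ b → ∫⁻ Z : Config 1, gibbs b Z ≤ ENNReal.ofReal c := by
  obtain ⟨g, hg, hgb⟩ := exists_gauss_moment (half_pos hβ)
  set V := (volume (univ : Set T3)).toReal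
  have hV : volume (univ : Set T3) = ENNReal.ofReal V :=
    (ENNReal.ofReal_toReal (measure_ne_top _ _)).symm
  refine ⟨g * V + 1, by positivity, fun b hb => ?_⟩
  have h0 : volume (univ : Set (Config 0)) = 1 := by
    rw [volume_pi, Measure.pi_of_empty]; simp
  rw [lintegral_config_succ (measurable_gibbs b)]
  have hE : ∀ (W : Config 0) (z : Particle), gibbs b (Fin.snoc (α := fun _ => Particle) W z) =
      ENNReal.ofReal (Real.exp (-b * (‖z.2‖ ^ 2 / 2))) := by
    intro W z
    rw [gibbs, energy_snoc]
    simp [energy]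
  simp only [hE, lintegral_const, h0, mul_one]
  have : ∫⁻ z : Particle, ENNReal.ofReal (Real.exp (-b * (‖z.2‖ ^ 2 / 2))) =
      ∫⁻ v : E3, ∫⁻ _ : T3, ENNReal.ofReal (Real.exp (-b * (‖v‖ ^ 2 / 2))) :=
    lintegral_prod_symm _ (by fun_prop)
  rw [this]
  simp only [lintegral_const]
  rw [lintegral_mul_const _ (by fun_prop), hV]
  calc (∫⁻ v : E3, ENNReal.ofReal (Real.exp (-b * (‖v‖ ^ 2 / 2)))) * ENNReal.ofReal V
      ≤ ENNReal.ofReal g * ENNReal.ofReal V := by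
        gcongr
        refine le_trans (lintegral_mono fun v => ENNReal.ofReal_le_ofReal ?_) (hgb b hb)
        exact le_mul_of_one_le_right (Real.exp_pos _).le (by linarith [norm_nonneg v])
    _ = ENNReal.ofReal (g * V) := (ENNReal.ofReal_mul hg.le).symm
    _ ≤ _ := ENNReal.ofReal_le_ofReal (by linarith)

/-- One factor of order `K` per departure is harmless: `x ^ r / r! ≤ exp x` and a binomial
coefficient at most `2 ^ r` leave only a geometric growth. -/
lemma pow_div_factorials_le (n j : ℕ) :
    ((n + j + 1 : ℕ) : ℝ) ^ (n + j) / (n.factorial * j.factorial) ≤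
      Real.exp 1 * (2 * Real.exp 1) ^ (n + j) := by
  have h1 : ((n + j + 1 : ℕ) : ℝ) ^ (n + j) / (n + j).factorial ≤ Real.exp ((n + j + 1 : ℕ) : ℝ) :=
    Real.pow_div_factorial_le_exp _ (by positivity) _
  have h2 : ((n + j).choose n : ℝ) ≤ 2 ^ (n + j) := by exact_mod_cast Nat.choose_le_two_pow _ _
  have h3 : ((n + j).choose n : ℝ) * (n.factorial * j.factorial) = (n + j).factorial := by
    rw [← mul_assoc]
    rw [Nat.choose_symm_add]
    exact_mod_cast Nat.add_choose_mul_factorial_mul_factorial n j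
  have h4 : Real.exp ((n + j + 1 : ℕ) : ℝ) = Real.exp 1 * Real.exp 1 ^ (n + j) := by
    rw [← Real.exp_nat_mul, ← Real.exp_add]; congr 1; push_cast; ring
  have hpos : (0 : ℝ) < n.factorial * j.factorial := by positivity
  have hpos' : (0 : ℝ) < (n + j).factorial := by positivity
  calc ((n + j + 1 : ℕ) : ℝ) ^ (n + j) / (n.factorial * j.factorial)
      = ((n + j + 1 : ℕ) : ℝ) ^ (n + j) / (n + j).factorial * (n + j).choose n := by
        rw [← h3]
        have : ((n + j).choose n : ℝ) ≠ 0 := by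
          have := Nat.choose_pos (show n ≤ n + j by omega)
          positivity
        field_simp
    _ ≤ (Real.exp 1 * Real.exp 1 ^ (n + j)) * 2 ^ (n + j) := by
        rw [← h4]; gcongr
    _ = _ := by rw [mul_pow]; ring

/-- The iteration bound is applied twice, once for each stage, so that the durations of the two
stages appear with separate exponents. This separation is what later allows the short slice to
dominate. -/
lemma exists_lintegral_treeCount_le {β : ℝ} (hβ : 0 < β) :
    ∃ c C : ℝ, 0 < c ∧ 0 < C ∧ ∀ {ε h : ℝ} {n j M₁ M₂ : ℕ}, 0 < ε → ε ≤ 1 → 0 ≤ h →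
      ∫⁻ Z, gibbs β Z * treeCount ε h (1 + j) M₁ M₂ (1 + j + n) Z ≤
        ENNReal.ofReal (c * (C * ε ^ 2) ^ (n + j) * (h * M₁) ^ n * (h * M₂) ^ j) := by
  obtain ⟨C, hC, H⟩ := exists_weight_levelOp_iterate_le hβ
  obtain ⟨c, hc, hcb⟩ := exists_lintegral_gibbs_one_le hβ
  refine ⟨Real.exp 1 * c, 2 * Real.exp 1 * C, by positivity, by positivity, ?_⟩
  intro ε h n j M₁ M₂ hε hε1 hh
  set K := 1 + j + n with hK
  have hKpos : (0 : ℝ) < K := by rw [hK]; positivity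
  have hone : ∀ m, Measurable (oneParticle m) := fun m => measurable_const
  -- At the top level `K` the weight has the full inverse temperature `β` of the marginal bound.
  have hβK : β / 2 + β * K / (2 * K) = β := by field_simp; ring
  have h0 : ∫⁻ Z, gibbs β Z * treeCount ε h (1 + j) M₁ M₂ K Z =
      weight β K (treeCount ε h (1 + j) M₁ M₂) K := by
    rw [weight, hβK]
  have h1 := H (ε := ε) (h := h) (K := K) hε hε1 hh (measurable_midLevel (ε := ε) (h := h)
    (1 + j) M₂)
    (fun m hm => by funext Z; simp [hm.ne]) (fun m hm => by funext Z; simp [hm.ne']) (by omega)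
    M₁ n le_rfl
  have h2 : weight β K (fun m Z => if m = 1 + j then (levelOp ε h)^[M₂] oneParticle m Z else 0)
      (1 + j) = weight β K ((levelOp ε h)^[M₂] oneParticle) (1 + j) := by
    simp [weight]
  have h3 := H (ε := ε) (h := h) (K := K) (Φ := oneParticle) (m₀ := 1) hε hε1 hh hone
    (fun m hm => by funext Z; simp [oneParticle, hm.ne])
    (fun m hm => by funext Z; simp [oneParticle, hm.ne']) one_pos M₂ j (by omega)
  have h4 : weight β K oneParticle 1 ≤ ENNReal.ofReal c := by
    have : weight β K oneParticle 1 = ∫⁻ Z : Config 1, gibbs (β / 2 + β * (1 : ℕ) / (2 * K)) Z := by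
      simp [weight, oneParticle]
    rw [this]
    refine hcb _ ?_
    have : (0 : ℝ) ≤ β * (1 : ℕ) / (2 * K) := by positivity
    linarith
  rw [h0]
  refine h1.trans ?_
  rw [h2]
  calc ENNReal.ofReal (M₁.choose n * (C * K * ε ^ 2 * h) ^ n) *
        weight β K ((levelOp ε h)^[M₂] oneParticle) (1 + j)
      ≤ ENNReal.ofReal (M₁.choose n * (C * K * ε ^ 2 * h) ^ n) *
        (ENNReal.ofReal (M₂.choose j * (C * K * ε ^ 2 * h) ^ j) * ENNReal.ofReal c) := by
        gcongr; exact h3.trans (by gcongr)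
    _ = ENNReal.ofReal ((M₁.choose n * (C * K * ε ^ 2 * h) ^ n) *
        ((M₂.choose j * (C * K * ε ^ 2 * h) ^ j) * c)) := by
        rw [← ENNReal.ofReal_mul (by positivity), ← ENNReal.ofReal_mul (by positivity)]
    _ ≤ _ := by
        refine ENNReal.ofReal_le_ofReal ?_
        have e1 : (M₁.choose n : ℝ) ≤ M₁ ^ n / n.factorial := Nat.choose_le_pow_div n M₁
        have e2 : (M₂.choose j : ℝ) ≤ M₂ ^ j / j.factorial := Nat.choose_le_pow_div j M₂
        have e3 := pow_div_factorials_le n j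
        have hKn : ((n + j + 1 : ℕ) : ℝ) = K := by rw [hK]; congr 1; omega
        rw [hKn] at e3
        calc (M₁.choose n * (C * K * ε ^ 2 * h) ^ n) * ((M₂.choose j * (C * K * ε ^ 2 * h) ^ j) * c)
            ≤ (M₁ ^ n / n.factorial * (C * K * ε ^ 2 * h) ^ n) *
              ((M₂ ^ j / j.factorial * (C * K * ε ^ 2 * h) ^ j) * c) := by gcongr
          _ = (K ^ (n + j) / (n.factorial * j.factorial)) *
              (c * (C * ε ^ 2) ^ (n + j) * (h * M₁) ^ n * (h * M₂) ^ j) := by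
              simp only [mul_pow, pow_add]
              field_simp
          _ ≤ (Real.exp 1 * (2 * Real.exp 1) ^ (n + j)) *
              (c * (C * ε ^ 2) ^ (n + j) * (h * M₁) ^ n * (h * M₂) ^ j) := by gcongr
          _ = _ := by
              simp only [mul_pow]
              ring

end Levels

/-! ### Trajectories on bounded time intervals. -/

section Trajectories

open scoped RealInnerProductSpace

variable {ε : ℝ} {N : ℕ} {ζ η : ℝ → Config N} {a b c d : ℝ}

/-- `Z'` is the outcome of a collision of `i` and `j` for the incoming velocities given by `Z`. -/
def CollisionRule (ε : ℝ) (Z Z' : Config N) (i j : Fin N) : Prop :=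
  (∀ ω : E3, ‖ω‖ = 1 → (Z' i).1 - (Z' j).1 = toTorus (ε • ω) →
    inner ℝ ω ((Z i).2 - (Z j).2) < 0 ∧
    (Z' i).2 = (Z i).2 - (inner ℝ ω ((Z i).2 - (Z j).2)) • ω ∧
    (Z' j).2 = (Z j).2 + (inner ℝ ω ((Z i).2 - (Z j).2)) • ω) ∧
  (∀ l, l ≠ i → l ≠ j → (Z' l).2 = (Z l).2)

lemma CollisionRule.congr_velocity {Z W Z' : Config N} {i j : Fin N} (h : CollisionRule ε Z Z' i j)
    (hv : ∀ k, (Z k).2 = (W k).2) : CollisionRule ε W Z' i j := by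
  simpa only [CollisionRule, hv] using h

/-- A hard-sphere trajectory on the time interval `[a, b]`; at the time `a` itself no condition is
imposed. -/
structure TrajOn (ε : ℝ) (ζ : ℝ → Config N) (a b : ℝ) : Prop where
  no_overlap : ∀ s ∈ Ioc a b, ∀ i j, i ≠ j → ε ≤ torusDist (ζ s i).1 (ζ s j).1
  finite : (collisionTimes ε ζ ∩ Ioc a b).Finite
  position : ∀ c d, a ≤ c → c ≤ d → d ≤ b → Disjoint (collisionTimes ε ζ) (Ioo c d) →
    ∀ i, (ζ d i).1 = (ζ c i).1 + toTorus ((d - c) • (ζ c i).2)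
  velocity : ∀ c d, a ≤ c → c ≤ d → d ≤ b → Disjoint (collisionTimes ε ζ) (Ioc c d) →
    ∀ i, (ζ d i).2 = (ζ c i).2
  binary : ∀ s ∈ Ioc a b, ∀ i j, InContact ε (ζ s) i j → ∀ k l, InContact ε (ζ s) k l →
    (k = i ∧ l = j) ∨ (k = j ∧ l = i)
  collision : ∀ c s, a ≤ c → c < s → s ≤ b → Disjoint (collisionTimes ε ζ) (Ioo c s) →
    ∀ i j, InContact ε (ζ s) i j → CollisionRule ε (ζ c) (ζ s) i j

lemma TrajOn.mono (h : TrajOn ε ζ a b) (hac : a ≤ c) (hdb : d ≤ b) : TrajOn ε ζ c d where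
  no_overlap s hs := h.no_overlap s ⟨hac.trans_lt hs.1, hs.2.trans hdb⟩
  finite := h.finite.subset (inter_subset_inter_right _ (Ioc_subset_Ioc hac hdb))
  position p q hp hpq hq := h.position p q (hac.trans hp) hpq (hq.trans hdb)
  velocity p q hp hpq hq := h.velocity p q (hac.trans hp) hpq (hq.trans hdb)
  binary s hs := h.binary s ⟨hac.trans_lt hs.1, hs.2.trans hdb⟩
  collision p q hp hpq hq := h.collision p q (hac.trans hp) hpq (hq.trans hdb)

lemma TrajOn.congr (h : TrajOn ε ζ a b) (heq : EqOn ζ η (Icc a b)) : TrajOn ε η a b := by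
  have hc : ∀ s ∈ Icc a b, (s ∈ collisionTimes ε η ↔ s ∈ collisionTimes ε ζ) := by
    intro s hs
    simp only [collisionTimes, mem_ofPred_eq, heq hs]
  have hdis : ∀ S ⊆ Icc a b, Disjoint (collisionTimes ε η) S → Disjoint (collisionTimes ε ζ) S := by
    intro S hS hd
    rw [Set.disjoint_left] at hd ⊢
    exact fun s hs hsS => hd ((hc s (hS hsS)).2 hs) hsS
  constructor
  · intro s hs
    rw [← heq (Ioc_subset_Icc_self hs)]
    exact h.no_overlap s hs
  · refine h.finite.subset ?_
    rintro s ⟨hs, hsI⟩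
    exact ⟨(hc s (Ioc_subset_Icc_self hsI)).1 hs, hsI⟩
  · intro p q hp hpq hq hd
    rw [← heq ⟨hp, hpq.trans hq⟩, ← heq ⟨hp.trans hpq, hq⟩]
    exact h.position p q hp hpq hq (hdis _ (fun s hs => ⟨hp.trans hs.1.le, hs.2.le.trans hq⟩) hd)
  · intro p q hp hpq hq hd
    rw [← heq ⟨hp, hpq.trans hq⟩, ← heq ⟨hp.trans hpq, hq⟩]
    exact h.velocity p q hp hpq hq (hdis _ (fun s hs => ⟨hp.trans hs.1.le, hs.2.trans hq⟩) hd)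
  · intro s hs
    rw [← heq (Ioc_subset_Icc_self hs)]
    exact h.binary s hs
  · intro p q hp hpq hq hd
    rw [← heq ⟨hp, hpq.le.trans hq⟩, ← heq ⟨hp.trans hpq.le, hq⟩]
    exact h.collision p q hp hpq hq (hdis _ (fun s hs => ⟨hp.trans hs.1.le, hs.2.le.trans hq⟩) hd)

lemma TrajOn.shift (h : TrajOn ε ζ a b) (r : ℝ) : TrajOn ε (fun s => ζ (s + r)) (a - r)
    (b - r) := by
  have hc : ∀ s, s ∈ collisionTimes ε (fun s => ζ (s + r)) ↔ s + r ∈ collisionTimes ε ζ :=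
    fun s => Iff.rfl
  have hdis : ∀ S : Set ℝ,
    Disjoint (collisionTimes ε (fun s => ζ (s + r))) ((fun s => s + r) ⁻¹' S) →
      Disjoint (collisionTimes ε ζ) S := by
    intro S hd
    rw [Set.disjoint_left] at hd ⊢
    intro s hs hsS
    exact hd (a := s - r) (by simpa [hc] using hs) (by simpa using hsS)
  constructor
  · intro s hs
    exact h.no_overlap _ ⟨by linarith [hs.1], by linarith [hs.2]⟩
  · refine (h.finite.image (fun s => s - r)).subset ?_
    rintro s ⟨hs, hsI⟩
    exact ⟨s + r, ⟨hs, by linarith [hsI.1], by linarith [hsI.2]⟩, by simp⟩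
  · intro p q hp hpq hq hd i
    rw [h.position (p + r) (q + r) (by linarith) (by linarith) (by linarith)
      (hdis _ (by simpa using hd)) i]
    simp
  · intro p q hp hpq hq hd
    exact h.velocity (p + r) (q + r) (by linarith) (by linarith) (by linarith)
      (hdis _ (by simpa using hd))
  · intro s hs
    exact h.binary _ ⟨by linarith [hs.1], by linarith [hs.2]⟩
  · intro p q hp hpq hq hd
    exact h.collision (p + r) (q + r) (by linarith) (by linarith) (by linarith)
      (hdis _ (by simpa using hd))

/-- A collision at the junction `b` is governed by the first piece, since the second one imposes
nothing at its left end. Intervals without collisions that straddle `b` are split there. -/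
lemma TrajOn.glue (h₁ : TrajOn ε ζ a b) (h₂ : TrajOn ε ζ b c) : TrajOn ε ζ a c := by
  constructor
  · intro s hs
    rcases le_or_gt s b with hsb | hsb
    · exact h₁.no_overlap s ⟨hs.1, hsb⟩
    · exact h₂.no_overlap s ⟨hsb, hs.2⟩
  · refine (h₁.finite.union h₂.finite).subset ?_
    rintro s ⟨hs, hsI⟩
    rcases le_or_gt s b with hsb | hsb
    · exact Or.inl ⟨hs, hsI.1, hsb⟩
    · exact Or.inr ⟨hs, hsb, hsI.2⟩
  · intro p q hp hpq hq hd i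
    rcases le_or_gt q b with hqb | hqb
    · exact h₁.position p q hp hpq hqb hd i
    rcases le_or_gt b p with hbp | hbp
    · exact h₂.position p q hbp hpq hq hd i
    have hb : b ∉ collisionTimes ε ζ := fun hb => Set.disjoint_left.1 hd hb ⟨hbp, hqb⟩
    have hd1 : Disjoint (collisionTimes ε ζ) (Ioc p b) := by
      rw [Set.disjoint_left] at hd ⊢
      exact fun s hs hsI => hd hs ⟨hsI.1, hsI.2.trans_lt hqb⟩
    rw [h₂.position b q le_rfl hqb.le hq (hd.mono_right (Ioo_subset_Ioo_left hbp.le)) i,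
      h₁.position p b hp hbp.le le_rfl (hd.mono_right (Ioo_subset_Ioo_right hqb.le)) i,
      h₁.velocity p b hp hbp.le le_rfl hd1 i, add_assoc, ← toTorus_add, ← add_smul]
    congr 3
    ring
  · intro p q hp hpq hq hd i
    rcases le_or_gt q b with hqb | hqb
    · exact h₁.velocity p q hp hpq hqb hd i
    rcases le_or_gt b p with hbp | hbp
    · exact h₂.velocity p q hbp hpq hq hd i
    rw [h₂.velocity b q le_rfl hqb.le hq (hd.mono_right (Ioc_subset_Ioc_left hbp.le)) i,
      h₁.velocity p b hp hbp.le le_rfl (hd.mono_right (Ioc_subset_Ioc_right hqb.le)) i]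
  · intro s hs
    rcases le_or_gt s b with hsb | hsb
    · exact h₁.binary s ⟨hs.1, hsb⟩
    · exact h₂.binary s ⟨hsb, hs.2⟩
  · intro p q hp hpq hq hd i j hij
    rcases le_or_gt q b with hqb | hqb
    · exact h₁.collision p q hp hpq hqb hd i j hij
    rcases le_or_gt b p with hbp | hbp
    · exact h₂.collision p q hbp hpq hq hd i j hij
    have hd1 : Disjoint (collisionTimes ε ζ) (Ioc p b) := by
      rw [Set.disjoint_left] at hd ⊢
      exact fun s hs hsI => hd hs ⟨hsI.1, hsI.2.trans_lt hqb⟩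
    exact (h₂.collision b q le_rfl hqb hq (hd.mono_right (Ioo_subset_Ioo_left hbp.le)) i j hij
      ).congr_velocity (h₁.velocity p b hp hbp.le le_rfl hd1)

lemma IsTrajectory.trajOn (h : IsTrajectory ε ζ) (a b : ℝ) : TrajOn ε ζ a b where
  no_overlap s _ := h.no_overlap s
  finite := (h.locally_finite a b).subset (inter_subset_inter_right _ Ioc_subset_Icc_self)
  position p q _ hpq _ := h.position p q hpq
  velocity p q _ hpq _ := h.velocity p q hpq
  binary s _ := h.binary s
  collision p q _ hpq _ := h.collision p q hpq

lemma isTrajectory_of_trajOn (h : ∀ m : ℕ, TrajOn ε ζ (-m) m) : IsTrajectory ε ζ := by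
  have key : ∀ x y : ℝ, ∃ m : ℕ, -(m : ℝ) < x ∧ x ≤ m ∧ -(m : ℝ) < y ∧ y ≤ m := by
    intro x y
    obtain ⟨m, hm⟩ := exists_nat_gt (max |x| |y|)
    have hx := (le_max_left _ _).trans_lt hm
    have hy := (le_max_right _ _).trans_lt hm
    rw [abs_lt] at hx hy
    exact ⟨m, hx.1, hx.2.le, hy.1, hy.2.le⟩
  constructor
  · intro s
    obtain ⟨m, h1, h2, -, -⟩ := key s s
    exact (h m).no_overlap s ⟨h1, h2⟩
  · intro x y
    obtain ⟨m, h1, h2, h3, h4⟩ := key x y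
    exact (h m).finite.subset (inter_subset_inter_right _
      fun s hs => ⟨h1.trans_le hs.1, hs.2.trans h4⟩)
  · intro x y hxy
    obtain ⟨m, h1, h2, h3, h4⟩ := key x y
    exact (h m).position x y h1.le hxy h4
  · intro x y hxy
    obtain ⟨m, h1, h2, h3, h4⟩ := key x y
    exact (h m).velocity x y h1.le hxy h4
  · intro s
    obtain ⟨m, h1, h2, -, -⟩ := key s s
    exact (h m).binary s ⟨h1, h2⟩
  · intro x y hxy
    obtain ⟨m, h1, h2, h3, h4⟩ := key x y
    exact (h m).collision x y h1.le hxy h4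

lemma InContact.symm {Z : Config N} {i j : Fin N} (h : InContact ε Z i j) : InContact ε Z j i :=
  ⟨h.1.symm, by rw [torusDist_comm]; exact h.2⟩

lemma IsTrajectory.comp_perm (h : IsTrajectory ε ζ) (σ : Equiv.Perm (Fin N)) :
    IsTrajectory ε fun s => ζ s ∘ σ := by
  have hc : collisionTimes ε (fun s => ζ s ∘ σ) = collisionTimes ε ζ := by
    ext s
    constructor
    · rintro ⟨i, j, hij⟩
      exact ⟨σ i, σ j, fun hh => hij.1 (σ.injective hh), hij.2⟩
    · rintro ⟨i, j, hij⟩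
      refine ⟨σ.symm i, σ.symm j, fun hh => hij.1 (σ.symm.injective hh), ?_⟩
      simpa using hij.2
  have hin : ∀ s i j, InContact ε (ζ s ∘ σ) i j → InContact ε (ζ s) (σ i) (σ j) :=
    fun s i j hij => ⟨fun hh => hij.1 (σ.injective hh), hij.2⟩
  constructor
  · intro s i j hij
    exact h.no_overlap s (σ i) (σ j) (fun hh => hij (σ.injective hh))
  · rw [hc]; exact h.locally_finite
  · rw [hc]; exact fun p q hpq hd i => h.position p q hpq hd (σ i)
  · rw [hc]; exact fun p q hpq hd i => h.velocity p q hpq hd (σ i)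
  · intro s i j hij k l hkl
    simpa [σ.injective.eq_iff] using h.binary s _ _ (hin s i j hij) _ _ (hin s k l hkl)
  · rw [hc]
    intro p q hpq hd i j hij
    obtain ⟨h1, h2⟩ := h.collision p q hpq hd _ _ (hin q i j hij)
    exact ⟨h1, fun l hi hj => h2 (σ l) (fun hh => hi (σ.injective hh)) fun hh => hj
      (σ.injective hh)⟩

lemma lt_torusDist_of_not_inContact (h : TrajOn ε ζ a b) {s : ℝ} (hs : s ∈ Ioc a b) {i j : Fin N}
    (hij : i ≠ j) (hc : ¬ InContact ε (ζ s) i j) : ε < torusDist (ζ s i).1 (ζ s j).1 :=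
  lt_of_le_of_ne (h.no_overlap s hs i j hij) fun hh => hc ⟨hij, hh.symm⟩

/-! ### Groups of particles during one time step of a trajectory. -/

section Window

variable {h : ℝ} {m : ℕ} {e : Fin m → Fin N}

lemma freeFlow_of_disjoint (hζ : TrajOn ε ζ a b) {s : ℝ} (hs0 : 0 ≤ s) (hs : a + s ≤ b)
    (hd : Disjoint (collisionTimes ε ζ) (Ioc a (a + s))) : ζ (a + s) = freeFlow s (ζ a) := by
  funext k
  ext1
  · rw [hζ.position a (a + s) le_rfl (by linarith) hs (hd.mono_right Ioo_subset_Ioc_self) k,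
      freeFlow_fst, add_sub_cancel_left]
  · rw [hζ.velocity a (a + s) le_rfl (by linarith) hs hd k, freeFlow_snd]

/-- A motion with one collision is reproduced by `collide`. -/
lemma mem_Coll_of_brokenPos {Z : Config N} {i j : Fin N} (hε : 0 < ε) (hε1 : ε ≤ 1)
    (hij : i ≠ j) (hslow : Z ∈ slow ε h) {σ : ℝ} (hσ : σ ∈ Ioc 0 h) {ω : E3} (hω : ‖ω‖ = 1)
    (hc : ⟪ω, (Z i).2 - (Z j).2⟫ < 0)
    (hpos : (freeFlow σ Z i).1 - (freeFlow σ Z j).1 = toTorus (ε • ω))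
    (hother : ∀ k l, k ≠ l → ¬((k = i ∧ l = j) ∨ (k = j ∧ l = i)) → ∀ s ∈ Ioc 0 h,
      ε < torusDist (brokenPos Z i j σ (⟪ω, (Z i).2 - (Z j).2⟫ • ω) s k)
        (brokenPos Z i j σ (⟪ω, (Z i).2 - (Z j).2⟫ • ω) s l)) {Z' : Config N}
    (hpos' : ∀ k, (Z' k).1 = brokenPos Z i j σ (⟪ω, (Z i).2 - (Z j).2⟫ • ω) h k)
    (hi : (Z' i).2 = (Z i).2 - ⟪ω, (Z i).2 - (Z j).2⟫ • ω)
    (hj : (Z' j).2 = (Z j).2 + ⟪ω, (Z i).2 - (Z j).2⟫ • ω)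
    (hk : ∀ k, k ≠ i → k ≠ j → (Z' k).2 = (Z k).2) :
    Z ∈ Coll ε h i j ∧ collide ε i j (freeFlow h Z) = Z' := by
  set v := (Z i).2 - (Z j).2 with hv
  set z := freeFlow h Z i - freeFlow h Z j with hz
  have hh : 0 ≤ h := hσ.1.le.trans hσ.2
  have hvs : h * ‖v‖ ≤ ε / 4 := by
    have h1 := mul_le_mul_of_nonneg_left (norm_sub_le (Z i).2 (Z j).2) hh
    have := hslow i
    have := hslow j
    linarith
  have hz1 : z.1 = toTorus (ε • ω + (h - σ) • v) := by
    rw [toTorus_add, ← hpos, hv, smul_sub, toTorus_sub, hz]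
    simp only [Prod.fst_sub, freeFlow_fst, sub_smul, toTorus_sub]
    abel
  have hnorm : ‖ε • ω + (h - σ) • v‖ ≤ 5 / 4 * ε := by
    refine (norm_add_le _ _).trans ?_
    rw [norm_smul, norm_smul, hω, Real.norm_of_nonneg hε.le,
      Real.norm_of_nonneg (by linarith [hσ.2])]
    nlinarith [norm_nonneg v, hσ.1]
  have hrel : relState z = (ε • ω + (h - σ) • v, v) := by
    rw [relState, hz1, lift_toTorus (lt_pi_of_le hε1 hnorm)]
    rfl
  obtain ⟨h1, h2, h3⟩ := scat_unique hε hω hc (s := h - σ)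
  rw [← hrel] at h1 h2 h3
  have hspeed : scatSpeed ε (relState z) = ⟪ω, v⟫ := by rw [scatSpeed, h3, hrel]
  have hkick : (kick ε z).2 = ⟪ω, v⟫ • ω := by rw [kick, scatKick, hspeed, h3]
  have htr : transfer ε h i j Z = ⟪ω, v⟫ • ω := by rw [transfer, ← hz, hkick]
  have hct : collTime ε h i j Z = σ := by rw [collTime, ← hz, h2]; ring
  have hdom : z ∈ collDom ε h := by
    refine ⟨h1, ?_, ?_⟩
    · rw [h2]; constructor <;> linarith [hσ.1, hσ.2]
    · exact hvs
  refine ⟨⟨hslow, hdom, ?_⟩, ?_⟩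
  · rw [htr, hct]; exact hother
  · funext k
    ext1
    · rw [hpos', ← hct, ← htr]
      have := collide_freeFlow_fst hij (ε := ε) (h := h) (Z := Z) (s := 0) hdom.2.1.1 hdom.2.1.1 k
      rwa [neg_zero, freeFlow_zero, sub_zero] at this
    · by_cases hki : k = i
      · subst hki
        rw [collide_left hij, Prod.snd_sub, ← hz, hkick, hi, freeFlow_snd]
      · by_cases hkj : k = j
        · subst hkj
          rw [collide_right, Prod.snd_add, ← hz, hkick, hj, freeFlow_snd]
        · rw [collide_of_ne hki hkj, hk k hki hkj, freeFlow_snd]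

/-- The only collision time in the window carries only the pair `e i`, `e j`, so the group is
affected by no other collision. It need not be known in advance that the group is closed. -/
lemma group_mem_Coll (hε : 0 < ε) (hε1 : ε ≤ 1) (hζ : TrajOn ε ζ a (a + h))
    (hslow : ζ a ∈ slow ε h) (hone : (collisionTimes ε ζ ∩ Ioc a (a + h)).Subsingleton)
    (he : Function.Injective e) {r : ℝ} (hr : r ∈ Ioc a (a + h)) {i j : Fin m}
    (hc : InContact ε (ζ r) (e i) (e j)) :
    ζ a ∘ e ∈ Coll ε h i j ∧ collide ε i j (freeFlow h (ζ a ∘ e)) = ζ (a + h) ∘ e := by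
  have hij : i ≠ j := fun hh => hc.1 (by rw [hh])
  have hrC : r ∈ collisionTimes ε ζ ∩ Ioc a (a + h) := ⟨⟨_, _, hc⟩, hr⟩
  have huniq : ∀ s ∈ Ioc a (a + h), s ∈ collisionTimes ε ζ → s = r := fun s hs hsC =>
    hone ⟨hsC, hs⟩ hrC
  have hd1 : Disjoint (collisionTimes ε ζ) (Ioo a r) := Set.disjoint_left.2 fun s hs hsI =>
    hsI.2.ne (huniq s ⟨hsI.1, hsI.2.le.trans hr.2⟩ hs)
  have hd2 : Disjoint (collisionTimes ε ζ) (Ioc r (a + h)) := Set.disjoint_left.2 fun s hs hsI =>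
    hsI.1.ne' (huniq s ⟨hr.1.trans hsI.1, hsI.2⟩ hs)
  obtain ⟨ω, hω, hωpos⟩ := exists_dir_of_torusDist_eq hε hc.2
  obtain ⟨hrule, hrule'⟩ := hζ.collision a r le_rfl hr.1 hr.2 hd1 _ _ hc
  obtain ⟨hneg, hvi, hvj⟩ := hrule ω hω hωpos
  set w := ⟪ω, (ζ a (e i)).2 - (ζ a (e j)).2⟫ • ω with hw
  have hposr : ∀ k, (ζ r k).1 = (ζ a k).1 + toTorus ((r - a) • (ζ a k).2) :=
    hζ.position a r le_rfl hr.1.le hr.2 hd1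
  have hvel : ∀ s, r ≤ s → s ≤ a + h → ∀ k, (ζ s k).2 = (ζ r k).2 := fun s hs hs' =>
    hζ.velocity r s hr.1.le hs hs' (hd2.mono_right (Ioc_subset_Ioc_right hs'))
  -- Before `r` the positions are those of free flight, and after `r` the change of velocity given
  -- by the collision rule produces the broken path.
  have hpos : ∀ s, 0 ≤ s → s ≤ h → ∀ k, (ζ (a + s) (e k)).1 =
      brokenPos (ζ a ∘ e) i j (r - a) w s k := by
    intro s hs0 hsh k
    rcases le_or_gt (a + s) r with hsr | hsr
    · rw [hζ.position a (a + s) le_rfl (by linarith) (by linarith)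
        (hd1.mono_right (Ioo_subset_Ioo_right hsr)), brokenPos_of_le (by linarith), freeFlow_fst,
        add_sub_cancel_left]
      rfl
    · rw [hζ.position r (a + s) hr.1.le hsr.le (by linarith)
        (hd2.mono_right
          (show Ioo r (a + s) ⊆ Ioc r (a + h) from fun x hx => ⟨hx.1,
            hx.2.le.trans (by linarith)⟩)), hposr, brokenPos,
        max_eq_left (by linarith : 0 ≤ s - (r - a))]
      have hsplit : ∀ u : E3, toTorus (s • u) =
          toTorus ((r - a) • u) + toTorus ((a + s - r) • u) := by
        intro u
        rw [← toTorus_add, ← add_smul]; congr 2; ring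
      have hs' : s - (r - a) = a + s - r := by ring
      simp only [Function.comp_apply, hsplit, hs']
      by_cases hki : k = i
      · subst hki
        rw [if_pos rfl, hvi, smul_sub, toTorus_sub]
        abel
      · by_cases hkj : k = j
        · subst hkj
          rw [if_neg hki, if_pos rfl, hvj, smul_add, toTorus_add]
          abel
        · rw [if_neg hki, if_neg hkj, hrule' (e k) (fun hh => hki (he hh)) fun hh => hkj (he hh)]
          abel
  have hh : 0 ≤ h := by linarith [hr.1, hr.2]
  refine mem_Coll_of_brokenPos hε hε1 hij (σ := r - a) (ω := ω) (fun k => hslow (e k))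
    ⟨by linarith [hr.1], by linarith [hr.2]⟩ hω hneg ?_ ?_ (fun k => hpos h hh le_rfl k) ?_ ?_ ?_
  · rw [← hωpos, hposr, hposr]; rfl
  · intro k l hkl hne s hs
    change ε < torusDist (brokenPos (ζ a ∘ e) i j (r - a) w s k)
      (brokenPos (ζ a ∘ e) i j (r - a) w s l)
    rw [← hpos s hs.1.le hs.2, ← hpos s hs.1.le hs.2]
    have hsI : a + s ∈ Ioc a (a + h) := ⟨by linarith [hs.1], by linarith [hs.2]⟩
    refine lt_torusDist_of_not_inContact hζ hsI (fun hh => hkl (he hh)) fun hcon => hne ?_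
    have hsr := huniq _ hsI ⟨_, _, hcon⟩
    rw [hsr] at hcon
    simpa [he.eq_iff] using hζ.binary r hr _ _ hc _ _ hcon
  · change (ζ (a + h) (e i)).2 = _
    rw [hvel _ hr.2 le_rfl, hvi]
  · change (ζ (a + h) (e j)).2 = _
    rw [hvel _ hr.2 le_rfl, hvj]
  · intro k hki hkj
    change (ζ (a + h) (e k)).2 = _
    rw [hvel _ hr.2 le_rfl, hrule' (e k) (fun hh => hki (he hh)) fun hh => hkj (he hh)]

/-- `Z'` is the state one time step after `Z`. -/
def Step (ε h : ℝ) (Z Z' : Config N) : Prop :=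
  ∃ q, Z ∈ branchDom ε h q ∧ branchMap ε h q Z = Z'

/-- The reason why a cluster evolves by itself between departures: without contact to outsiders, the
group either has the single collision of the window or flies freely. -/
lemma group_step (hε : 0 < ε) (hε1 : ε ≤ 1) (hh : 0 ≤ h) (hζ : TrajOn ε ζ a (a + h))
    (hslow : ζ a ∈ slow ε h) (hone : (collisionTimes ε ζ ∩ Ioc a (a + h)).Subsingleton)
    (he : Function.Injective e) (hclosed : ∀ s ∈ Ioc a (a + h), ∀ k l,
      InContact ε (ζ s) (e k) l → l ∈ range e) : Step ε h (ζ a ∘ e) (ζ (a + h) ∘ e) := by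
  by_cases hcol : ∃ r ∈ Ioc a (a + h), ∃ i j, InContact ε (ζ r) (e i) (e j)
  · obtain ⟨r, hr, i, j, hij⟩ := hcol
    have hne : i ≠ j := fun hh => hij.1 (by rw [hh])
    rcases lt_or_gt_of_ne hne with hlt | hlt
    · exact ⟨some ⟨(i, j), hlt⟩, group_mem_Coll hε hε1 hζ hslow hone he hr hij⟩
    · exact ⟨some ⟨(j, i), hlt⟩, group_mem_Coll hε hε1 hζ hslow hone he hr hij.symm⟩
  · push Not at hcol
    have hnot : ∀ s ∈ Ioc a (a + h), ∀ k l, ¬ InContact ε (ζ s) (e k) l := by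
      intro s hs k l hkl
      obtain ⟨l, rfl⟩ := hclosed s hs k l hkl
      exact hcol s hs k l hkl
    -- The window may contain a collision among outsiders. It leaves the velocities of the group
    -- unchanged, so the two pieces of free flight fit together.
    have hfree : ∀ s, 0 ≤ s → s ≤ h → ∀ k, ζ (a + s) (e k) = freeFlow s (ζ a ∘ e) k := by
      intro s hs0 hsh k
      by_cases hd : Disjoint (collisionTimes ε ζ) (Ioc a (a + s))
      · rw [freeFlow_of_disjoint hζ hs0 (by linarith) hd]; rfl
      · rw [Set.not_disjoint_iff] at hd
        obtain ⟨r, hrC, hrI⟩ := hd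
        have hr : r ∈ Ioc a (a + h) := ⟨hrI.1, hrI.2.trans (by linarith)⟩
        have huniq : ∀ s ∈ Ioc a (a + h), s ∈ collisionTimes ε ζ → s = r := fun s hs hsC =>
          hone ⟨hsC, hs⟩ ⟨hrC, hr⟩
        have hd1 : Disjoint (collisionTimes ε ζ) (Ioo a r) := Set.disjoint_left.2 fun s hs hsI =>
          hsI.2.ne (huniq s ⟨hsI.1, hsI.2.le.trans hr.2⟩ hs)
        have hd2 : Disjoint (collisionTimes ε ζ) (Ioc r (a + h)) :=
          Set.disjoint_left.2 fun s hs hsI =>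
          hsI.1.ne' (huniq s ⟨hr.1.trans hsI.1, hsI.2⟩ hs)
        obtain ⟨i, j, hij⟩ := hrC
        have hki : e k ≠ i := fun hh => hnot r hr k j (by rw [hh]; exact hij)
        have hkj : e k ≠ j := fun hh => hnot r hr k i (by rw [hh]; exact hij.symm)
        have hv := (hζ.collision a r le_rfl hr.1 hr.2 hd1 _ _ hij).2 (e k) hki hkj
        ext1
        · rw [hζ.position r (a + s) hr.1.le hrI.2 (by linarith) (hd2.mono_right
            (show Ioo r (a + s) ⊆ Ioc r (a + h) from fun x hx => ⟨hx.1,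
              hx.2.le.trans (by linarith)⟩)), hζ.position a r le_rfl hr.1.le hr.2 hd1,
            hv, add_assoc, ← toTorus_add, ← add_smul, freeFlow_fst]
          congr 3
          ring
        · rw [hζ.velocity r (a + s) hr.1.le hrI.2 (by linarith) (hd2.mono_right
            (show Ioc r (a + s) ⊆ Ioc r (a + h) from fun x hx => ⟨hx.1, hx.2.trans (by linarith)⟩)),
              hv]; rfl
    refine ⟨none, ⟨fun k => hslow (e k), ?_⟩, ?_⟩
    · intro k l hkl s hs
      rw [← hfree s hs.1.le hs.2, ← hfree s hs.1.le hs.2]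
      have hsI : a + s ∈ Ioc a (a + h) := ⟨by linarith [hs.1], by linarith [hs.2]⟩
      exact lt_torusDist_of_not_inContact hζ hsI (fun hh => hkl (he hh)) (hnot _ hsI _ _)
    · funext k
      exact (hfree h hh le_rfl k).symm

end Window

end Trajectories

/-! ### Chains of time steps and their equivalence with trajectories. -/

section Chains

open scoped RealInnerProductSpace

variable {ε h : ℝ} {N : ℕ} {ζ η : ℝ → Config N} {a b : ℝ}

lemma Step.unique_right (hε : 0 < ε) (hε1 : ε ≤ 1) {Z W W' : Config N} (h₁ : Step ε h Z W)
    (h₂ : Step ε h Z W') : W = W' := by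
  obtain ⟨q, hq, rfl⟩ := h₁
  obtain ⟨r, hr, rfl⟩ := h₂
  rw [branchDom_unique hε hε1 hq hr]

lemma Step.unique_left (hε : 0 < ε) (hε1 : ε ≤ 1) {Z Z' W : Config N} (h₁ : Step ε h Z W)
    (h₂ : Step ε h Z' W) : Z = Z' := by
  obtain ⟨q, hq, hqW⟩ := h₁
  obtain ⟨r, hr, hrW⟩ := h₂
  obtain rfl := branchMap_unique hε hε1 hq hr (hqW.trans hrW.symm)
  exact injOn_branchMap hε hε1 q hq hr (hqW.trans hrW.symm)

/-- `Z'` is the state `M` time steps after `Z`. -/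
def Chain (ε h : ℝ) : ℕ → Config N → Config N → Prop
  | 0, Z, Z' => Z = Z'
  | M + 1, Z, Z' => ∃ W, Step ε h Z W ∧ Chain ε h M W Z'

lemma Chain.unique_right (hε : 0 < ε) (hε1 : ε ≤ 1) : ∀ {M : ℕ} {Z W W' : Config N},
    Chain ε h M Z W → Chain ε h M Z W' → W = W'
  | 0, _, _, _, h₁, h₂ => h₁.symm.trans h₂
  | _ + 1, _, _, _, ⟨_, h₁, h₁'⟩, ⟨_, h₂, h₂'⟩ => by
    obtain rfl := h₁.unique_right hε hε1 h₂
    exact h₁'.unique_right hε hε1 h₂'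

lemma Chain.unique_left (hε : 0 < ε) (hε1 : ε ≤ 1) : ∀ {M : ℕ} {Z Z' W : Config N},
    Chain ε h M Z W → Chain ε h M Z' W → Z = Z'
  | 0, _, _, _, h₁, h₂ => h₁.trans h₂.symm
  | _ + 1, _, _, _, ⟨_, h₁, h₁'⟩, ⟨_, h₂, h₂'⟩ => by
    obtain rfl := h₁'.unique_left hε hε1 h₂'
    exact h₁.unique_left hε hε1 h₂

lemma measurableSet_step_left {B : Set (Config N)} (hB : MeasurableSet B) :
    MeasurableSet {Z | ∃ Z' ∈ B, Step ε h Z Z'} := by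
  have : {Z | ∃ Z' ∈ B, Step ε h Z Z'} = ⋃ q, branchDom ε h q ∩ branchMap ε h q ⁻¹' B := by
    ext Z
    simp only [Step, mem_ofPred_eq, mem_iUnion, mem_inter_iff, mem_preimage]
    constructor
    · rintro ⟨Z', hZ', q, hq, rfl⟩; exact ⟨q, hq, hZ'⟩
    · rintro ⟨q, hq, hZ⟩; exact ⟨_, hZ, q, hq, rfl⟩
  rw [this]
  exact .iUnion fun q => (measurableSet_branchDom q).inter (measurable_branchMap q hB)

/-- Images of Borel sets under injective measurable maps between standard Borel spaces are Borel;
injectivity comes from the determinism of the steps. -/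
lemma measurableSet_step_right (hε : 0 < ε) (hε1 : ε ≤ 1) {B : Set (Config N)}
    (hB : MeasurableSet B) : MeasurableSet {Z' | ∃ Z ∈ B, Step ε h Z Z'} := by
  have : {Z' | ∃ Z ∈ B, Step ε h Z Z'} = ⋃ q, branchMap ε h q '' (branchDom ε h q ∩ B) := by
    ext Z
    simp only [Step, mem_ofPred_eq, mem_iUnion, mem_inter_iff, mem_image]
    constructor
    · rintro ⟨Z', hZ', q, hq, rfl⟩; exact ⟨q, _, ⟨hq, hZ'⟩, rfl⟩
    · rintro ⟨q, Z, ⟨hq, hZ⟩, rfl⟩; exact ⟨_, hZ, q, hq, rfl⟩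
  rw [this]
  exact .iUnion fun q => ((measurableSet_branchDom q).inter hB).image_of_measurable_injOn
    (measurable_branchMap q) ((injOn_branchMap hε hε1 q).mono inter_subset_left)

lemma measurableSet_chain_left (M : ℕ) {B : Set (Config N)} (hB : MeasurableSet B) :
    MeasurableSet {Z | ∃ Z' ∈ B, Chain ε h M Z Z'} := by
  induction M with
  | zero => simpa [Chain] using hB
  | succ M ih =>
    convert measurableSet_step_left (ε := ε) (h := h) ih using 1
    ext Z
    constructor
    · rintro ⟨Z', hZ', W, hW, hc⟩; exact ⟨W, ⟨Z', hZ', hc⟩, hW⟩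
    · rintro ⟨W, ⟨Z', hZ', hc⟩, hW⟩; exact ⟨Z', hZ', W, hW, hc⟩

lemma measurableSet_chain_right (hε : 0 < ε) (hε1 : ε ≤ 1) (M : ℕ) {B : Set (Config N)}
    (hB : MeasurableSet B) : MeasurableSet {Z' | ∃ Z ∈ B, Chain ε h M Z Z'} := by
  induction M generalizing B with
  | zero => simpa [Chain] using hB
  | succ M ih =>
    convert ih (measurableSet_step_right (ε := ε) (h := h) hε hε1 hB) using 1
    ext Z'
    constructor
    · rintro ⟨Z, hZ, W, hW, hc⟩; exact ⟨W, ⟨Z, hZ, hW⟩, hc⟩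
    · rintro ⟨W, ⟨Z, hZ, hW⟩, hc⟩; exact ⟨Z, hZ, W, hW, hc⟩

lemma Step.le_stepOp {φ : Config N → ℝ≥0∞} {Z Z' : Config N} (hZ : Step ε h Z Z') :
    φ Z' ≤ stepOp ε h φ Z := by
  obtain ⟨q, hq, rfl⟩ := hZ
  refine le_trans (le_of_eq ?_) (Finset.single_le_sum (f := fun q =>
    (branchDom ε h q).indicator (fun Z => φ (branchMap ε h q Z)) Z) (fun _ _ => zero_le)
    (Finset.mem_univ q))
  simp only [indicator_of_mem hq]

lemma Chain.le_stepOp_iterate {φ : Config N → ℝ≥0∞} : ∀ {M : ℕ} {Z Z' : Config N},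
    Chain ε h M Z Z' → φ Z' ≤ (stepOp ε h)^[M] φ Z
  | 0, _, _, hc => by rw [show _ = _ from hc]; rfl
  | M + 1, _, _, ⟨_, hs, hc⟩ => by
    rw [Function.iterate_succ_apply']
    exact hc.le_stepOp_iterate.trans hs.le_stepOp

lemma measurable_stepOp_iterate {φ : Config N → ℝ≥0∞} (hφ : Measurable φ) (M : ℕ) :
    Measurable ((stepOp ε h)^[M] φ) := by
  induction M with
  | zero => exact hφ
  | succ M ih => rw [Function.iterate_succ_apply']; exact measurable_stepOp ih

lemma lintegral_stepOp_iterate_le (hε : 0 < ε) (hε1 : ε ≤ 1) {φ : Config N → ℝ≥0∞}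
    (hφ : Measurable φ) (M : ℕ) : ∫⁻ Z, (stepOp ε h)^[M] φ Z ≤ ∫⁻ Z, φ Z := by
  induction M with
  | zero => exact le_rfl
  | succ M ih =>
    rw [Function.iterate_succ_apply']
    exact (lintegral_stepOp_le hε hε1 (measurable_stepOp_iterate hφ M)).trans ih

lemma TrajOn.exists_velocity_bound (hζ : TrajOn ε ζ a b) :
    ∃ V, ∀ s ∈ Icc a b, ∀ k, ‖(ζ s k).2‖ ≤ V := by
  set F := insert a (collisionTimes ε ζ ∩ Ioc a b) with hF
  have hFfin : F.Finite := hζ.finite.insert a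
  obtain ⟨V, hV⟩ := (hFfin.image fun s => ∑ k, ‖(ζ s k).2‖).bddAbove
  refine ⟨V, fun s hs k => ?_⟩
  -- `r` is the last collision time up to `s`, or `a` if there is none; velocities are constant from
  -- `r` to `s`.
  obtain ⟨r, hr, hmax⟩ := Set.exists_max_image (F ∩ Iic s) id (hFfin.subset inter_subset_left)
    ⟨a, mem_insert _ _, hs.1⟩
  have hra : a ≤ r := by
    rcases hr.1 with h | h
    · exact h.ge
    · exact h.2.1.le
  have hvel := hζ.velocity r s hra hr.2 hs.2 (Set.disjoint_left.2 fun u hu huI =>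
    absurd (hmax u ⟨mem_insert_of_mem _ ⟨hu, hra.trans_lt huI.1, huI.2.trans hs.2⟩, huI.2⟩)
      (not_le.2 huI.1)) k
  rw [hvel]
  exact (Finset.single_le_sum (f := fun k => ‖(ζ r k).2‖) (fun _ _ => norm_nonneg _)
    (Finset.mem_univ k)).trans (hV (mem_image_of_mem _ hr.1))

/-- For short time steps, no particle moves far within a step, and in each step there is at most
one collision time. -/
lemma TrajOn.exists_mesh (hε : 0 < ε) (hζ : TrajOn ε ζ a b) :
    ∃ δ > 0, ∀ h, 0 < h → h < δ → ∀ c, a ≤ c → c + h ≤ b →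
      ζ c ∈ slow ε h ∧ (collisionTimes ε ζ ∩ Ioc c (c + h)).Subsingleton := by
  obtain ⟨V, hV⟩ := hζ.exists_velocity_bound
  obtain ⟨δ₁, hδ₁, hsep⟩ : ∃ δ > 0, ∀ s ∈ collisionTimes ε ζ ∩ Ioc a b,
      ∀ r ∈ collisionTimes ε ζ ∩ Ioc a b, s ≠ r → δ ≤ dist s r := by
    by_cases hnt : (collisionTimes ε ζ ∩ Ioc a b).Nontrivial
    · exact ⟨_, hζ.finite.infsep_pos_iff_nontrivial.2 hnt, fun s hs r hr hne =>
        Set.infsep_le_dist_of_mem hs hr hne⟩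
    · exact ⟨1, one_pos, fun s hs r hr hne =>
        absurd (Set.not_nontrivial_iff.1 hnt hs hr) hne⟩
  refine ⟨min δ₁ (ε / (8 * (|V| + 1))), lt_min hδ₁ (by positivity), fun h h0 hh c hac hcb => ⟨?_,
    ?_⟩⟩
  · intro k
    have h1 : ‖(ζ c k).2‖ ≤ |V| + 1 :=
      (hV c ⟨hac, by linarith⟩ k).trans (by linarith [le_abs_self V])
    have h2 : h ≤ ε / (8 * (|V| + 1)) := (hh.trans_le (min_le_right _ _)).le
    calc h * ‖(ζ c k).2‖ ≤ ε / (8 * (|V| + 1)) * (|V| + 1) := by gcongr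
      _ = ε / 8 := by field_simp
  · intro s hs r hr
    by_contra hne
    have h1 := hsep s ⟨hs.1, hac.trans_lt hs.2.1, hs.2.2.trans hcb⟩ r
      ⟨hr.1, hac.trans_lt hr.2.1, hr.2.2.trans hcb⟩ hne
    have h2 : dist s r < h := by
      rw [Real.dist_eq, abs_lt]
      constructor <;> linarith [hs.2.1, hs.2.2, hr.2.1, hr.2.2]
    linarith [hh.trans_le (min_le_left _ _)]

lemma chain_of_mesh (hε : 0 < ε) (hε1 : ε ≤ 1) (h0 : 0 < h) :
    ∀ (M : ℕ) (a : ℝ), TrajOn ε ζ a (a + M * h) → (∀ c, a ≤ c → c + h ≤ a + M * h →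
      ζ c ∈ slow ε h ∧ (collisionTimes ε ζ ∩ Ioc c (c + h)).Subsingleton) →
      Chain ε h M (ζ a) (ζ (a + M * h))
  | 0, a, _, _ => by simp [Chain]
  | M + 1, a, hζ, hm => by
    have hle : a + h ≤ a + ((M + 1 : ℕ) : ℝ) * h := by
      push_cast
      nlinarith [mul_nonneg (Nat.cast_nonneg (α := ℝ) M) h0.le]
    have heq : a + ((M + 1 : ℕ) : ℝ) * h = a + h + M * h := by push_cast; ring
    refine ⟨ζ (a + h), ?_, ?_⟩
    · have := hm a le_rfl hle
      exact group_step hε hε1 h0.le (hζ.mono le_rfl hle) this.1 this.2 Function.injective_id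
        fun s _ k l _ => ⟨l, rfl⟩
    · rw [heq]
      refine chain_of_mesh hε hε1 h0 M (a + h) (hζ.mono (by linarith) heq.ge) fun c hc hc' => ?_
      exact hm c (by linarith) (by rw [heq]; exact hc')

/-- Finitely many collision times have a positive minimal distance, and velocities are bounded;
every sufficiently fine uniform mesh therefore reproduces the trajectory exactly, not just
approximately. -/
lemma TrajOn.eventually_chain (hε : 0 < ε) (hε1 : ε ≤ 1) (hab : a < b) (hζ : TrajOn ε ζ a b) :
    ∀ᶠ p : ℕ in Filter.atTop, Chain ε ((b - a) / (p + 1)) (p + 1) (ζ a) (ζ b) := by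
  obtain ⟨δ, hδ, H⟩ := hζ.exists_mesh hε
  have hlim := tendsto_const_div_atTop_nhds_zero_nat (b - a)
  have hlim' := (Filter.tendsto_add_atTop_iff_nat 1).2 hlim
  filter_upwards [hlim'.eventually (gt_mem_nhds hδ)] with p hp
  have hpos : 0 < (b - a) / (p + 1) := div_pos (sub_pos.2 hab) (by positivity)
  have heq : a + ((p + 1 : ℕ) : ℝ) * ((b - a) / (p + 1)) = b := by
    push_cast; field_simp; ring
  have := chain_of_mesh (ζ := ζ) hε hε1 hpos (p + 1) a (by rwa [heq]) fun c hc hc' =>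
    H _ hpos (by exact_mod_cast hp) c hc (by rwa [heq] at hc')
  rwa [heq] at this

/-- Both trajectories are chains for a common fine mesh, and chains are deterministic. -/
lemma TrajOn.eqOn_of_left (hε : 0 < ε) (hε1 : ε ≤ 1) (hζ : TrajOn ε ζ a b) (hη : TrajOn ε η a b)
    (h : ζ a = η a) : EqOn ζ η (Icc a b) := by
  intro s hs
  rcases hs.1.eq_or_lt with rfl | has
  · exact h
  obtain ⟨p, h1, h2⟩ := (((hζ.mono le_rfl hs.2).eventually_chain hε hε1 has).and
    ((hη.mono le_rfl hs.2).eventually_chain hε hε1 has)).exists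
  rw [← h] at h2
  exact h1.unique_right hε hε1 h2

lemma TrajOn.eqOn_of_right (hε : 0 < ε) (hε1 : ε ≤ 1) (hζ : TrajOn ε ζ a b) (hη : TrajOn ε η a b)
    (h : ζ b = η b) : EqOn ζ η (Icc a b) := by
  intro s hs
  rcases hs.2.eq_or_lt with rfl | hsb
  · exact h
  obtain ⟨p, h1, h2⟩ := (((hζ.mono hs.1 le_rfl).eventually_chain hε hε1 hsb).and
    ((hη.mono hs.1 le_rfl).eventually_chain hε hε1 hsb)).exists
  rw [← h] at h2
  exact h1.unique_left hε hε1 h2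

/-- A pair in contact that moves apart is at a distance greater than `ε` from then on; used after
the collision, and before it with reversed velocity. -/
lemma lt_norm_add_smul {ω u : E3} (hω : ‖ω‖ = 1) (hu : 0 < ⟪ω, u⟫) {r : ℝ} (hr : 0 < r) :
    ε < ‖ε • ω + r • u‖ := by
  have h1 : ⟪ω, ε • ω + r • u⟫ ≤ ‖ε • ω + r • u‖ := by
    simpa [hω] using real_inner_le_norm ω (ε • ω + r • u)
  rw [inner_add_right, real_inner_smul_right, real_inner_smul_right, real_inner_self_eq_norm_sq,
    hω] at h1
  nlinarith [mul_pos hr hu]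

lemma dir_unique (hε : 0 < ε) (hε1 : ε ≤ 1) {ω ω' : E3} (hω : ‖ω‖ = 1) (hω' : ‖ω'‖ = 1)
    (h : toTorus (ε • ω) = toTorus (ε • ω')) : ω = ω' := by
  have hn : ∀ u : E3, ‖u‖ = 1 → ‖ε • u‖ < Real.pi := fun u hu => by
    rw [norm_smul, hu, Real.norm_of_nonneg hε.le]; linarith [Real.pi_gt_three]
  have := congrArg lift h
  rw [lift_toTorus (hn _ hω), lift_toTorus (hn _ hω')] at this
  exact smul_right_injective _ hε.ne' this

lemma exists_trajOn_free {Z : Config N} (hZ : Z ∈ Free ε h) :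
    TrajOn ε (fun s => freeFlow s Z) 0 h := by
  have hnot : ∀ s ∈ Ioc 0 h, s ∉ collisionTimes ε fun s => freeFlow s Z := by
    rintro s hs ⟨i, j, hij, hd⟩
    exact absurd hd (hZ.2 i j hij s hs).ne'
  constructor
  · intro s hs i j hij
    exact (hZ.2 i j hij s hs).le
  · refine Set.finite_empty.subset ?_
    rintro s ⟨hs, hsI⟩
    exact hnot s hsI hs
  · intro c d _ _ _ _ i
    simp only [freeFlow_fst, freeFlow_snd, add_assoc, ← toTorus_add, ← add_smul]
    congr 3; ring
  · intro c d _ _ _ _ i; rfl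
  · intro s hs i j hij
    exact absurd ⟨i, j, hij⟩ (hnot s hs)
  · intro c s hc hcs hs _ i j hij
    exact absurd ⟨i, j, hij⟩ (hnot s ⟨hc.trans_lt hcs, hs⟩)

/-- The motion with one collision, of `i` and `j` at the time `σ`, that transfers `w`. -/
noncomputable def brokenPath (Z : Config N) (i j : Fin N) (σ : ℝ) (w : E3) (s : ℝ) : Config N :=
  fun k => (brokenPos Z i j σ w s k, if s < σ then (Z k).2 else
    (Z k).2 + if k = i then -w else if k = j then w else 0)

/-- Contacts of all other pairs are excluded by the definition of the branch, and the colliding pair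
touches only at `σ`, because it approaches before and separates after. -/
lemma trajOn_brokenPath (hε : 0 < ε) (hε1 : ε ≤ 1) {i j : Fin N} (hij : i ≠ j) {Z : Config N}
    (hZ : Z ∈ Coll ε h i j) :
    TrajOn ε (brokenPath Z i j (collTime ε h i j Z) (transfer ε h i j Z)) 0 h := by
  obtain ⟨hslow, hdom, hother⟩ := hZ
  set σ := collTime ε h i j Z with hσ
  set w := transfer ε h i j Z with hw
  set ζ := brokenPath Z i j σ w with hζ
  set p := relState (freeFlow h Z i - freeFlow h Z j) with hp
  set ω := scatDir ε p with hω
  set v := (Z i).2 - (Z j).2 with hv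
  have hσm : σ ∈ Ioc 0 h := collTime_mem hdom
  have hω1 : ‖ω‖ = 1 := norm_scatDir hε hdom.1
  have hw' : w = ⟪ω, v⟫ • ω := rfl
  have hneg : ⟪ω, v⟫ < 0 := scatSpeed_neg hε hdom.1
  have hvh : h * ‖v‖ ≤ ε / 4 := hdom.2.2
  have hpσ := (torusDist_collTime hε hε1 hdom).1
  have hzpos : ∀ s k, (ζ s k).1 = brokenPos Z i j σ w s k := fun _ _ => rfl
  -- The collision reverses the component of the relative velocity along `ω`.
  have hlater : ⟪ω, v - (2 : ℝ) • w⟫ = -⟪ω, v⟫ := by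
    rw [hw', inner_sub_right, real_inner_smul_right, real_inner_smul_right,
      real_inner_self_eq_norm_sq, hω1]; ring
  have hlatern : ‖v - (2 : ℝ) • w‖ = ‖v‖ := by
    have h1 := norm_scat_snd hε hdom.1
    rw [scat_snd] at h1
    rw [hw', smul_smul]; exact h1
  have hrelσ : (brokenPos Z i j σ w σ i) - (brokenPos Z i j σ w σ j) = toTorus (ε • ω) := by
    rw [brokenPos_of_le le_rfl, brokenPos_of_le le_rfl]; exact hpσ
  have hdist : ∀ s ∈ Ioc 0 h, s ≠ σ → ε < torusDist (ζ s i).1 (ζ s j).1 := by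
    intro s hs hne
    rcases lt_or_gt_of_ne hne with hlt | hlt
    · have h1 : (ζ s i).1 - (ζ s j).1 = toTorus (ε • ω + (σ - s) • -v) := by
        rw [hzpos, hzpos, brokenPos_of_le hlt.le, brokenPos_of_le hlt.le, toTorus_add, ← hpσ, hv]
        simp only [freeFlow_fst, smul_neg, smul_sub, sub_smul, toTorus_neg, toTorus_sub]
        abel
      have h2 : ‖ε • ω + (σ - s) • -v‖ ≤ 5 / 4 * ε := by
        refine (norm_add_le _ _).trans ?_
        rw [norm_smul, norm_smul, hω1, Real.norm_of_nonneg hε.le, Real.norm_of_nonneg (by linarith),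
          norm_neg]
        nlinarith [norm_nonneg v, hσm.2, hs.1]
      rw [torusDist_of_sub_eq h1 (lt_pi_of_le hε1 h2)]
      exact lt_norm_add_smul hω1 (by rw [inner_neg_right]; linarith) (by linarith)
    · have h1 : (ζ s i).1 - (ζ s j).1 = toTorus (ε • ω + (s - σ) • (v - (2 : ℝ) • w)) := by
        rw [hzpos, hzpos, toTorus_add, ← hrelσ, hv]
        simp only [brokenPos, if_pos, if_neg hij.symm, max_eq_left (by linarith : 0 ≤ s - σ),
          sub_self,
          max_self, zero_smul, toTorus_zero, smul_sub, sub_smul, toTorus_sub, two_smul, smul_add,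
          toTorus_add]
        abel
      have h2 : ‖ε • ω + (s - σ) • (v - (2 : ℝ) • w)‖ ≤ 5 / 4 * ε := by
        refine (norm_add_le _ _).trans ?_
        rw [norm_smul, norm_smul, hω1, Real.norm_of_nonneg hε.le, Real.norm_of_nonneg (by linarith),
          hlatern]
        nlinarith [norm_nonneg v, hσm.1, hs.2]
      rw [torusDist_of_sub_eq h1 (lt_pi_of_le hε1 h2)]
      exact lt_norm_add_smul hω1 (by rw [hlater]; linarith) (by linarith)
  have hdistσ : torusDist (ζ σ i).1 (ζ σ j).1 = ε := by
    rw [hzpos, hzpos, brokenPos_of_le le_rfl, brokenPos_of_le le_rfl]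
    exact (torusDist_collTime hε hε1 hdom).2
  have hcontact : ∀ s ∈ Ioc 0 h, ∀ k l, InContact ε (ζ s) k l →
      s = σ ∧ ((k = i ∧ l = j) ∨ (k = j ∧ l = i)) := by
    intro s hs k l hkl
    have hpair : (k = i ∧ l = j) ∨ (k = j ∧ l = i) := by
      by_contra hne
      exact absurd hkl.2 (hother k l hkl.1 hne s hs).ne'
    refine ⟨by_contra fun hne => ?_, hpair⟩
    rcases hpair with ⟨rfl, rfl⟩ | ⟨rfl, rfl⟩
    · exact absurd hkl.2 (hdist s hs hne).ne'
    · exact absurd hkl.symm.2 (hdist s hs hne).ne'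
  have hσC : σ ∈ collisionTimes ε ζ := ⟨i, j, hij, hdistσ⟩
  have hvel_before : ∀ s < σ, ∀ k, (ζ s k).2 = (Z k).2 := fun s hs k => by
    simp only [hζ, brokenPath, if_pos hs]
  have hvel_after : ∀ s, σ ≤ s → ∀ k, (ζ s k).2 =
      (Z k).2 + if k = i then -w else if k = j then w else 0 := fun s hs k => by
    simp only [hζ, brokenPath, if_neg hs.not_gt]
  constructor
  · intro s hs k l hkl
    by_cases hpair : (k = i ∧ l = j) ∨ (k = j ∧ l = i)
    · have : ε ≤ torusDist (ζ s i).1 (ζ s j).1 := by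
        by_cases hsσ : s = σ
        · rw [hsσ, hdistσ]
        · exact (hdist s hs hsσ).le
      rcases hpair with ⟨rfl, rfl⟩ | ⟨rfl, rfl⟩
      · exact this
      · rwa [torusDist_comm]
    · exact (hother k l hkl hpair s hs).le
  · refine (Set.finite_singleton σ).subset ?_
    rintro s ⟨⟨k, l, hkl⟩, hsI⟩
    exact (hcontact s hsI k l hkl).1
  · intro c d hc hcd hd hdis k
    rcases hcd.eq_or_lt with rfl | hlt
    · simp
    rcases le_or_gt d σ with hdσ | hdσ
    · rw [hzpos, hzpos, brokenPos_of_le hdσ, brokenPos_of_le (hlt.le.trans hdσ), freeFlow_fst,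
        freeFlow_fst, hvel_before c (hlt.trans_le hdσ), add_assoc, ← toTorus_add, ← add_smul]
      congr 3; ring
    · have hcσ : σ ≤ c := by
        by_contra hcon
        exact Set.disjoint_left.1 hdis hσC ⟨not_le.1 hcon, hdσ⟩
      rw [hzpos, hzpos, hvel_after c hcσ]
      simp only [brokenPos, max_eq_left (sub_nonneg.2 hcσ), max_eq_left (sub_nonneg.2 hdσ.le)]
      split_ifs
      · simp only [smul_add, sub_smul, smul_neg, toTorus_add, toTorus_sub, toTorus_neg]; abel
      · simp only [smul_add, sub_smul, toTorus_add, toTorus_sub]; abel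
      · simp only [add_zero, sub_smul, toTorus_sub]; abel
  · intro c d hc hcd hd hdis k
    rcases lt_or_ge d σ with hdσ | hdσ
    · rw [hvel_before d hdσ, hvel_before c (hcd.trans_lt hdσ)]
    · have hcσ : σ ≤ c := by
        by_contra hcon
        exact Set.disjoint_left.1 hdis hσC ⟨not_le.1 hcon, hdσ⟩
      rw [hvel_after d hdσ, hvel_after c hcσ]
  · intro s hs k l hkl k' l' hkl'
    rcases (hcontact s hs k l hkl).2 with ⟨rfl, rfl⟩ | ⟨rfl, rfl⟩
    · exact (hcontact s hs k' l' hkl').2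
    · exact (hcontact s hs k' l' hkl').2.symm
  · intro c s hc hcs hs hdis k l hkl
    obtain ⟨rfl, hpair⟩ := hcontact s ⟨hc.trans_lt hcs, hs⟩ k l hkl
    rcases hpair with ⟨rfl, rfl⟩ | ⟨rfl, rfl⟩
    · refine ⟨fun ω' hω' hpos => ?_, fun l hl hl' => ?_⟩
      -- The collision rule quantifies over all directions of contact, but for `ε ≤ 1` there is only
      -- one.
      · have : ω' = ω := dir_unique hε hε1 hω' hω1 (by rw [← hpos, ← hrelσ]; rfl)
        subst this
        rw [hvel_before c hcs, hvel_before c hcs, hvel_after _ le_rfl, hvel_after _ le_rfl,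
          if_pos rfl,
          if_neg hij.symm, if_pos rfl]
        exact ⟨hneg, by rw [sub_eq_add_neg, hw'], by rw [hw']⟩
      · rw [hvel_before c hcs, hvel_after _ le_rfl, if_neg hl, if_neg hl', add_zero]
    · refine ⟨fun ω' hω' hpos => ?_, fun l hl hl' => ?_⟩
      -- With the two particles exchanged the direction is reversed, and the rule is invariant under
      -- this change.
      · have hneg' : -ω' = ω := by
          refine dir_unique hε hε1 (by rwa [norm_neg]) hω1 ?_
          rw [smul_neg, toTorus_neg, ← hpos, ← hrelσ, neg_sub]; rfl
        have hω'' : ω' = -ω := by rw [← hneg', neg_neg]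
        have hinner : ⟪ω', (Z k).2 - (Z l).2⟫ = ⟪ω, v⟫ := by
          rw [hω'', hv, inner_neg_left, ← inner_neg_right, neg_sub]
        rw [hvel_before c hcs, hvel_before c hcs, hvel_after _ le_rfl, hvel_after _ le_rfl,
          if_pos rfl,
          if_neg hij.symm, if_pos rfl, hinner, hω'', hw']
        exact ⟨hneg, by rw [smul_neg, sub_neg_eq_add], by rw [smul_neg]⟩
      · rw [hvel_before c hcs, hvel_after _ le_rfl, if_neg hl', if_neg hl, add_zero]

lemma Step.exists_trajOn (hε : 0 < ε) (hε1 : ε ≤ 1) {Z Z' : Config N} (hs : Step ε h Z Z') :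
    ∃ ζ : ℝ → Config N, TrajOn ε ζ 0 h ∧ ζ 0 = Z ∧ ζ h = Z' := by
  obtain ⟨q, hq, rfl⟩ := hs
  cases q with
  | none => exact ⟨_, exists_trajOn_free hq, freeFlow_zero Z, rfl⟩
  | some p =>
    have hσ := collTime_mem hq.2.1
    refine ⟨_, trajOn_brokenPath hε hε1 p.2.ne hq, ?_, ?_⟩
    · funext k
      ext1
      · simp only [brokenPath]
        rw [brokenPos_of_le hσ.1.le, freeFlow_zero]
      · simp only [brokenPath, if_pos hσ.1]
    · funext k
      ext1
      · have := collide_freeFlow_fst p.2.ne (ε := ε) (h := h) (Z := Z) (s := 0) hq.2.1.2.1.1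
          hq.2.1.2.1.1 k
        rw [neg_zero, freeFlow_zero, sub_zero] at this
        exact this.symm
      · simp only [brokenPath, if_neg hσ.2.not_gt, branchMap]
        by_cases hki : k = p.1.1
        · rw [hki, collide_left p.2.ne, if_pos rfl, Prod.snd_sub, freeFlow_snd, sub_eq_add_neg]; rfl
        · by_cases hkj : k = p.1.2
          · rw [hkj, collide_right, if_neg p.2.ne', if_pos rfl, Prod.snd_add, freeFlow_snd]; rfl
          · rw [collide_of_ne hki hkj, if_neg hki, if_neg hkj, add_zero, freeFlow_snd]

/-- Each step comes from a piece of trajectory, and consecutive pieces are glued. -/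
lemma Chain.exists_trajOn (hε : 0 < ε) (hε1 : ε ≤ 1) (h0 : 0 < h) : ∀ {M : ℕ} {Z Z' : Config N},
    Chain ε h M Z Z' → ∃ ζ : ℝ → Config N, TrajOn ε ζ 0 (M * h) ∧ ζ 0 = Z ∧ ζ (M * h) = Z'
  | 0, Z, Z', hc => by
    refine ⟨fun _ => Z, ?_, rfl, hc⟩
    constructor
    · simp
    · simp
    · intro c d hc hcd hd _ i
      have : c = d := by simp at hd; linarith
      simp [this]
    · intros; rfl
    · simp
    · intro c s hc hcs hs
      simp at hs; linarith
  | M + 1, Z, Z', ⟨W, hs, hc⟩ => by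
    obtain ⟨ζ, hζ, hζ0, hζh⟩ := hs.exists_trajOn hε hε1
    obtain ⟨η, hη, hη0, hηM⟩ := hc.exists_trajOn hε hε1 h0
    have heq : ((M + 1 : ℕ) : ℝ) * h = M * h + h := by push_cast; ring
    have hMh : 0 ≤ M * h := by positivity
    refine ⟨fun s => if s ≤ h then ζ s else η (s - h), ?_, by simp [h0.le, hζ0], ?_⟩
    · refine TrajOn.glue (b := h) (hζ.congr fun s hs => by simp [hs.2]) ?_
      have h1 := hη.shift (-h)
      rw [show (0 : ℝ) - -h = h by ring,
        show M * h - -h = ((M + 1 : ℕ) : ℝ) * h by rw [heq]; ring] at h1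
      refine h1.congr fun s hs => ?_
      rcases hs.1.eq_or_lt with rfl | hlt
      · simp [hη0, hζh]
      · simp [hlt, sub_eq_add_neg]
    · simp only [heq]
      split_ifs with hle
      · have h2 : M * h = 0 := le_antisymm (by linarith) hMh
        rw [h2] at hηM ⊢
        rw [zero_add, hζh, ← hη0, hηM]
      · rw [add_sub_cancel_right, hηM]

end Chains

/-! ### The flow: uniqueness, measurability, and no increase of integrals. -/

section Flow

variable {ε : ℝ} {N : ℕ} {ζ η : ℝ → Config N} {a b s : ℝ} {Z : Config N}

lemma IsTrajectory.eq_of_eq (hε : 0 < ε) (hε1 : ε ≤ 1) (hζ : IsTrajectory ε ζ)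
    (hη : IsTrajectory ε η) {r : ℝ} (h : ζ r = η r) : ζ = η := by
  funext s
  rcases le_total r s with hs | hs
  · exact (hζ.trajOn r s).eqOn_of_left hε hε1 (hη.trajOn r s) h ⟨hs, le_rfl⟩
  · exact (hζ.trajOn s r).eqOn_of_right hε hε1 (hη.trajOn s r) h ⟨le_rfl, hs⟩

lemma IsTrajectory.shift (hζ : IsTrajectory ε ζ) (r : ℝ) :
    IsTrajectory ε fun s => ζ (s + r) :=
  isTrajectory_of_trajOn fun m => by
    simpa using (hζ.trajOn (-m + r) (m + r)).shift r

lemma flow_of_not_wellPosed (hZ : ¬ WellPosed ε Z) : flow ε s Z = Z := by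
  rw [flow, dif_neg hZ]

lemma WellPosed.isTrajectory_flow (hZ : WellPosed ε Z) :
    IsTrajectory ε fun s => flow ε s Z := by
  have : (fun s => flow ε s Z) = hZ.choose := by funext s; rw [flow, dif_pos hZ]
  rw [this]
  exact hZ.choose_spec.1

lemma flow_zero (Z : Config N) : flow ε 0 Z = Z := by
  by_cases hZ : WellPosed ε Z
  · rw [flow, dif_pos hZ, hZ.choose_spec.2]
  · exact flow_of_not_wellPosed hZ

lemma flow_eq (hε : 0 < ε) (hε1 : ε ≤ 1) (hζ : IsTrajectory ε ζ) (s : ℝ) :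
    flow ε s (ζ 0) = ζ s := by
  have hZ : WellPosed ε (ζ 0) := ⟨ζ, hζ, rfl⟩
  exact congrFun (hZ.isTrajectory_flow.eq_of_eq hε hε1 hζ (r := 0) (flow_zero _)) s

lemma WellPosed.flow_flow (hε : 0 < ε) (hε1 : ε ≤ 1) (hZ : WellPosed ε Z) (r s : ℝ) :
    HardSpheres.flow ε r (HardSpheres.flow ε s Z) = HardSpheres.flow ε (r + s) Z := by
  have := flow_eq hε hε1 (hZ.isTrajectory_flow.shift s) r
  simpa using this

lemma WellPosed.comp_perm (hZ : WellPosed ε Z) (σ : Equiv.Perm (Fin N)) :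
    WellPosed ε (Z ∘ σ) := by
  obtain ⟨ζ, hζ, rfl⟩ := hZ
  exact ⟨_, hζ.comp_perm σ, rfl⟩

lemma flow_comp_perm (hε : 0 < ε) (hε1 : ε ≤ 1) (s : ℝ) (Z : Config N) (σ : Equiv.Perm (Fin N)) :
    flow ε s (Z ∘ σ) = flow ε s Z ∘ σ := by
  by_cases hZ : WellPosed ε Z
  · obtain ⟨ζ, hζ, rfl⟩ := hZ
    rw [flow_eq hε hε1 hζ s]
    exact flow_eq hε hε1 (hζ.comp_perm σ) s
  · have hZ' : ¬ WellPosed ε (Z ∘ σ) := fun h => hZ (by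
      have := h.comp_perm σ.symm
      rwa [Function.comp_assoc, Equiv.self_comp_symm, Function.comp_id] at this)
    rw [flow_of_not_wellPosed hZ, flow_of_not_wellPosed hZ']

/-- A configuration from which chains of time steps of every length start and which are the end of
such chains is well-posed. -/
lemma wellPosed_of_chain (hε : 0 < ε) (hε1 : ε ≤ 1)
    (hr : ∀ m : ℕ, ∃ p : ℕ, ∃ Z', Chain ε (1 / (p + 1)) (m * (p + 1)) Z Z')
    (hl : ∀ m : ℕ, ∃ p : ℕ, ∃ Z', Chain ε (1 / (p + 1)) (m * (p + 1)) Z' Z) : WellPosed ε Z := by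
  have hlen : ∀ m p : ℕ, ((m * (p + 1) : ℕ) : ℝ) * (1 / (p + 1)) = m := by
    intro m p
    push_cast
    have : (p : ℝ) + 1 ≠ 0 := by positivity
    field_simp
  have hex : ∀ m : ℕ, ∃ ξ : ℝ → Config N, TrajOn ε ξ (-m) m ∧ ξ 0 = Z := by
    intro m
    obtain ⟨p, Z₁, h₁⟩ := hr m
    obtain ⟨q, Z₂, h₂⟩ := hl m
    obtain ⟨η, hη, hη0, -⟩ := h₁.exists_trajOn hε hε1 (by positivity)
    obtain ⟨θ, hθ, -, hθm⟩ := h₂.exists_trajOn hε hε1 (by positivity)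
    rw [hlen] at hη hθ hθm
    have hθ' := hθ.shift m
    rw [zero_sub, sub_self] at hθ'
    refine ⟨fun s => if s ≤ 0 then θ (s + m) else η s,
      TrajOn.glue (b := 0) (hθ'.congr fun s hs => by simp [hs.2]) (hη.congr fun s hs => ?_),
      by simp [hθm]⟩
    rcases hs.1.eq_or_lt with rfl | hpos
    · simp [hη0, hθm]
    · simp [hpos.not_ge]
  choose ξ hξ hξ0 using hex
  have hcons : ∀ m m' : ℕ, m ≤ m' → EqOn (ξ m) (ξ m') (Icc (-m) m) := by
    intro m m' hm s hs
    have hm' : (m : ℝ) ≤ m' := by exact_mod_cast hm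
    have h0 : ξ m 0 = ξ m' 0 := by rw [hξ0, hξ0]
    rcases le_total 0 s with h | h
    · exact ((hξ m).mono (by simp) le_rfl).eqOn_of_left hε hε1
        ((hξ m').mono (by simp) hm') h0 ⟨h, hs.2⟩
    · exact ((hξ m).mono le_rfl (by simp)).eqOn_of_right hε hε1
        ((hξ m').mono (by linarith) (by simp)) h0 ⟨hs.1, h⟩
  -- By uniqueness the trajectories on growing intervals are compatible, so at the time `s` any one
  -- whose interval contains `s` may be used.
  refine ⟨fun s => ξ ⌈|s|⌉₊ s, isTrajectory_of_trajOn fun m => (hξ m).congr fun s hs => ?_, ?_⟩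
  · exact (hcons _ _ (Nat.ceil_le.2 (abs_le.2 hs)) (abs_le.1 (Nat.le_ceil |s|))).symm
  · simp [hξ0]

lemma WellPosed.eventually_chain_right (hε : 0 < ε) (hε1 : ε ≤ 1) (hZ : WellPosed ε Z)
    (hs : 0 < s) :
    ∀ᶠ p : ℕ in Filter.atTop, Chain ε (s / (p + 1)) (p + 1) Z (HardSpheres.flow ε s Z) := by
  simpa [flow_zero] using (hZ.isTrajectory_flow.trajOn 0 s).eventually_chain hε hε1 hs

lemma WellPosed.eventually_chain_left (hε : 0 < ε) (hε1 : ε ≤ 1) (hZ : WellPosed ε Z)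
    (hs : 0 < s) :
    ∀ᶠ p : ℕ in Filter.atTop, Chain ε (s / (p + 1)) (p + 1) (HardSpheres.flow ε (-s) Z) Z := by
  simpa [flow_zero] using
    (hZ.isTrajectory_flow.trajOn (-s) 0).eventually_chain hε hε1 (neg_lt_zero.2 hs)

/-- Step lengths `1 / (p + 1)` divide every integer length, so well-posedness can be expressed by
countably many conditions on chains. -/
lemma TrajOn.exists_chain (hε : 0 < ε) (hε1 : ε ≤ 1) (hζ : TrajOn ε ζ a b) {m : ℕ}
    (hm : a + m = b) : ∃ p : ℕ, Chain ε (1 / (p + 1)) (m * (p + 1)) (ζ a) (ζ b) := by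
  obtain ⟨δ, hδ, H⟩ := hζ.exists_mesh hε
  obtain ⟨p, hp⟩ := exists_nat_one_div_lt hδ
  have hpos : (0 : ℝ) < 1 / (p + 1) := by positivity
  have heq : a + ((m * (p + 1) : ℕ) : ℝ) * (1 / (p + 1)) = b := by
    rw [← hm]
    push_cast
    have : (p : ℝ) + 1 ≠ 0 := by positivity
    field_simp
  refine ⟨p, ?_⟩
  have := chain_of_mesh (ζ := ζ) hε hε1 hpos (m * (p + 1)) a (by rwa [heq]) fun c hc hc' =>
    H _ hpos hp c hc (by rwa [heq] at hc')
  rwa [heq] at this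

/-- Well-posedness amounts to the existence, for every `m`, of some chain of length `m` forwards and
of one backwards: countably many measurable conditions. -/
lemma measurableSet_wellPosed (hε : 0 < ε) (hε1 : ε ≤ 1) :
    MeasurableSet {Z : Config N | WellPosed ε Z} := by
  have : {Z : Config N | WellPosed ε Z} =
      (⋂ m : ℕ, ⋃ p : ℕ, {Z | ∃ Z' ∈ univ, Chain ε (1 / (p + 1)) (m * (p + 1)) Z Z'}) ∩
      ⋂ m : ℕ, ⋃ p : ℕ, {Z | ∃ Z' ∈ univ, Chain ε (1 / (p + 1)) (m * (p + 1)) Z' Z} := by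
    ext Z
    simp only [mem_ofPred_eq, mem_inter_iff, mem_iInter, mem_iUnion, mem_univ, true_and]
    constructor
    · rintro ⟨ζ, hζ, rfl⟩
      refine ⟨fun m => ?_, fun m => ?_⟩
      · obtain ⟨p, hp⟩ := (hζ.trajOn 0 m).exists_chain hε hε1 (zero_add _)
        exact ⟨p, _, hp⟩
      · obtain ⟨p, hp⟩ := (hζ.trajOn (-m) 0).exists_chain hε hε1 (neg_add_cancel _)
        exact ⟨p, _, hp⟩
    · rintro ⟨h₁, h₂⟩
      exact wellPosed_of_chain hε hε1 h₁ h₂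
  rw [this]
  exact (MeasurableSet.iInter fun m => .iUnion fun p => measurableSet_chain_left _ .univ).inter
    (MeasurableSet.iInter fun m => .iUnion fun p => measurableSet_chain_right hε hε1 _ .univ)

/-- For a well-posed state the end of the chain of every fine mesh is the value of the flow. So
membership of that value in `B` is a countable combination of conditions on chains. -/
lemma measurable_flow (hε : 0 < ε) (hε1 : ε ≤ 1) (s : ℝ) :
    Measurable (flow ε s : Config N → Config N) := by
  have hG := measurableSet_wellPosed (N := N) hε hε1
  intro B hB
  have key : ∃ D : Set (Config N), MeasurableSet D ∧
      ∀ Z, WellPosed ε Z → (flow ε s Z ∈ B ↔ Z ∈ D) := by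
    rcases lt_trichotomy s 0 with hs | rfl | hs
    · refine ⟨⋃ q : ℕ, ⋂ p : ℕ, ⋂ _ : q ≤ p,
        {Z | ∃ Z' ∈ B, Chain ε (-s / (p + 1)) (p + 1) Z' Z}, .iUnion fun q => .iInter fun p =>
          .iInter fun _ => measurableSet_chain_right hε hε1 _ hB, fun Z hZ => ?_⟩
      obtain ⟨q, hq⟩ := Filter.eventually_atTop.1
        (hZ.eventually_chain_left hε hε1 (neg_pos.2 hs))
      simp only [neg_neg] at hq
      simp only [mem_iUnion, mem_iInter, mem_ofPred_eq]
      constructor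
      · exact fun hZB => ⟨q, fun p hp => ⟨_, hZB, hq p hp⟩⟩
      · rintro ⟨r, hr⟩
        obtain ⟨Z', hZ', hc⟩ := hr (max q r) (le_max_right _ _)
        rwa [(hq _ (le_max_left _ _)).unique_left hε hε1 hc]
    · exact ⟨B, hB, fun Z _ => by rw [flow_zero]⟩
    · refine ⟨⋃ q : ℕ, ⋂ p : ℕ, ⋂ _ : q ≤ p,
        {Z | ∃ Z' ∈ B, Chain ε (s / (p + 1)) (p + 1) Z Z'}, .iUnion fun q => .iInter fun p =>
          .iInter fun _ => measurableSet_chain_left _ hB, fun Z hZ => ?_⟩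
      obtain ⟨q, hq⟩ := Filter.eventually_atTop.1 (hZ.eventually_chain_right hε hε1 hs)
      simp only [mem_iUnion, mem_iInter, mem_ofPred_eq]
      constructor
      · exact fun hZB => ⟨q, fun p hp => ⟨_, hZB, hq p hp⟩⟩
      · rintro ⟨r, hr⟩
        obtain ⟨Z', hZ', hc⟩ := hr (max q r) (le_max_right _ _)
        rwa [(hq _ (le_max_left _ _)).unique_right hε hε1 hc]
  obtain ⟨D, hD, hDB⟩ := key
  -- Off the well-posed states the flow is the identity by convention, so the preimage there is `B`
  -- itself.
  have : flow ε s ⁻¹' B = ({Z | WellPosed ε Z} ∩ D) ∪ ({Z | WellPosed ε Z}ᶜ ∩ B) := by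
    ext Z
    by_cases hZ : WellPosed ε Z
    · simp [hZ, hDB Z hZ]
    · simp [hZ, flow_of_not_wellPosed hZ]
  rw [this]
  exact (hG.inter hD).union (hG.compl.inter hB)

/-- The flow does not increase integrals. -/
lemma lintegral_flow_le (hε : 0 < ε) (hε1 : ε ≤ 1) (hs : 0 ≤ s) {φ : Config N → ℝ≥0∞}
    (hφ : Measurable φ) : ∫⁻ Z in {Z | WellPosed ε Z}, φ (flow ε s Z) ≤ ∫⁻ Z, φ Z := by
  rcases hs.eq_or_lt with rfl | hs
  · simp only [flow_zero]
    exact setLIntegral_le_lintegral _ _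
  -- For fine meshes the value of `φ` after the flow is one of the summands of the iterated step,
  -- and Fatou's lemma passes the bound for fixed meshes to the limit.
  set F : ℕ → Config N → ℝ≥0∞ := fun p => (stepOp ε (s / (p + 1)))^[p + 1] φ with hF
  have hFm : ∀ p, Measurable (F p) := fun p => measurable_stepOp_iterate hφ _
  calc ∫⁻ Z in {Z | WellPosed ε Z}, φ (flow ε s Z)
      ≤ ∫⁻ Z in {Z | WellPosed ε Z}, Filter.liminf (fun p => F p Z) Filter.atTop := by
        refine setLIntegral_mono' (measurableSet_wellPosed hε hε1) fun Z hZ => ?_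
        refine Filter.le_liminf_of_le (by isBoundedDefault) ?_
        filter_upwards [WellPosed.eventually_chain_right hε hε1 hZ hs] with p hp
        exact hp.le_stepOp_iterate
    _ ≤ ∫⁻ Z, Filter.liminf (fun p => F p Z) Filter.atTop := setLIntegral_le_lintegral _ _
    _ ≤ Filter.liminf (fun p => ∫⁻ Z, F p Z) Filter.atTop := lintegral_liminf_le hFm
    _ ≤ ∫⁻ Z, φ Z := by
        refine Filter.liminf_le_of_le (by isBoundedDefault) fun b hb => ?_
        obtain ⟨p, hp⟩ := hb.exists
        exact hp.trans (lintegral_stepOp_iterate_le hε hε1 hφ _)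

end Flow

/-! ### From observables of a few particles to marginals. -/

section Marginals

variable {ε : ℝ} {N K : ℕ}

/-- The configuration whose first `K` particles are given by `z`, the other ones by `w`. -/
def joinConfig (z : Config K) (w : {i : Fin N // K ≤ (i : ℕ)} → Particle) : Config N :=
  fun i => if h : (i : ℕ) < K then z ⟨i, h⟩ else w ⟨i, not_lt.mp h⟩

lemma bijective_sumElim_castLE (hK : K ≤ N) :
    Function.Bijective (Sum.elim (Fin.castLE hK) (Subtype.val : {i : Fin N // K ≤
      (i : ℕ)} → Fin N)) := by
  constructor
  · rintro (a | a) (b | b) hab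
    · simpa using hab
    · have := congrArg Fin.val hab
      have h1 := b.2
      have h2 := a.2
      simp at this; omega
    · have := congrArg Fin.val hab
      have h1 := a.2
      have h2 := b.2
      simp at this; omega
    · simpa [Subtype.ext_iff] using hab
  · intro i
    by_cases h : (i : ℕ) < K
    · exact ⟨.inl ⟨i, h⟩, by ext; rfl⟩
    · exact ⟨.inr ⟨i, not_lt.1 h⟩, rfl⟩

lemma measurePreserving_joinConfig (hK : K ≤ N) :
    MeasurePreserving (fun p : Config K × ({i : Fin N // K ≤ (i : ℕ)} → Particle) =>
      joinConfig p.1 p.2) := by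
  set f := Equiv.ofBijective _ (bijective_sumElim_castLE hK) with hf
  have h1 := volume_measurePreserving_piCongrLeft (fun _ : Fin N => Particle) f
  have h2 := volume_measurePreserving_sumPiEquivProdPi_symm
    (fun _ : Fin K ⊕ {i : Fin N // K ≤ (i : ℕ)} => Particle)
  have h3 := h1.comp h2
  suffices heq : (fun p : Config K × ({i : Fin N // K ≤
    (i : ℕ)} → Particle) => joinConfig p.1 p.2) =
      (MeasurableEquiv.piCongrLeft (fun _ : Fin N => Particle) f) ∘
        (MeasurableEquiv.sumPiEquivProdPi
          (fun _ : Fin K ⊕ {i : Fin N // K ≤ (i : ℕ)} => Particle)).symm by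
    rw [heq]; exact h3
  funext p i
  obtain ⟨x, rfl⟩ := f.surjective i
  simp only [Function.comp_apply, MeasurableEquiv.coe_piCongrLeft]
  rw [Equiv.piCongrLeft_apply_apply]
  rcases x with a | a
  · have : ((f (.inl a) : Fin N) : ℕ) = a := rfl
    simp only [joinConfig, this, a.2, dif_pos]
    rfl
  · have : (f (.inr a) : Fin N) = a.1 := rfl
    simp only [joinConfig, this, not_lt.2 a.2, dif_neg, not_false_eq_true]
    rfl

lemma lintegral_mul_castLE (hK : K ≤ N) {W : Config N → ℝ≥0∞} (hW : Measurable W)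
    {ψ : Config K → ℝ≥0∞} (hψ : Measurable ψ) :
    ∫⁻ Y, W Y * ψ (Y ∘ Fin.castLE hK) = ∫⁻ z, marginal W K z * ψ z := by
  have hm : Measurable fun Y : Config N => W Y * ψ (Y ∘ Fin.castLE hK) :=
    hW.mul (hψ.comp (measurable_pi_lambda _ fun k => measurable_pi_apply _))
  rw [← (measurePreserving_joinConfig hK).lintegral_comp hm, Measure.volume_eq_prod,
    lintegral_prod]
  swap
  · exact (hm.comp (measurePreserving_joinConfig hK).measurable).aemeasurable
  refine lintegral_congr fun z => ?_
  have : ∀ w : {i : Fin N // K ≤ (i : ℕ)} → Particle, joinConfig z w ∘ Fin.castLE hK = z := by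
    intro w
    funext k
    simp [joinConfig]
  simp only [this]
  rw [lintegral_mul_const]
  · rfl
  · exact hW.comp ((measurePreserving_joinConfig hK).measurable.comp measurable_prodMk_left)

lemma MarginalBound.ae_marginal_le {β A : ℝ} {W : Config N → ℝ≥0∞} (h : MarginalBound β A W)
    (hK0 : 1 ≤ K) (hK : K ≤ N) :
    ∀ᵐ z : Config K, marginal W K z ≤ ENNReal.ofReal (A ^ K) * gibbs β z := by
  filter_upwards [h K hK0 hK] with z hz
  have h1 : ENNReal.ofReal (∏ i, Real.exp (β / 2 * ‖(z i).2‖ ^ 2)) * gibbs β z = 1 := by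
    rw [gibbs, ← ENNReal.ofReal_mul (by positivity), ← Real.exp_sum, ← Real.exp_add,
      energy, ← Finset.mul_sum, ← Finset.sum_div]
    convert ENNReal.ofReal_one
    rw [Real.exp_eq_one_iff]; ring
  calc marginal W K z
      = marginal W K z * ENNReal.ofReal (∏ i, Real.exp (β / 2 * ‖(z i).2‖ ^ 2)) * gibbs β z := by
        rw [mul_assoc, h1, mul_one]
    _ ≤ _ := by gcongr

/-- Symmetry of the density allows any `K` distinct labels to be moved to the first `K` ones, which
turns the integral into one against the marginal. -/
lemma lintegral_mul_comp_le {β A : ℝ} {W : Config N → ℝ≥0∞} (hW : Measurable W)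
    (hsymm : ∀ (σ : Equiv.Perm (Fin N)) (Z : Config N), W (Z ∘ σ) = W Z)
    (h : MarginalBound β A W) {ψ : Config K → ℝ≥0∞} (hψ : Measurable ψ) (hK0 : 1 ≤ K)
    {e : Fin K → Fin N} (he : Function.Injective e) :
    ∫⁻ Y, W Y * ψ (Y ∘ e) ≤ ENNReal.ofReal (A ^ K) * ∫⁻ z, gibbs β z * ψ z := by
  have hK : K ≤ N := by simpa using Fintype.card_le_of_injective e he
  obtain ⟨σ, hσ⟩ := Equiv.Perm.exists_extending_pair (Fin.castLE hK) e
    (Fin.castLE_injective hK) he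
  have hmp := volume_measurePreserving_piCongrLeft (fun _ : Fin N => Particle) σ.symm
  have hcomp : ∀ Y : Config N,
    MeasurableEquiv.piCongrLeft (fun _ : Fin N => Particle) σ.symm Y = Y ∘ σ := by
    intro Y
    funext i
    obtain ⟨x, rfl⟩ := σ.symm.surjective i
    rw [MeasurableEquiv.coe_piCongrLeft, Equiv.piCongrLeft_apply_apply]
    simp
  have hm : Measurable fun Y : Config N => W Y * ψ (Y ∘ Fin.castLE hK) :=
    hW.mul (hψ.comp (measurable_pi_lambda _ fun k => measurable_pi_apply _))
  calc ∫⁻ Y, W Y * ψ (Y ∘ e)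
      = ∫⁻ Y : Config N, W (Y ∘ σ) * ψ ((Y ∘ σ) ∘ Fin.castLE hK) := by
        refine lintegral_congr fun Y => ?_
        rw [hsymm]
        congr 2
        funext k
        simp only [Function.comp_apply]
        rw [hσ]
    _ = ∫⁻ Y, W Y * ψ (Y ∘ Fin.castLE hK) := by
        rw [← hmp.lintegral_comp hm]
        simp only [hcomp]
    _ = ∫⁻ z, marginal W K z * ψ z := lintegral_mul_castLE hK hW hψ
    _ ≤ ∫⁻ z, ENNReal.ofReal (A ^ K) * (gibbs β z * ψ z) := by
        refine lintegral_mono_ae ?_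
        filter_upwards [h.ae_marginal_le hK0 hK] with z hz
        rw [← mul_assoc]
        gcongr
    _ = _ := lintegral_const_mul' _ _ ENNReal.ofReal_ne_top

lemma evolvedDensity_zero (W₀ : Config N → ℝ≥0∞) : evolvedDensity ε W₀ 0 = W₀ := by
  funext Z
  rw [evolvedDensity, neg_zero, flow_zero]

/-- Observables of `K` particles at the time `s`. -/
lemma lintegral_density_mul_flow_le {β A s : ℝ} (hε : 0 < ε) (hε1 : ε ≤ 1) (hs : 0 ≤ s)
    {W₀ : Config N → ℝ≥0∞} (hW : IsSymmetricDensity ε W₀)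
    (h : MarginalBound β A (evolvedDensity ε W₀ s)) {ψ : Config K → ℝ≥0∞} (hψ : Measurable ψ)
    (hK0 : 1 ≤ K) {e : Fin K → Fin N} (he : Function.Injective e) :
    ∫⁻ Z in {Z | WellPosed ε Z}, W₀ Z * ψ (flow ε s Z ∘ e) ≤
      ENNReal.ofReal (A ^ K) * ∫⁻ z, gibbs β z * ψ z := by
  have hWm : Measurable (evolvedDensity ε W₀ s) := hW.measurable.comp (measurable_flow hε hε1 _)
  have hm : Measurable fun Y : Config N => evolvedDensity ε W₀ s Y * ψ (Y ∘ e) :=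
    hWm.mul (hψ.comp (measurable_pi_lambda _ fun k => measurable_pi_apply _))
  calc ∫⁻ Z in {Z | WellPosed ε Z}, W₀ Z * ψ (flow ε s Z ∘ e)
      = ∫⁻ Z in {Z | WellPosed ε Z},
          evolvedDensity ε W₀ s (flow ε s Z) * ψ (flow ε s Z ∘ e) := by
        -- The density is constant along the flow: `W₀ Z` is the evolved density at the state
        -- reached at time `s`.
        refine setLIntegral_congr_fun (measurableSet_wellPosed hε hε1) fun Z hZ => ?_
        have := WellPosed.flow_flow hε hε1 hZ (-s) s
        rw [neg_add_cancel, flow_zero] at this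
        simp only [evolvedDensity, this]
    _ ≤ ∫⁻ Y, evolvedDensity ε W₀ s Y * ψ (Y ∘ e) := lintegral_flow_le hε hε1 hs hm
    _ ≤ _ := lintegral_mul_comp_le hWm (fun σ Z => by
        rw [evolvedDensity, flow_comp_perm hε hε1, hW.symm]; rfl) h hψ hK0 he

end Marginals

/-! ### The backward cluster as a dissolving group. -/

section Cluster

variable {ε : ℝ} {N k : ℕ} {ζ : ℝ → Config N} {t : ℝ} {p : Fin N} {i : Fin k → Fin N}
  {τ : Fin k → ℝ}

/-- The number of particles that have joined the cluster when one goes back in time to `s`. -/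
noncomputable def joined (τ : Fin k → ℝ) (s : ℝ) : ℕ :=
  sInf {n : ℕ | ∀ r : Fin k, n ≤ r → τ r ≤ s}

/-- As the joining times decrease, the particles collected before reaching `s` form an initial
segment of the cluster. -/
lemma lt_joined_iff (hτ : StrictAnti τ) {s : ℝ} {r : Fin k} : (r : ℕ) < joined τ s ↔ s < τ r := by
  have hne : {n : ℕ | ∀ r : Fin k, n ≤ r → τ r ≤ s}.Nonempty :=
    ⟨k, fun r hr => absurd r.2 (not_lt.2 hr)⟩
  constructor
  · intro h
    have := Nat.notMem_of_lt_sInf h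
    simp only [mem_ofPred_eq, not_forall, not_le] at this
    obtain ⟨r', hr, hs⟩ := this
    exact hs.trans_le (hτ.antitone hr)
  · intro h
    by_contra hcon
    exact absurd (Nat.sInf_mem hne r (not_lt.1 hcon)) (not_le.2 h)

lemma joined_le (τ : Fin k → ℝ) (s : ℝ) : joined τ s ≤ k :=
  Nat.sInf_le fun r hr => absurd r.2 (not_lt.2 hr)

lemma joined_anti (τ : Fin k → ℝ) : Antitone (joined τ) := fun s _ h =>
  Nat.sInf_le fun r hr => (Nat.sInf_mem (s := {n : ℕ | ∀ r : Fin k, n ≤ r → τ r ≤ s})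
    ⟨k, fun r hr => absurd r.2 (not_lt.2 hr)⟩ r hr).trans h

lemma joined_eq_zero (τ : Fin k → ℝ) {s : ℝ} (h : ∀ r, τ r ≤ s) : joined τ s = 0 :=
  Nat.le_zero.1 (Nat.sInf_le fun r _ => h r)

lemma joined_eq_card (hτ : StrictAnti τ) {s : ℝ} (h : ∀ r, s < τ r) : joined τ s = k := by
  refine le_antisymm (joined_le τ s) (not_lt.1 fun hlt => ?_)
  exact absurd ((lt_joined_iff hτ (r := ⟨_, hlt⟩)).2 (h _)) (lt_irrefl _)

/-- The members of the cluster of `p` in the order in which they join. -/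
def member (p : Fin N) (i : Fin k → Fin N) : ℕ → Fin N
  | 0 => p
  | r + 1 => if h : r < k then i ⟨r, h⟩ else p

/-- The first `n` members of the cluster. -/
def members (p : Fin N) (i : Fin k → Fin N) (n : ℕ) (x : Fin n) : Fin N := member p i x

lemma mem_collectedAfter_iff (hτ : StrictAnti τ) {s : ℝ} {a : Fin N} :
    a ∈ collectedAfter p i τ s ↔ a ∈ range (members p i (joined τ s + 1)) := by
  constructor
  · rintro (rfl | ⟨r, hr, rfl⟩)
    · exact ⟨0, rfl⟩
    · refine ⟨⟨r + 1, by have := (lt_joined_iff hτ).2 hr; omega⟩, ?_⟩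
      simp [members, member]
  · rintro ⟨⟨x, hx⟩, rfl⟩
    cases x with
    | zero => exact Or.inl rfl
    | succ r =>
      have hrk : r < k := by have := joined_le τ s; omega
      refine Or.inr ⟨⟨r, hrk⟩, (lt_joined_iff hτ).1 (by simpa using hx), ?_⟩
      simp [members, member, hrk]

/-- Each new member lies outside the group collected so far, which contains all earlier members
because the times are strictly decreasing. -/
lemma IsBackwardCluster.injective_members (hc : IsBackwardCluster ε ζ t p i τ) {n : ℕ}
    (hn : n ≤ k + 1) : Function.Injective (members p i n) := by
  have key : ∀ x y : ℕ, x < y → y < n → member p i x ≠ member p i y := by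
    intro x y hxy hy heq
    obtain ⟨r, rfl⟩ : ∃ r, y = r + 1 := ⟨y - 1, by omega⟩
    have hr : r < k := by omega
    have hnew := hc.new ⟨r, hr⟩
    have hmem : member p i (r + 1) = i ⟨r, hr⟩ := by simp [member, hr]
    rw [hmem] at heq
    refine hnew ?_
    rw [← heq]
    cases x with
    | zero => exact Or.inl rfl
    | succ x =>
      have hx : x < k := by omega
      refine Or.inr ⟨⟨x, hx⟩, hc.times_anti (Fin.mk_lt_mk.2 (by omega)), ?_⟩
      simp [member, hx]
  intro x y hxy
  by_contra hne
  rcases lt_or_gt_of_ne (Fin.val_injective.ne hne) with h | h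
  · exact key x y h y.2 hxy
  · exact key y x h x.2 hxy.symm

/-- One time step backwards along the cluster. -/
lemma IsBackwardCluster.le_levelOp (hc : IsBackwardCluster ε ζ t p i τ) (hε : 0 < ε) (hε1 : ε ≤ 1)
    (hζ : IsTrajectory ε ζ) {a h : ℝ} (hh : 0 ≤ h) (ha : 0 ≤ a) (hat : a + h ≤ t)
    (hslow : ζ a ∈ slow ε h) (hone : (collisionTimes ε ζ ∩ Ioc a (a + h)).Subsingleton)
    (Φ : ∀ m, Config m → ℝ≥0∞) :
    Φ (joined τ (a + h) + 1) (ζ (a + h) ∘ members p i (joined τ (a + h) + 1)) ≤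
      levelOp ε h Φ (joined τ a + 1) (ζ a ∘ members p i (joined τ a + 1)) := by
  have hτ := hc.times_anti
  have hζ' := hζ.trajOn a (a + h)
  have hcol : ∀ r, τ r ∈ collisionTimes ε ζ := fun r => by
    obtain ⟨b, -, hb⟩ := hc.joins r
    exact ⟨_, _, hb⟩
  -- Either nobody joins in the window, and exhaustiveness closes the group to outsiders, or
  -- somebody does, and forwards in time this is the departure of the last member.
  rcases (joined_anti τ (by linarith : a ≤ a + h)).eq_or_lt with heq | hlt
  · rw [heq]
    refine le_trans (Step.le_stepOp ?_) le_self_add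
    refine group_step hε hε1 hh hζ' hslow hone
      (hc.injective_members (by have := joined_le τ a; omega)) fun s hs x l hxl => ?_
    have hjs : joined τ s = joined τ a :=
      le_antisymm (joined_anti τ hs.1.le) (heq.ge.trans (joined_anti τ hs.2))
    by_contra hl
    obtain ⟨r, hr, -⟩ := hc.exhaustive s ⟨ha.trans hs.1.le, hs.2.trans hat⟩ _
      ((mem_collectedAfter_iff hτ).2 (by rw [hjs]; exact mem_range_self x)) l
      (fun hl' => hl (by rw [mem_collectedAfter_iff hτ, hjs] at hl'; exact hl')) hxl
    have h1 : (r : ℕ) < joined τ a := (lt_joined_iff hτ).2 (by rw [hr]; exact hs.1)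
    rw [← heq, lt_joined_iff hτ, hr] at h1
    exact absurd hs.2 (not_le.2 h1)
  · set n := joined τ (a + h) with hn
    have hnk : n < k := hlt.trans_le (joined_le τ a)
    have hwin : ∀ r : Fin k, n ≤ r → (r : ℕ) < joined τ a → τ r ∈ Ioc a (a + h) := by
      intro r hr hr'
      refine ⟨(lt_joined_iff hτ).1 hr', not_lt.1 fun hcon => ?_⟩
      exact absurd ((lt_joined_iff hτ).2 hcon) (not_lt.2 hr)
    -- Two joinings would be at two different collision times, but the window contains at most one.
    have hja : joined τ a = n + 1 := by
      by_contra hne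
      have hlt' : n + 1 < joined τ a := by omega
      have hk1 : n + 1 < k := hlt'.trans_le (joined_le τ a)
      have := hone ⟨hcol _, hwin ⟨n, hnk⟩ le_rfl hlt⟩ ⟨hcol _, hwin ⟨n + 1, hk1⟩ (by simp) hlt'⟩
      have := congrArg Fin.val (hτ.injective this)
      simp at this
    have hr := hwin ⟨n, hnk⟩ le_rfl hlt
    have hjr : joined τ (τ ⟨n, hnk⟩) = n := by
      refine le_antisymm (not_lt.1 fun hcon => ?_) (joined_anti τ hr.2)
      exact lt_irrefl _ ((lt_joined_iff hτ (r := ⟨n, hnk⟩)).1 hcon)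
    obtain ⟨b, hb, hcont⟩ := hc.joins ⟨n, hnk⟩
    rw [mem_collectedAfter_iff hτ, hjr] at hb
    obtain ⟨x, rfl⟩ := hb
    have hlast : i ⟨n, hnk⟩ = members p i (n + 1 + 1) (Fin.last (n + 1)) := by
      simp [members, member, hnk]
    rw [hlast] at hcont
    have hmem : ∀ y : Fin (n + 1), members p i (n + 1) y = members p i (n + 1 + 1) y.castSucc :=
      fun _ => rfl
    rw [hmem] at hcont
    -- The group taken here includes the departing particle in the last place, and the state after
    -- the step is restricted to the others.
    obtain ⟨hC, hcoll⟩ := group_mem_Coll hε hε1 hζ' hslow hone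
      (hc.injective_members (by omega)) hr hcont
    rw [hja]
    refine le_trans ?_ (le_add_self (a := shedOp ε h (Φ (n + 1))
      (ζ a ∘ members p i (n + 1 + 1))))
    refine le_trans (le_of_eq ?_) (Finset.single_le_sum
      (f := fun b : Fin (n + 1) => (Coll ε h b.castSucc (Fin.last (n + 1))).indicator
        (fun Z => Φ (n + 1) (dropLast (collide ε b.castSucc (Fin.last (n + 1)) (freeFlow h Z))))
        (ζ a ∘ members p i (n + 1 + 1))) (fun _ _ => zero_le) (Finset.mem_univ x))
    simp only [indicator_of_mem hC, hcoll]
    rfl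

lemma IsBackwardCluster.le_levelOp_iterate (hc : IsBackwardCluster ε ζ t p i τ) (hε : 0 < ε)
    (hε1 : ε ≤ 1) (hζ : IsTrajectory ε ζ) {h : ℝ} (hh : 0 ≤ h)
    (hmesh : ∀ c, 0 ≤ c → c + h ≤ t →
      ζ c ∈ slow ε h ∧ (collisionTimes ε ζ ∩ Ioc c (c + h)).Subsingleton)
    (Φ : ∀ m, Config m → ℝ≥0∞) : ∀ (M : ℕ) (a : ℝ), 0 ≤ a → a + M * h ≤ t →
    Φ (joined τ (a + M * h) + 1) (ζ (a + M * h) ∘ members p i (joined τ (a + M * h) + 1)) ≤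
      (levelOp ε h)^[M] Φ (joined τ a + 1) (ζ a ∘ members p i (joined τ a + 1))
  | 0, a, _, _ => by
    have heq : a + ((0 : ℕ) : ℝ) * h = a := by simp
    rw [heq]
    exact le_rfl
  | M + 1, a, ha, hat => by
    have heq : a + ((M + 1 : ℕ) : ℝ) * h = a + h + M * h := by push_cast; ring
    have hMh : 0 ≤ M * h := by positivity
    rw [heq] at hat ⊢
    have hm := hmesh a ha (by linarith)
    rw [Function.iterate_succ_apply']
    exact (hc.le_levelOp_iterate hε hε1 hζ hh hmesh Φ M (a + h) (by linarith) hat).trans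
      (hc.le_levelOp hε hε1 hζ hh ha (by linarith) hm.1 hm.2 _)

/-- The cluster is counted by `treeCount`, for all fine discretisations. Time is cut in slices of
length `T`. -/
lemma IsBackwardCluster.eventually_one_le_treeCount (hc : IsBackwardCluster ε ζ t p i τ)
    (hε : 0 < ε) (hε1 : ε ≤ 1) (hζ : IsTrajectory ε ζ) {T : ℝ} (hT : 0 < T) {l n j : ℕ}
    (hl : (l + 1) * T ≤ t) (hj : joined τ (t - l * T) = j)
    (hn : joined τ (t - (l + 1) * T) = j + n) :
    ∀ᶠ q : ℕ in Filter.atTop, 1 ≤ treeCount ε (T / (q + 1)) (1 + j) (q + 1) (l * (q + 1))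
      (1 + j + n) (ζ (t - (l + 1) * T) ∘ members p i (1 + j + n)) := by
  obtain ⟨δ, hδ, H⟩ := (hζ.trajOn 0 t).exists_mesh hε
  have hlim := (Filter.tendsto_add_atTop_iff_nat 1).2 (tendsto_const_div_atTop_nhds_zero_nat T)
  filter_upwards [hlim.eventually (gt_mem_nhds hδ)] with q hq
  have hpos : 0 < T / (q + 1) := by positivity
  have hmesh := H _ hpos (by exact_mod_cast hq)
  have hq0 : (q : ℝ) + 1 ≠ 0 := by positivity
  have e1 : t - (l + 1) * T + ((q + 1 : ℕ) : ℝ) * (T / (q + 1)) = t - l * T := by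
    push_cast; field_simp; ring
  have e2 : t - l * T + ((l * (q + 1) : ℕ) : ℝ) * (T / (q + 1)) = t := by
    push_cast; field_simp; ring
  have hlT : 0 ≤ l * T := by positivity
  have h2 := hc.le_levelOp_iterate hε hε1 hζ hpos.le hmesh oneParticle (l * (q + 1)) (t - l * T)
    (by linarith) e2.le
  rw [e2, joined_eq_zero τ fun r => (hc.times_mem r).2] at h2
  have h1 := hc.le_levelOp_iterate hε hε1 hζ hpos.le hmesh
    (fun m Z => if m = 1 + j then
      (levelOp ε (T / (q + 1)))^[l * (q + 1)] oneParticle m Z else 0) (q + 1) (t - (l + 1) * T)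
    (by linarith) (by rw [e1]; linarith)
  rw [e1, if_pos (by rw [hj, add_comm])] at h1
  have h3 := h2.trans h1
  have hK : joined τ (t - (l + 1) * T) + 1 = 1 + j + n := by omega
  rw [hK] at h3
  exact le_trans (by simp [oneParticle]) h3

end Cluster

/-! ### Summation over slices and the tail bound. -/

section Tail

variable {ε : ℝ} {N k : ℕ}

/-- At time `0` the spheres are strictly apart, so nobody joins exactly then. Hence all members are
counted at time `0`, where joining times are compared strictly. -/
lemma IsBackwardCluster.times_pos {ζ : ℝ → Config N} {t : ℝ} {p : Fin N} {i : Fin k → Fin N}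
    {τ : Fin k → ℝ} (hc : IsBackwardCluster ε ζ t p i τ) (h0 : ζ 0 ∈ phaseSpace ε N) (r : Fin k) :
    0 < τ r := by
  refine (hc.times_mem r).1.lt_of_ne fun h => ?_
  obtain ⟨a, -, ha⟩ := hc.joins r
  rw [← h] at ha
  exact (h0 _ _ ha.1).ne' ha.2

/-- The well-posed configurations for which the particles `e` are counted by `treeCount` at the time
`s`, for all fine discretisations. -/
def treeEvent (ε s T : ℝ) (l n j : ℕ) (e : Fin (1 + j + n) → Fin N) : Set (Config N) :=
  {Z | WellPosed ε Z ∧ ∀ᶠ q : ℕ in Filter.atTop, 1 ≤ treeCount ε (T / (q + 1)) (1 + j) (q + 1)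
    (l * (q + 1)) (1 + j + n) (flow ε s Z ∘ e)}

lemma exists_withDensity_treeEvent_le {β : ℝ} (hβ : 0 < β) :
    ∃ c C : ℝ, 0 < c ∧ 0 < C ∧ ∀ {N : ℕ} {ε A s T : ℝ} {l n j : ℕ} {W₀ : Config N → ℝ≥0∞}
      {e : Fin (1 + j + n) → Fin N}, 0 < ε → ε ≤ 1 → 0 < A → 0 ≤ s → 0 ≤ T →
      IsSymmetricDensity ε W₀ → MarginalBound β A (evolvedDensity ε W₀ s) → Function.Injective e →
      (volume.withDensity W₀) (treeEvent ε s T l n j e) ≤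
        ENNReal.ofReal (c * A * (A * C * T * ε ^ 2) ^ n * (A * C * (l * T) * ε ^ 2) ^ j) := by
  obtain ⟨c, C, hc, hC, H⟩ := exists_lintegral_treeCount_le hβ
  refine ⟨c, C, hc, hC, ?_⟩
  intro N ε A s T l n j W₀ e hε hε1 hA hs hT hW hMB he
  have hG := measurableSet_wellPosed (N := N) hε hε1
  set F : ℕ → Config N → ℝ≥0∞ := fun q Z => W₀ Z * treeCount ε (T / (q + 1)) (1 + j) (q + 1)
    (l * (q + 1)) (1 + j + n) (flow ε s Z ∘ e) with hF
  have hflow : Measurable fun Z : Config N => flow ε s Z ∘ e :=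
    (measurable_pi_lambda _ fun k => measurable_pi_apply _).comp (measurable_flow hε hε1 s)
  have hm : ∀ q : ℕ, Measurable fun Z : Config N => treeCount ε (T / (q + 1)) (1 + j) (q + 1)
    (l * (q + 1)) (1 + j + n) (flow ε s Z ∘ e) := fun q => (measurable_treeCount _ _ _ _).comp hflow
  have hFm : ∀ q, Measurable (F q) := fun q => hW.measurable.mul (hm q)
  have hS : MeasurableSet (treeEvent ε s T l n j e) := by
    have : treeEvent ε s T l n j e = {Z | WellPosed ε Z} ∩ ⋃ r : ℕ, ⋂ q : ℕ, ⋂ _ : r ≤ q,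
        {Z | 1 ≤ treeCount ε (T / (q + 1)) (1 + j) (q + 1) (l * (q + 1)) (1 + j + n)
          (flow ε s Z ∘ e)} := by
      ext Z
      simp only [treeEvent, Filter.eventually_atTop, mem_ofPred_eq, mem_inter_iff, mem_iUnion,
        mem_iInter]
    rw [this]
    exact hG.inter (.iUnion fun r => .iInter fun q => .iInter fun _ =>
      measurableSet_le measurable_const (hm q))
  rw [withDensity_apply _ hS]
  calc ∫⁻ Z in treeEvent ε s T l n j e, W₀ Z
      -- On the event the count is eventually at least one, so the density is below the lower limit
      -- of density times count, and Fatou's lemma reduces the estimate to a fixed mesh.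
      ≤ ∫⁻ Z in treeEvent ε s T l n j e, Filter.liminf (fun q => F q Z) Filter.atTop := by
        refine setLIntegral_mono' hS fun Z hZ => ?_
        refine Filter.le_liminf_of_le (by isBoundedDefault) ?_
        filter_upwards [hZ.2] with q hq
        exact le_mul_of_one_le_right' hq
    _ ≤ ∫⁻ Z in {Z | WellPosed ε Z}, Filter.liminf (fun q => F q Z) Filter.atTop :=
        lintegral_mono_set fun Z hZ => hZ.1
    _ ≤ Filter.liminf (fun q => ∫⁻ Z in {Z | WellPosed ε Z}, F q Z) Filter.atTop :=
        lintegral_liminf_le hFm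
    _ ≤ _ := by
        refine Filter.liminf_le_of_le (by isBoundedDefault) fun b hb => ?_
        obtain ⟨q, hq⟩ := hb.exists
        refine hq.trans ((lintegral_density_mul_flow_le hε hε1 hs hW hMB
          (measurable_treeCount _ _ _ _) (by omega) he).trans ?_)
        refine (mul_le_mul_right (H hε hε1 (div_nonneg hT (by positivity))) _).trans ?_
        rw [← ENNReal.ofReal_mul (by positivity)]
        refine ENNReal.ofReal_le_ofReal (le_of_eq ?_)
        -- The number of steps times their length is the duration of each stage, so the bound is the
        -- same for every mesh.
        have h1 : T / ((q : ℝ) + 1) * ((q + 1 : ℕ) : ℝ) = T := by push_cast; field_simp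
        have h2 : T / ((q : ℝ) + 1) * ((l * (q + 1) : ℕ) : ℝ) = l * T := by push_cast; field_simp
        rw [h1, h2]
        simp only [mul_pow, pow_add, pow_one]
        ring

/-- The clusters of `n + j + 1` particles with a choice of the order of the members. -/
lemma withDensity_iUnion_treeEvent_le {B s T : ℝ} {l n j : ℕ} {W₀ : Config N → ℝ≥0∞} (p : Fin N)
    (h : ∀ e : Fin (1 + j + n) → Fin N, Function.Injective e →
      (volume.withDensity W₀) (treeEvent ε s T l n j e) ≤ ENNReal.ofReal B) :
    (volume.withDensity W₀) {Z | ∃ f : Fin (n + j) → Fin N,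
      Function.Injective (members p f (1 + j + n)) ∧
        Z ∈ treeEvent ε s T l n j (members p f (1 + j + n))} ≤
      ENNReal.ofReal ((N : ℝ) ^ (n + j) * B) := by
  calc _ ≤ (volume.withDensity W₀) (⋃ f ∈ (Finset.univ : Finset (Fin (n + j) → Fin N)),
        {Z | Function.Injective (members p f (1 + j + n)) ∧
          Z ∈ treeEvent ε s T l n j (members p f (1 + j + n))}) := by
        refine measure_mono ?_
        rintro Z ⟨f, hf⟩
        exact mem_biUnion (Finset.mem_coe.2 (Finset.mem_univ f)) hf
    _ ≤ ∑ f : Fin (n + j) → Fin N, ENNReal.ofReal B := by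
        refine (measure_biUnion_finset_le _ _).trans (Finset.sum_le_sum fun f _ => ?_)
        by_cases hf : Function.Injective (members p f (1 + j + n))
        · exact (measure_mono fun Z hZ => hZ.2).trans (h _ hf)
        · simp [hf]
    _ = _ := by
        rw [Finset.sum_const, Finset.card_univ, Fintype.card_fun, Fintype.card_fin,
          Fintype.card_fin,
          nsmul_eq_mul, ENNReal.ofReal_mul (by positivity), ENNReal.ofReal_pow (by positivity),
          ENNReal.ofReal_natCast]
        push_cast
        rfl

/-- Some time slice multiplies the size of the cluster. -/
lemma exists_slice {κ : ℕ → ℕ} {m : ℕ} (hm : 0 < m) {y : ℝ} (h0 : κ 0 = 0) (hκ : y ^ m ≤ κ m) :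
    ∃ l < m, (κ l : ℝ) ≤ y ^ l ∧ y ^ (l + 1) ≤ κ (l + 1) := by
  classical
  -- The slice sought is the first one at whose end the power of `y` is reached; at its beginning
  -- the size is still below the previous power.
  have hex : ∃ l, y ^ (l + 1) ≤ κ (l + 1) := ⟨m - 1, by rwa [Nat.sub_add_cancel hm]⟩
  refine ⟨Nat.find hex, ?_, ?_, Nat.find_spec hex⟩
  · have : Nat.find hex ≤ m - 1 := Nat.find_min' hex (by rwa [Nat.sub_add_cancel hm])
    omega
  · rcases hl : Nat.find hex with _ | l
    · simp [h0]
    · exact (not_le.1 (Nat.find_min hex (m := l) (by omega))).le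

/-- The sizes at the slice boundaries, counted back from `t`, run from `0` to `k`, so `exists_slice`
supplies a slice with fast growth. Only the members collected up to its early end matter, and their
labels form the choice `f`. -/
lemma clusterCardEvent_subset [NeZero N] (hε : 0 < ε) (hε1 : ε ≤ 1) {t y : ℝ} (ht : 0 < t) {m : ℕ}
    (hm : 0 < m) (hy : y ^ m ≤ k) :
    clusterCardEvent ε N t k ⊆ ⋃ x ∈ ((Finset.range m ×ˢ Finset.range (k + 1)) ×ˢ
        Finset.range (k + 1)).filter fun x => (x.2 : ℝ) ≤ y ^ x.1.1 ∧
          y ^ (x.1.1 + 1) ≤ (x.1.2 + x.2 : ℝ),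
      {Z | ∃ f : Fin (x.1.2 + x.2) → Fin N,
        Function.Injective (members 0 f (1 + x.2 + x.1.2)) ∧
        Z ∈ treeEvent ε (t - (x.1.1 + 1) * (t / m)) (t / m) x.1.1 x.1.2 x.2
          (members 0 f (1 + x.2 + x.1.2))} := by
  rintro Z ⟨hZ, hWP, i, τ, hc⟩
  have hpos := hc.times_pos (by rwa [flow_zero])
  have hT : 0 < t / m := by positivity
  have hmT : (m : ℝ) * (t / m) = t := by field_simp
  set κ : ℕ → ℕ := fun l => joined τ (t - l * (t / m)) with hκ
  have hκ0 : κ 0 = 0 := joined_eq_zero τ fun r => by simpa using (hc.times_mem r).2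
  have hκm : κ m = k := joined_eq_card hc.times_anti fun r => by rw [hmT, sub_self]; exact hpos r
  obtain ⟨l, hl, h1, h2⟩ := exists_slice hm hκ0 (by rwa [hκm])
  have hmono : κ l ≤ κ (l + 1) := joined_anti τ (by push_cast; nlinarith)
  have hle : κ (l + 1) ≤ k := joined_le _ _
  obtain ⟨n, hn⟩ := Nat.exists_eq_add_of_le hmono
  have hnj : n + κ l ≤ k := by omega
  -- Members that join still earlier in time play no part, so truncating the list of labels does not
  -- alter the group.
  have hmem : members 0 (fun r : Fin (n + κ l) => i (Fin.castLE hnj r)) (1 + κ l + n) =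
      members 0 i (1 + κ l + n) := by
    funext ⟨x, hx⟩
    cases x with
    | zero => rfl
    | succ x =>
      have e1 : x < n + κ l := by omega
      have e2 : x < k := by omega
      simp [members, member, e1, e2]
  refine mem_biUnion (x := ((l, n), κ l)) ?_ ⟨fun r => i (Fin.castLE hnj r), ?_, ?_⟩
  · simp only [Finset.coe_filter, Finset.mem_product, Finset.mem_range, mem_ofPred_eq]
    refine ⟨⟨⟨hl, by omega⟩, by omega⟩, h1, ?_⟩
    rw [hn] at h2
    push_cast at h2
    linarith
  · rw [hmem]
    exact hc.injective_members (by omega)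
  · rw [hmem]
    refine ⟨hWP, ?_⟩
    refine hc.eventually_one_le_treeCount hε hε1 hWP.isTrajectory_flow hT ?_ rfl ?_
    · have h3 : ((l : ℝ) + 1) ≤ m := by exact_mod_cast hl
      calc ((l : ℝ) + 1) * (t / m) ≤ m * (t / m) := by gcongr
        _ = t := hmT
    · rw [← hn]; simp [hκ]

/-- From `j ≤ y ^ l` and `y ^ (l+1) ≤ n + j` follows `y j ≤ n + j`, hence `j ≤ n` and `y ≤ n + j`.
Then `-6n + y j ≤ -5n + j`, which leaves room for `-y/4` and for the summable factor `exp (-n - j)`.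
-/
lemma pow_mul_pow_le_exp {a b y : ℝ} {l n j : ℕ} (ha : 0 ≤ a) (ha' : a ≤ Real.exp (-6))
    (hb : 0 ≤ b) (hb' : b ≤ Real.exp y) (hy : 2 ≤ y) (h1 : (j : ℝ) ≤ y ^ l)
    (h2 : y ^ (l + 1) ≤ (n + j : ℝ)) :
    a ^ n * b ^ j ≤ Real.exp (-(1 / 4) * y) * ((1 / 2) ^ n * (1 / 2) ^ j) := by
  have hhalf : ∀ i : ℕ, Real.exp (-(i : ℝ)) ≤ (1 / 2) ^ i := by
    intro i
    have h3 : Real.exp (-1) ≤ 1 / 2 := by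
      rw [Real.exp_neg, one_div]
      gcongr
      linarith [Real.add_one_le_exp (1 : ℝ)]
    calc Real.exp (-(i : ℝ)) = Real.exp (-1) ^ i := by rw [← Real.exp_nat_mul]; congr 1; ring
      _ ≤ _ := by gcongr
  have h3 : y * j ≤ n + j := by
    refine le_trans ?_ h2
    rw [pow_succ']
    gcongr
  have h4 : y ≤ n + j := by
    refine le_trans ?_ h2
    exact le_self_pow₀ (by linarith) (by omega)
  have h5 : (j : ℝ) ≤ n := by nlinarith [Nat.cast_nonneg (α := ℝ) j]
  calc a ^ n * b ^ j ≤ Real.exp (-6) ^ n * Real.exp y ^ j := by gcongr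
    _ = Real.exp (-6 * n + y * j) := by
      rw [← Real.exp_nat_mul, ← Real.exp_nat_mul, ← Real.exp_add]; congr 1; ring
    _ ≤ Real.exp (-(1 / 4) * y + (-n + -j)) := by
      refine Real.exp_le_exp.2 ?_
      linarith
    _ = Real.exp (-(1 / 4) * y) * (Real.exp (-n) * Real.exp (-j)) := by
      rw [Real.exp_add, Real.exp_add]
    _ ≤ _ := by
      gcongr
      · exact hhalf n
      · exact hhalf j

/-- The tail bound, for `m` time slices that are short. -/
lemma exists_clusterProb_le {β A : ℝ} (hβ : 0 < β) (hA : 0 < A) :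
    ∃ c C : ℝ, 0 < c ∧ 0 < C ∧ ∀ {N m k : ℕ} [NeZero N] {ε t y : ℝ} {W₀ : Config N → ℝ≥0∞},
      0 < ε → ε ^ 2 * N = 1 → IsSymmetricDensity ε W₀ → 0 < m → 0 < t →
      C * (t / m) ≤ Real.exp (-6) →
      (∀ l < m, MarginalBound β A (evolvedDensity ε W₀ (t - (l + 1) * (t / m)))) →
      2 ≤ y → C * t ≤ y → y ^ m ≤ k →
      clusterProb ε W₀ t k ≤ ENNReal.ofReal (c * m * Real.exp (-(1 / 4) * y)) := by
  obtain ⟨c, C, hc, hC, H⟩ := exists_withDensity_treeEvent_le hβ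
  refine ⟨4 * (c * A), A * C, by positivity, by positivity, ?_⟩
  intro N m k _ ε t y W₀ hε hεN hW hm ht hsmall hMB hy hty hyk
  have hN : (1 : ℝ) ≤ N := by exact_mod_cast Nat.one_le_iff_ne_zero.2 (NeZero.ne N)
  have hε1 : ε ≤ 1 := by nlinarith
  have hT : 0 ≤ t / m := by positivity
  have hmT : (m : ℝ) * (t / m) = t := by field_simp
  set D := c * A * Real.exp (-(1 / 4) * y) with hD
  have hterm : ∀ x ∈ ((Finset.range m ×ˢ Finset.range (k + 1)) ×ˢ
        Finset.range (k + 1)).filter fun x => (x.2 : ℝ) ≤ y ^ x.1.1 ∧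
          y ^ (x.1.1 + 1) ≤ (x.1.2 + x.2 : ℝ),
      (volume.withDensity W₀) {Z | ∃ f : Fin (x.1.2 + x.2) → Fin N,
        Function.Injective (members 0 f (1 + x.2 + x.1.2)) ∧
        Z ∈ treeEvent ε (t - (x.1.1 + 1) * (t / m)) (t / m) x.1.1 x.1.2 x.2
          (members 0 f (1 + x.2 + x.1.2))} ≤
      ENNReal.ofReal (D * ((1 / 2) ^ x.1.2 * (1 / 2) ^ x.2)) := by
    rintro ⟨⟨l, n⟩, j⟩ hx
    simp only [Finset.mem_filter, Finset.mem_product, Finset.mem_range] at hx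
    obtain ⟨⟨⟨hl, -⟩, -⟩, h1, h2⟩ := hx
    have hlm : (l : ℝ) + 1 ≤ m := by exact_mod_cast hl
    have hlT : ((l : ℝ) + 1) * (t / m) ≤ t := by
      calc ((l : ℝ) + 1) * (t / m) ≤ m * (t / m) := by gcongr
        _ = t := hmT
    refine (withDensity_iUnion_treeEvent_le 0 fun e he =>
      H hε hε1 hA (sub_nonneg.2 hlT) hT hW (hMB l hl) he).trans (ENNReal.ofReal_le_ofReal ?_)
    -- The scaling `ε² N = 1` makes the number of labellings cancel the collision cross sections,
    -- and all dependence on `N` disappears.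
    have hNε : (N : ℝ) ^ (n + j) * (ε ^ 2) ^ n * (ε ^ 2) ^ j = 1 := by
      rw [mul_assoc, ← pow_add, ← mul_pow, mul_comm (N : ℝ), hεN, one_pow]
    have heq : (N : ℝ) ^ (n + j) * (c * A * (A * C * (t / m) * ε ^ 2) ^ n *
        (A * C * (l * (t / m)) * ε ^ 2) ^ j) =
        c * A * ((A * C * (t / m)) ^ n * (A * C * (l * (t / m))) ^ j) := by
      rw [mul_pow _ (ε ^ 2) n, mul_pow _ (ε ^ 2) j]
      linear_combination (c * A * ((A * C * (t / m)) ^ n * (A * C * (l * (t / m))) ^ j)) * hNε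
    rw [heq, hD, mul_assoc (c * A)]
    refine mul_le_mul_of_nonneg_left ?_ (by positivity)
    refine pow_mul_pow_le_exp (by positivity) hsmall (by positivity) ?_ hy h1 h2
    calc A * C * (l * (t / m)) ≤ A * C * t := by
          refine mul_le_mul_of_nonneg_left ?_ (by positivity)
          linarith [add_mul (l : ℝ) 1 (t / m)]
      _ ≤ y := hty
      _ ≤ Real.exp y := by linarith [Real.add_one_le_exp y]
  have hgeom : ∑ n ∈ Finset.range (k + 1), (1 / 2 : ℝ) ^ n ≤ 2 := by
    rw [geom_sum_eq (by norm_num), div_le_iff_of_neg (by norm_num)]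
    have : (0 : ℝ) < (1 / 2) ^ (k + 1) := by positivity
    linarith
  have hgeom0 : 0 ≤ ∑ n ∈ Finset.range (k + 1), (1 / 2 : ℝ) ^ n :=
    Finset.sum_nonneg fun _ _ => by positivity
  have hD0 : 0 ≤ D := by positivity
  rw [clusterProb]
  refine (measure_mono (clusterCardEvent_subset hε hε1 ht hm hyk)).trans
    ((measure_biUnion_finset_le _ _).trans ((Finset.sum_le_sum hterm).trans ?_))
  rw [← ENNReal.ofReal_sum_of_nonneg fun _ _ => by positivity]
  refine ENNReal.ofReal_le_ofReal ?_
  -- The sum over the slices gives the factor `m`, and the two geometric sums give at most 2 each.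
  calc _ ≤ ∑ x ∈ (Finset.range m ×ˢ Finset.range (k + 1)) ×ˢ Finset.range (k + 1),
        D * ((1 / 2 : ℝ) ^ x.1.2 * (1 / 2) ^ x.2) :=
        Finset.sum_le_sum_of_subset_of_nonneg (Finset.filter_subset _ _) fun _ _ _ => by positivity
    _ = m * D * ((∑ n ∈ Finset.range (k + 1), (1 / 2 : ℝ) ^ n) *
        ∑ n ∈ Finset.range (k + 1), (1 / 2 : ℝ) ^ n) := by
        rw [Finset.sum_product, Finset.sum_product]
        simp only [← Finset.mul_sum, ← Finset.sum_mul, Finset.sum_const, Finset.card_range,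
          nsmul_eq_mul]
        ring
    _ ≤ m * D * (2 * 2) := by gcongr
    _ = 4 * (c * A) * m * Real.exp (-(1 / 4) * y) := by rw [hD]; ring

lemma clusterProb_zero [NeZero N] {W₀ : Config N → ℝ≥0∞} (hk : 0 < k) :
    clusterProb ε W₀ 0 k = 0 := by
  have : clusterCardEvent ε N 0 k = ∅ := by
    rw [Set.eq_empty_iff_forall_notMem]
    rintro Z ⟨hZ, -, i, τ, hc⟩
    exact absurd (hc.times_pos (by rwa [flow_zero]) ⟨0, hk⟩)
      (not_lt.2 (hc.times_mem ⟨0, hk⟩).2)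
  rw [clusterProb, this, measure_empty]

/-- The growth factor per slice is chosen as `y = k ^ (1/m)`, and `k₀` is so large that `y` exceeds
the thresholds of the estimate. -/
lemma exists_tail_bound {β A : ℝ} (hβ : 0 < β) (hA : 0 < A) :
    ∃ C₀ : ℝ, 0 < C₀ ∧ ∀ (m : ℕ) (t : ℝ), 0 < m → 0 < t → C₀ * (t / m) ≤ Real.exp (-6) →
      ∃ (k₀ : ℕ) (C : ℝ), 0 < C ∧ ∀ (N : ℕ) [NeZero N] (ε : ℝ), 0 < ε → ε ^ 2 * N = 1 →
        ∀ W₀ : Config N → ENNReal, IsSymmetricDensity ε W₀ →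
        (∀ l < m, MarginalBound β A (evolvedDensity ε W₀ (t - (l + 1) * (t / m)))) →
        ∀ k : ℕ, k₀ < k → clusterProb ε W₀ t k ≤
          ENNReal.ofReal (C * t * Real.exp (-(1 / 4) * (k : ℝ) ^ (1 / (C * t)))) := by
  obtain ⟨c, C₀, hc, hC₀, H⟩ := exists_clusterProb_le hβ hA
  refine ⟨C₀, hC₀, fun m t hm ht hsmall => ?_⟩
  have hm1 : (1 : ℝ) ≤ m := by exact_mod_cast hm
  have hm0 : (m : ℝ) ≠ 0 := by positivity
  set Y := 2 + C₀ * t with hY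
  have hY2 : 2 ≤ Y := by linarith [mul_pos hC₀ ht]
  -- With this constant `C t = (c + 1) m`, which dominates both the prefactor `c m` and the
  -- reciprocal `m` of the exponent of `k`.
  refine ⟨⌈Y ^ m⌉₊, (c + 1) * m / t, by positivity, ?_⟩
  intro N _ ε hε hεN W₀ hW hMB k hk
  have hkY : Y ^ m ≤ k := (Nat.le_ceil _).trans (by exact_mod_cast hk.le)
  have hk1 : (1 : ℝ) ≤ k := (one_le_pow₀ (by linarith)).trans hkY
  have hyY : Y ≤ (k : ℝ) ^ (1 / (m : ℝ)) := by
    calc Y = (Y ^ m) ^ (1 / (m : ℝ)) := by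
          rw [one_div, Real.pow_rpow_inv_natCast (by linarith) hm.ne']
      _ ≤ _ := Real.rpow_le_rpow (by positivity) hkY (by positivity)
  have hyk : ((k : ℝ) ^ (1 / (m : ℝ))) ^ m ≤ k := by
    rw [one_div, Real.rpow_inv_natCast_pow (by positivity) hm.ne']
  have hCt : (c + 1) * m / t * t = (c + 1) * m := by field_simp
  refine (H hε hεN hW hm ht hsmall hMB (hY2.trans hyY) (le_trans (by linarith) hyY) hyk).trans
    (ENNReal.ofReal_le_ofReal ?_)
  rw [hCt]
  have hexp : (k : ℝ) ^ (1 / ((c + 1) * m)) ≤ (k : ℝ) ^ (1 / (m : ℝ)) := by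
    refine Real.rpow_le_rpow_of_exponent_le hk1 (one_div_le_one_div_of_le (by positivity) ?_)
    nlinarith
  refine mul_le_mul ?_ (Real.exp_le_exp.2 (by linarith)) (Real.exp_pos _).le (by positivity)
  gcongr
  linarith

end Tail

end HardSpheres

/-- In the first part the number of slices is chosen so that each is short enough, and the bounds at
all times cover their starting times. In the second part `t` itself is so short that a single slice,
which starts at time `0`, suffices. -/
theorem corollary1 (β A : ℝ) (hβ : 0 < β) (hA : 0 < A) :
    (∀ T : ℝ, 0 < T → ∀ t ∈ Set.Icc 0 T,
      ∃ (k₀ : ℕ) (C : ℝ), 0 < C ∧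
        ∀ (N : ℕ) [NeZero N] (ε : ℝ), 0 < ε → ε ^ 2 * N = 1 →
        ∀ W₀ : HardSpheres.Config N → ENNReal, HardSpheres.IsSymmetricDensity ε W₀ →
        (∀ s ∈ Set.Icc 0 T,
          HardSpheres.MarginalBound β A (HardSpheres.evolvedDensity ε W₀ s)) →
        ∀ k : ℕ, k₀ < k →
          HardSpheres.clusterProb ε W₀ t k ≤
            ENNReal.ofReal (C * t * Real.exp (-(1 / 4) * (k : ℝ) ^ (1 / (C * t))))) ∧
    (∃ T : ℝ, 0 < T ∧ ∀ t ∈ Set.Icc 0 T,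
      ∃ (k₀ : ℕ) (C : ℝ), 0 < C ∧
        ∀ (N : ℕ) [NeZero N] (ε : ℝ), 0 < ε → ε ^ 2 * N = 1 →
        ∀ W₀ : HardSpheres.Config N → ENNReal, HardSpheres.IsSymmetricDensity ε W₀ →
        HardSpheres.MarginalBound β A W₀ →
        ∀ k : ℕ, k₀ < k →
          HardSpheres.clusterProb ε W₀ t k ≤
            ENNReal.ofReal (C * t * Real.exp (-(1 / 4) * (k : ℝ) ^ (1 / (C * t))))) := by
  obtain ⟨C₀, hC₀, H⟩ := HardSpheres.exists_tail_bound hβ hA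
  constructor
  · intro T _ t ht
    rcases ht.1.eq_or_lt with rfl | ht0
    · refine ⟨0, 1, one_pos, fun N _ ε _ _ W₀ _ _ k hk => ?_⟩
      rw [HardSpheres.clusterProb_zero hk]
      exact zero_le
    -- This `m` makes `C₀ * (t / m)` at most `exp (-6)`.
    obtain ⟨m, hm⟩ := exists_nat_gt (C₀ * t / Real.exp (-6))
    have hm0 : (0 : ℝ) < m := lt_of_le_of_lt (by positivity) hm
    obtain ⟨k₀, C, hC, h⟩ := H m t (by exact_mod_cast hm0) ht0 (by
      rw [← mul_div_assoc, div_le_iff₀ hm0, mul_comm (Real.exp (-6)),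
        ← div_le_iff₀ (Real.exp_pos _)]
      exact hm.le)
    refine ⟨k₀, C, hC, fun N _ ε hε hεN W₀ hW hMB => h N ε hε hεN W₀ hW fun l hl => hMB _ ⟨?_, ?_⟩⟩
    · have hlm : (l : ℝ) + 1 ≤ m := by exact_mod_cast hl
      rw [sub_nonneg, ← mul_div_assoc, div_le_iff₀ hm0, mul_comm t]
      gcongr
    · have : 0 ≤ ((l : ℝ) + 1) * (t / m) := by positivity
      linarith [ht.2]
  · refine ⟨Real.exp (-6) / C₀, by positivity, fun t ht => ?_⟩
    rcases ht.1.eq_or_lt with rfl | ht0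
    · refine ⟨0, 1, one_pos, fun N _ ε _ _ W₀ _ _ k hk => ?_⟩
      rw [HardSpheres.clusterProb_zero hk]
      exact zero_le
    obtain ⟨k₀, C, hC, h⟩ := H 1 t one_pos ht0 (by
      rw [Nat.cast_one, div_one, mul_comm, ← le_div_iff₀ hC₀]
      exact ht.2)
    refine ⟨k₀, C, hC, fun N _ ε hε hεN W₀ hW hMB => h N ε hε hεN W₀ hW fun l hl => ?_⟩
    obtain rfl : l = 0 := by omega
    have h0 : t - (((0 : ℕ) : ℝ) + 1) * (t / ((1 : ℕ) : ℝ)) = 0 := by simp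
    rw [h0, HardSpheres.evolvedDensity_zero]
    exact hMB
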